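/- Let $D$ be an EAS division ring, i.e. a division ring such that every (unital) ring endomorphism $D\to D$ is surjective, and let $m,n,p,q$ be arbitrary positive integers. The rank of a matrix over $D$ is the dimension of the left vector space generated by its rows (equivalently, of the right vector space generated by its columns). Let $\varphi : M_{m\times n}(D)\to M_{p\times q}(D)$ be a map that preserves adjacency: for all $A,B\in M_{m\times n}(D)$, $\operatorname{rank}(A-B)=1$ implies $\operatorname{rank}(\varphi(A)-\varphi(B))=1$. Then at least one of the following holds. (1) $\varphi$ is degenerate: for every $A\in M_{m\times n}(D)$ there exist a nonzero column ${}^{t}x\in M_{p\times 1}(D)$ and a nonzero row $y\in M_{1\times q}(D)$ such that $$\varphi\bigl(\{B : \operatorname{rank}(A-B)\le 1\}\bigr)\subset \bigl(\varphi(A)+R(y)\bigr)\cup\bigl(\varphi(A)+L({}^{t}x)\bigr),$$ where $R(y)=\{{}^{t}v\,y : {}^{t}v\in M_{p\times 1}(D)\}$ and $L({}^{t}x)=\{{}^{t}x\,u : u\in M_{1\times q}(D)\}$. (2) $\varphi$ is standard: there exist invertible matrices $T\in M_p(D)$ and $S\in M_q(D)$ and a matrix $R\in M_{p\times q}(D)$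 such that either $p\ge m$, $q\ge n$ and there is an automorphism $\tau$ of $D$ with $$\varphi(A)=T\begin{pmatrix}A^{\tau}&0\\0&0\end{pmatrix}S+R\quad\text{for all }A\in M_{m\times n}(D),$$ or $p\ge n$, $q\ge m$ and there is an anti-automorphism $\sigma$ of $D$ with $$\varphi(A)=T\begin{pmatrix}{}^{t}(A^{\sigma})&0\\0&0\end{pmatrix}S+R\quad\text{for all }A\in M_{m\times n}(D).$$ Here $A^{\tau}$ and $A^{\sigma}$ are obtained by applying $\tau$, resp. $\sigma$, to every entry of $A$, ${}^{t}$ denotes the transpose, and the zero blocks (possibly empty) complete the matrix to size $p\times q$. -/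

import Mathlib

noncomputable section

namespace HuaGeometry

/-- A division ring is EAS if every (unital) ring endomorphism of it is surjective. -/
def IsEAS (D : Type*) [DivisionRing D] : Prop :=
  ∀ f : D →+* D, Function.Surjective f

/-- The rank of a matrix over a division ring: the dimension of the left vector subspace of
`Dⁿ` generated by the rows. (Over a noncommutative division ring, `Matrix.cRank`, which is the
dimension of the *left* span of the columns, is a different number.) -/
def rowRank {D : Type*} [DivisionRing D] {m n : ℕ} (A : Matrix (Fin m) (Fin n) D) : ℕ :=
  Module.finrank D (Submodule.span D (Set.range A.row))

/-- Two matrices are adjacent if their difference has rank one. -/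
def Adjacent {D : Type*} [DivisionRing D] {m n : ℕ} (A B : Matrix (Fin m) (Fin n) D) : Prop :=
  rowRank (A - B) = 1

/-- Preservation of adjacency (in one direction). -/
def PreservesAdjacency {D : Type*} [DivisionRing D] {m n p q : ℕ}
    (φ : Matrix (Fin m) (Fin n) D → Matrix (Fin p) (Fin q) D) : Prop :=
  ∀ A B : Matrix (Fin m) (Fin n) D, Adjacent A B → Adjacent (φ A) (φ B)

/-- The unit ball centred at `A` for the arithmetic distance `(A, B) ↦ rank (A - B)`. -/
def unitBall {D : Type*} [DivisionRing D] {m n : ℕ} (A : Matrix (Fin m) (Fin n) D) :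
    Set (Matrix (Fin m) (Fin n) D) :=
  {B | rowRank (A - B) ≤ 1}

/-- `L(ᵗx)`: all products (column `x`) · (row `u`), where `u` is an arbitrary row. -/
def setL {D : Type*} [DivisionRing D] {p : ℕ} (q : ℕ) (x : Fin p → D) :
    Set (Matrix (Fin p) (Fin q) D) :=
  Set.range fun u : Fin q → D => Matrix.vecMulVec x u

/-- `R(y)`: all products (column `v`) · (row `y`), where `v` is an arbitrary column. -/
def setR {D : Type*} [DivisionRing D] (p : ℕ) {q : ℕ} (y : Fin q → D) :
    Set (Matrix (Fin p) (Fin q) D) :=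
  Set.range fun v : Fin p → D => Matrix.vecMulVec v y

/-- Degeneracy of a map with respect to one matrix `A`. -/
def IsDegenerateAt {D : Type*} [DivisionRing D] {m n p q : ℕ}
    (φ : Matrix (Fin m) (Fin n) D → Matrix (Fin p) (Fin q) D)
    (A : Matrix (Fin m) (Fin n) D) : Prop :=
  ∃ (x : Fin p → D) (y : Fin q → D), x ≠ 0 ∧ y ≠ 0 ∧
    φ '' unitBall A ⊆
      ((fun M => φ A + M) '' setR p y) ∪ ((fun M => φ A + M) '' setL q x)

/-- A degenerate map: degenerate with respect to every matrix. -/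
def IsDegenerate {D : Type*} [DivisionRing D] {m n p q : ℕ}
    (φ : Matrix (Fin m) (Fin n) D → Matrix (Fin p) (Fin q) D) : Prop :=
  ∀ A : Matrix (Fin m) (Fin n) D, IsDegenerateAt φ A

/-- The `p × q` block matrix with `A` in the upper left corner and zeros elsewhere
(used only when `m ≤ p` and `n ≤ q`). -/
def corner {D : Type*} [DivisionRing D] {m n : ℕ} (p q : ℕ) (A : Matrix (Fin m) (Fin n) D) :
    Matrix (Fin p) (Fin q) D :=
  Matrix.of fun i j =>
    if h : (i : ℕ) < m ∧ (j : ℕ) < n then A ⟨i, h.1⟩ ⟨j, h.2⟩ else 0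

/-- `A ↦ T [[A^τ, 0], [0, 0]] S + R` with `τ` an automorphism of `D`, and `T`, `S` invertible. -/
def IsStandardAut {D : Type*} [DivisionRing D] {m n p q : ℕ}
    (φ : Matrix (Fin m) (Fin n) D → Matrix (Fin p) (Fin q) D) : Prop :=
  m ≤ p ∧ n ≤ q ∧
    ∃ (τ : D ≃+* D) (T : Matrix (Fin p) (Fin p) D) (S : Matrix (Fin q) (Fin q) D)
      (R : Matrix (Fin p) (Fin q) D), IsUnit T ∧ IsUnit S ∧
      ∀ A : Matrix (Fin m) (Fin n) D,
        φ A = T * corner p q (A.map fun a => τ a) * S + R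

/-- `A ↦ T [[ᵗ(A^σ), 0], [0, 0]] S + R` with `σ` an anti-automorphism of `D` (a ring isomorphism
onto the opposite ring), and `T`, `S` invertible. -/
def IsStandardAnti {D : Type*} [DivisionRing D] {m n p q : ℕ}
    (φ : Matrix (Fin m) (Fin n) D → Matrix (Fin p) (Fin q) D) : Prop :=
  n ≤ p ∧ m ≤ q ∧
    ∃ (σ : D ≃+* Dᵐᵒᵖ) (T : Matrix (Fin p) (Fin p) D) (S : Matrix (Fin q) (Fin q) D)
      (R : Matrix (Fin p) (Fin q) D), IsUnit T ∧ IsUnit S ∧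
      ∀ A : Matrix (Fin m) (Fin n) D,
        φ A = T * corner p q (A.map fun a => MulOpposite.unop (σ a)).transpose * S + R

/-- A standard map: one of the two forms above. -/
def IsStandard {D : Type*} [DivisionRing D] {m n p q : ℕ}
    (φ : Matrix (Fin m) (Fin n) D → Matrix (Fin p) (Fin q) D) : Prop :=
  IsStandardAut φ ∨ IsStandardAnti φ

end HuaGeometry

end

/-! Translate so that `φ 0 = 0`. The image of a column `x` times a row `y` is again a nonzero
product, so it determines a point in the space of columns and one in the space of rows. Products
with a common factor are adjacent or equal, and adjacent matrices of rank one share a column or a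
row direction. A combinatorial lemma on grids (`grid_trichotomy`) leaves three cases: all images lie
in two cliques (degenerate), the column depends on `x` and the row on `y` (`Reg`), or the reverse,
which becomes `Reg` over the opposite ring after transposition. It remains to show that a map
regular at one point is standard.

For `2 × 2` matrices, regularity spreads to every base point and the image lies in a `2 × 2` block.
A matrix `M` is then viewed as the line of the points `(v, v ᵥ* M)` in the projective space of `E² ×
E²`. The images of the matrices with a given first row all pass through one point, and likewise for
the second row. If `D` has more than two elements, the two resulting maps on the affine plane `D²`
send lines to lines and span planes, and parallel lines go to lines concurrent on the intersection
of these planes. As in the fundamental theorem of projective geometry, both are semilinear for one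
homomorphism `D →+* E`. Its surjectivity pushes that intersection into `{0} × E²`, and the map is
standard (`standard_two_of_three`). Two scalars need a separate argument (`standard_two_of_binary`).

In general every nondegenerate `2 × 2` block is standard (`Reg.standard_block`). Surjectivity makes
`h` and `g` injective on projective points (`Reg.not_cPar_of_onto`), so any two columns and two rows
lie in a standard block. Hence the map is additive, the homomorphisms of the blocks agree up to
inner automorphisms, and `φ X = U * X.map τ * V` with `U`, `V` injective (`Reg.exists_standard`).
Completing `U` and `V` to invertible matrices finishes the proof. -/

noncomputable section
namespace HuaGeometry
open Matrix MulOpposite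

variable {D E : Type*} [DivisionRing D] [DivisionRing E] {m n p q : Type*}

local infixl:72 " ⊠ " => Matrix.vecMulVec

set_option linter.unusedSectionVars false

/-! ### Proportional vectors and matrices of rank one -/

/-- Right proportionality of columns. -/
def CPar (u u' : p → E) : Prop := ∃ c : E, c ≠ 0 ∧ ∀ i, u' i = u i * c

/-- Left proportionality of rows. -/
def RPar (w w' : q → E) : Prop := ∃ c : E, c ≠ 0 ∧ ∀ j, w' j = c * w j

theorem CPar.refl (u : p → E) : CPar u u := ⟨1, one_ne_zero, by simp⟩

theorem CPar.symm {u u' : p → E} : CPar u u' → CPar u' u := by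
  rintro ⟨c, hc, h⟩
  exact ⟨c⁻¹, inv_ne_zero hc, fun i => by rw [h, mul_assoc, mul_inv_cancel₀ hc, mul_one]⟩

theorem CPar.trans {u v w : p → E} : CPar u v → CPar v w → CPar u w := by
  rintro ⟨c, hc, h⟩ ⟨d, hd, h'⟩
  exact ⟨c * d, mul_ne_zero hc hd, fun i => by rw [h', h, mul_assoc]⟩

theorem RPar.refl (u : p → E) : RPar u u := ⟨1, one_ne_zero, by simp⟩

theorem RPar.symm {u u' : p → E} : RPar u u' → RPar u' u := by
  rintro ⟨c, hc, h⟩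
  exact ⟨c⁻¹, inv_ne_zero hc, fun i => by rw [h, ← mul_assoc, inv_mul_cancel₀ hc, one_mul]⟩

theorem RPar.trans {u v w : p → E} : RPar u v → RPar v w → RPar u w := by
  rintro ⟨c, hc, h⟩ ⟨d, hd, h'⟩
  exact ⟨d * c, mul_ne_zero hd hc, fun i => by rw [h', h, mul_assoc]⟩

theorem RPar.smul {c : E} (hc : c ≠ 0) (w : q → E) : RPar w (c • w) :=
  ⟨c, hc, fun _ => rfl⟩

theorem CPar.smul {c : E} (hc : c ≠ 0) (u : p → E) : CPar u (op c • u) :=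
  ⟨c, hc, fun _ => rfl⟩

theorem CPar.exists_eq {u u' : p → E} (h : CPar u u') : ∃ c : E, c ≠ 0 ∧ u' = op c • u := by
  obtain ⟨c, hc, h⟩ := h
  exact ⟨c, hc, funext fun i => by simp [h]⟩

theorem RPar.exists_eq {u u' : p → E} (h : RPar u u') : ∃ c : E, c ≠ 0 ∧ u' = c • u := by
  obtain ⟨c, hc, h⟩ := h
  exact ⟨c, hc, funext fun i => by simp [h]⟩

/-- A matrix of rank one, written as a column times a row. -/
def IsRankOne (M : Matrix p q E) : Prop := ∃ (x : p → E) (y : q → E), x ≠ 0 ∧ y ≠ 0 ∧ M = x ⊠ y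

theorem isRankOne_vecMulVec {x : p → E} {y : q → E} (hx : x ≠ 0) (hy : y ≠ 0) :
    IsRankOne (x ⊠ y) := ⟨x, y, hx, hy, rfl⟩

theorem vecMulVec_ne_zero' {x : p → E} {y : q → E} (hx : x ≠ 0) (hy : y ≠ 0) : x ⊠ y ≠ 0 := by
  obtain ⟨i, hi⟩ := Function.ne_iff.1 hx
  obtain ⟨j, hj⟩ := Function.ne_iff.1 hy
  intro h
  have := congrFun (congrFun h i) j
  exact mul_ne_zero hi hj (by simpa [vecMulVec_apply] using this)

@[simp] theorem vecMulVec_zero_right (x : p → E) : x ⊠ (0 : q → E) = 0 := by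
  ext i j; simp [vecMulVec_apply]

theorem IsRankOne.ne_zero {M : Matrix p q E} (h : IsRankOne M) : M ≠ 0 := by
  obtain ⟨x, y, hx, hy, rfl⟩ := h
  exact vecMulVec_ne_zero' hx hy

theorem isRankOne_of_ne_zero {x : p → E} {y : q → E} (h : x ⊠ y ≠ 0) : IsRankOne (x ⊠ y) := by
  refine ⟨x, y, ?_, ?_, rfl⟩ <;> rintro rfl <;> simp at h

theorem smul_op_vecMulVec (c : E) (x : p → E) (y : q → E) : (op c • x) ⊠ y = x ⊠ (c • y) :=
  (vecMulVec_smul' x c y).symm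

/-- The rows independent of `w'` can be separated from it by a column. -/
theorem exists_dotProduct_row [Fintype q] {w w' : q → E} (hw : w ≠ 0) (hw' : w' ≠ 0)
    (h : ¬ RPar w w') : ∃ z : q → E, w ⬝ᵥ z = 1 ∧ w' ⬝ᵥ z = 0 := by
  classical
  obtain ⟨j, hj⟩ := Function.ne_iff.1 hw'
  -- Elimination at a pivot `j` of `w'`: the multiple of `w'` agreeing with `w` at `j` is subtracted
  -- from `w`. The remainder is nonzero at some `i`, and the witness is supported on `i` and `j`.
  have : ∃ i, w i - w j * (w' j)⁻¹ * w' i ≠ 0 := by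
    by_contra! hcon
    refine h (RPar.symm ⟨w j * (w' j)⁻¹, ?_, fun i => sub_eq_zero.1 (hcon i)⟩)
    intro h0
    exact hw (funext fun i => by simpa [h0, sub_eq_zero] using hcon i)
  obtain ⟨i, hi⟩ := this
  have hj' : w' j ≠ 0 := hj
  refine ⟨Pi.single i (w i - w j * (w' j)⁻¹ * w' i)⁻¹ -
    Pi.single j ((w' j)⁻¹ * w' i * (w i - w j * (w' j)⁻¹ * w' i)⁻¹), ?_, ?_⟩
  · rw [dotProduct_sub, dotProduct_single, dotProduct_single, ← mul_assoc, ← mul_assoc, ← sub_mul,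
      mul_inv_cancel₀ hi]
  · rw [dotProduct_sub, dotProduct_single, dotProduct_single, ← mul_assoc, ← mul_assoc,
      mul_inv_cancel₀ hj', one_mul, sub_self]

/-! ### Duality between rows and columns through the opposite ring -/

theorem cPar_op {w w' : q → E} : CPar (op ∘ w) (op ∘ w') ↔ RPar w w' := by
  constructor
  · rintro ⟨c, hc, h⟩
    exact ⟨unop c, by simpa using hc, fun j => by simpa using congrArg unop (h j)⟩
  · rintro ⟨c, hc, h⟩
    exact ⟨op c, by simpa using hc, fun j => by simp [h j]⟩

theorem rPar_op {w w' : q → E} : RPar (op ∘ w) (op ∘ w') ↔ CPar w w' := by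
  constructor
  · rintro ⟨c, hc, h⟩
    exact ⟨unop c, by simpa using hc, fun j => by simpa using congrArg unop (h j)⟩
  · rintro ⟨c, hc, h⟩
    exact ⟨op c, by simpa using hc, fun j => by simp [h j]⟩

theorem op_comp_ne_zero {w : q → E} : op ∘ w ≠ 0 ↔ w ≠ 0 := by
  simp [Function.ne_iff, Function.comp]

theorem exists_dotProduct_col [Fintype p] {u u' : p → E} (hu : u ≠ 0) (hu' : u' ≠ 0)
    (h : ¬ CPar u u') : ∃ z : p → E, z ⬝ᵥ u = 1 ∧ z ⬝ᵥ u' = 0 := by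
  obtain ⟨z, h1, h2⟩ := exists_dotProduct_row (w := op ∘ u) (w' := op ∘ u')
    (op_comp_ne_zero.2 hu) (op_comp_ne_zero.2 hu') (by rwa [rPar_op])
  refine ⟨unop ∘ z, ?_, ?_⟩
  · simpa [dotProduct, Finset.unop_sum] using congrArg unop h1
  · simpa [dotProduct, Finset.unop_sum] using congrArg unop h2

/-- The transpose of a matrix, seen over the opposite ring. -/
def opT (M : Matrix p q E) : Matrix q p Eᵐᵒᵖ := (M.map op)ᵀ

/-- The inverse of `opT`. -/
def unopT (M : Matrix q p Eᵐᵒᵖ) : Matrix p q E := (M.map unop)ᵀ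

@[simp] theorem opT_apply (M : Matrix p q E) (i j) : opT M j i = op (M i j) := rfl
@[simp] theorem unopT_apply (M : Matrix q p Eᵐᵒᵖ) (i j) : unopT M i j = unop (M j i) := rfl
@[simp] theorem unopT_opT (M : Matrix p q E) : unopT (opT M) = M := rfl
@[simp] theorem opT_zero : opT (0 : Matrix p q E) = 0 := rfl
@[simp] theorem unopT_zero : unopT (0 : Matrix q p Eᵐᵒᵖ) = 0 := rfl
theorem opT_sub (M N : Matrix p q E) : opT (M - N) = opT M - opT N := rfl
theorem unopT_sub (M N : Matrix q p Eᵐᵒᵖ) : unopT (M - N) = unopT M - unopT N := rfl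
theorem opT_vecMulVec (x : p → E) (y : q → E) : opT (x ⊠ y) = (op ∘ y) ⊠ (op ∘ x) := by
  ext i j; simp [vecMulVec_apply]
theorem unopT_vecMulVec (x : q → Eᵐᵒᵖ) (y : p → Eᵐᵒᵖ) :
    unopT (x ⊠ y) = (unop ∘ y) ⊠ (unop ∘ x) := by
  ext i j; simp [vecMulVec_apply]

theorem unop_comp_ne_zero {w : q → Eᵐᵒᵖ} : unop ∘ w ≠ 0 ↔ w ≠ 0 := by
  simp [Function.ne_iff, Function.comp]

theorem IsRankOne.opT {M : Matrix p q E} (h : IsRankOne M) : IsRankOne (opT M) := by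
  obtain ⟨x, y, hx, hy, rfl⟩ := h
  exact ⟨_, _, op_comp_ne_zero.2 hy, op_comp_ne_zero.2 hx, opT_vecMulVec x y⟩

theorem IsRankOne.unopT {M : Matrix q p Eᵐᵒᵖ} (h : IsRankOne M) : IsRankOne (unopT M) := by
  obtain ⟨x, y, hx, hy, rfl⟩ := h
  exact ⟨_, _, unop_comp_ne_zero.2 hy, unop_comp_ne_zero.2 hx, unopT_vecMulVec x y⟩

/-! ### Differences of two products -/

/-- If a sum of two products of columns by rows has rank at most one and the rows are
not proportional, then the columns are. -/
theorem cPar_of_sub_eq [Fintype q] {a c e : p → E} {b d f : q → E} (ha : a ≠ 0) (hb : b ≠ 0)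
    (hc : c ≠ 0) (hd : d ≠ 0) (hbd : ¬ RPar b d) (h : a ⊠ b - c ⊠ d = e ⊠ f) :
    CPar e a ∧ CPar e c := by
  -- Evaluation on a column killed by one of the two rows isolates the other product.
  obtain ⟨z, hz1, hz2⟩ := exists_dotProduct_row hb hd hbd
  obtain ⟨z', hz1', hz2'⟩ := exists_dotProduct_row hd hb (fun h => hbd h.symm)
  have h1 := congrArg (· *ᵥ z) h
  have h2 := congrArg (· *ᵥ z') h
  simp only [sub_mulVec, vecMulVec_mulVec, hz1, hz2, hz1', hz2', op_one, one_smul, op_zero,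
    zero_smul, sub_zero, zero_sub] at h1 h2
  constructor
  · refine ⟨f ⬝ᵥ z, ?_, fun i => by rw [h1]; rfl⟩
    intro h0; rw [h0] at h1; exact ha (by simpa using h1)
  · refine ⟨-(f ⬝ᵥ z'), ?_, fun i => ?_⟩
    · intro h0; rw [neg_eq_zero] at h0; rw [h0] at h2; exact hc (by simpa using h2)
    · have := congrFun h2 i
      simp only [Pi.neg_apply, Pi.smul_apply, smul_eq_mul_unop, unop_op] at this
      rw [mul_neg, ← this, neg_neg]

/-- Otherwise the column of the difference would be proportional to both `a` and `c`. This is the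
basic constraint on adjacent matrices of rank one. -/
theorem par_or_par_of_isRankOne_sub [Fintype q] {a c : p → E} {b d : q → E} (ha : a ≠ 0)
    (hb : b ≠ 0) (hc : c ≠ 0) (hd : d ≠ 0) (h : IsRankOne (a ⊠ b - c ⊠ d)) :
    CPar a c ∨ RPar b d := by
  by_contra! hcon
  obtain ⟨e, f, he, hf, h⟩ := h
  obtain ⟨h1, h2⟩ := cPar_of_sub_eq ha hb hc hd hcon.2 h
  exact hcon.1 (h1.symm.trans h2)

/-- The variant in which the difference may also vanish. -/
theorem par_or_par_of_sub_eq [Fintype q] {a c e : p → E} {b d f : q → E} (ha : a ≠ 0)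
    (hb : b ≠ 0) (hc : c ≠ 0) (hd : d ≠ 0) (h : a ⊠ b - c ⊠ d = e ⊠ f) :
    CPar a c ∨ RPar b d := by
  by_contra! hcon
  obtain ⟨h1, h2⟩ := cPar_of_sub_eq ha hb hc hd hcon.2 h
  exact hcon.1 (h1.symm.trans h2)

theorem cPar_and_rPar_of_vecMulVec_eq {a c : p → E} {b d : q → E} (ha : a ≠ 0) (hb : b ≠ 0)
    (h : a ⊠ b = c ⊠ d) : CPar a c ∧ RPar b d := by
  obtain ⟨i, hi⟩ := Function.ne_iff.1 ha
  obtain ⟨j, hj⟩ := Function.ne_iff.1 hb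
  have hij := fun i j => congrFun (congrFun h i) j
  simp only [vecMulVec_apply] at hij
  have h0 : c i * d j ≠ 0 := by rw [← hij]; exact mul_ne_zero hi hj
  have hci := left_ne_zero_of_mul h0
  have hdj := right_ne_zero_of_mul h0
  simp only [Pi.zero_apply] at hi hj
  constructor
  · refine ⟨b j * (d j)⁻¹, mul_ne_zero hj (inv_ne_zero hdj), fun i' => ?_⟩
    rw [← mul_assoc, hij, mul_assoc, mul_inv_cancel₀ hdj, mul_one]
  · refine ⟨(c i)⁻¹ * a i, mul_ne_zero (inv_ne_zero hci) hi, fun i' => ?_⟩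
    rw [mul_assoc, hij, ← mul_assoc, inv_mul_cancel₀ hci, one_mul]

/-- A matrix adjacent to two points of a line through `0` is in one of the two maximal cliques
containing this line. -/
theorem mem_clique_of_adjacent [Fintype q] {C : Matrix p q E} {k : p → E} {g g' : q → E}
    (hk : k ≠ 0) (hg' : g' ≠ 0) (hpar : RPar g g') (hne : g ≠ g')
    (h1 : IsRankOne (C - k ⊠ g)) (h2 : IsRankOne (C - k ⊠ g')) :
    (∃ b, C = k ⊠ b) ∨ (∃ a, C = a ⊠ g) := by
  obtain ⟨a, b, ha, hb, h1⟩ := h1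
  obtain ⟨c, d, hc, hd, h2⟩ := h2
  -- `C` cancels: the two differences from `C` differ by a product with column `k`, so they share a
  -- column or a row direction. These are the two conclusions.
  have hsub : a ⊠ b - c ⊠ d = k ⊠ (g' - g) := by
    rw [← h1, ← h2, vecMulVec_sub]; abel
  have hgg : g' - g ≠ 0 := sub_ne_zero.2 hne.symm
  obtain ⟨s, hs, rfl⟩ := hpar.exists_eq
  have hkg : RPar g (s • g - g) := by
    refine ⟨s - 1, ?_, fun j => by simp [sub_mul]⟩
    intro h0; apply hgg; rw [sub_eq_zero] at h0; simp [h0]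
  rcases par_or_par_of_sub_eq ha hb hc hd hsub with h | h
  · left
    obtain ⟨t, ht, rfl⟩ := h.exists_eq
    rw [smul_op_vecMulVec, ← vecMulVec_sub] at hsub
    have hne0 : b - t • d ≠ 0 := by
      intro h0; rw [h0] at hsub; exact vecMulVec_ne_zero' hk hgg (by rw [← hsub]; simp)
    obtain ⟨h3, -⟩ := cPar_and_rPar_of_vecMulVec_eq ha hne0 hsub
    obtain ⟨r, hr, rfl⟩ := h3.symm.exists_eq
    rw [smul_op_vecMulVec, sub_eq_iff_eq_add] at h1
    exact ⟨_, by rw [h1, ← vecMulVec_add]⟩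
  · right
    obtain ⟨t, ht, rfl⟩ := h.exists_eq
    rw [vecMulVec_smul', ← sub_vecMulVec] at hsub
    have hne0 : a - op t • c ≠ 0 := by
      intro h0; rw [h0] at hsub; exact vecMulVec_ne_zero' hk hgg (by rw [← hsub]; simp)
    obtain ⟨-, h3⟩ := cPar_and_rPar_of_vecMulVec_eq hne0 hb hsub
    obtain ⟨r, hr, rfl⟩ := (h3.trans hkg.symm).symm.exists_eq
    rw [vecMulVec_smul', sub_eq_iff_eq_add, ← add_vecMulVec] at h1
    exact ⟨_, h1⟩

/-! ### Regular maps and their fibres -/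

/-- Preservation of adjacency, expressed through `IsRankOne`. -/
def AdjPres (φ : Matrix m n D → Matrix p q E) : Prop :=
  ∀ A B, IsRankOne (A - B) → IsRankOne (φ A - φ B)

/-- `φ` maps the product of a column `x` by a row `y` into the line given by `h x` and `g y`, where
neither `h` nor `g` is projectively constant. -/
structure Reg (φ : Matrix m n D → Matrix p q E) (h : (m → D) → p → E) (g : (n → D) → q → E) :
    Prop where
  col_ne : ∀ x, x ≠ 0 → h x ≠ 0
  row_ne : ∀ y, y ≠ 0 → g y ≠ 0
  map : ∀ x y, x ≠ 0 → y ≠ 0 → ∃ c : E, c ≠ 0 ∧ φ (x ⊠ y) = h x ⊠ (c • g y)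
  col_nc : ∃ x₁ x₂, x₁ ≠ 0 ∧ x₂ ≠ 0 ∧ ¬ CPar (h x₁) (h x₂)
  row_nc : ∃ y₁ y₂, y₁ ≠ 0 ∧ y₂ ≠ 0 ∧ ¬ RPar (g y₁) (g y₂)

namespace Reg

variable {φ : Matrix m n D → Matrix p q E} {h : (m → D) → p → E} {g : (n → D) → q → E}

/-- Regularity is self-dual, with `h` and `g` exchanged, so each statement on rows gives one on
columns. -/
theorem op (H : Reg φ h g) : Reg (fun X => opT (φ (unopT X)))
    (fun y => MulOpposite.op ∘ g (unop ∘ y)) (fun x => MulOpposite.op ∘ h (unop ∘ x)) where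
  col_ne y hy := op_comp_ne_zero.2 (H.row_ne _ (unop_comp_ne_zero.2 hy))
  row_ne x hx := op_comp_ne_zero.2 (H.col_ne _ (unop_comp_ne_zero.2 hx))
  map y x hy hx := by
    obtain ⟨c, hc, h1⟩ := H.map _ _ (unop_comp_ne_zero.2 hx) (unop_comp_ne_zero.2 hy)
    refine ⟨MulOpposite.op c, by simpa using hc, ?_⟩
    rw [unopT_vecMulVec, h1, opT_vecMulVec]
    ext i j
    simp [vecMulVec_apply, mul_assoc]
  col_nc := by
    obtain ⟨y₁, y₂, h1, h2, h3⟩ := H.row_nc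
    exact ⟨MulOpposite.op ∘ y₁, MulOpposite.op ∘ y₂, op_comp_ne_zero.2 h1, op_comp_ne_zero.2 h2,
      by rw [cPar_op]; exact h3⟩
  row_nc := by
    obtain ⟨y₁, y₂, h1, h2, h3⟩ := H.col_nc
    exact ⟨MulOpposite.op ∘ y₁, MulOpposite.op ∘ y₂, op_comp_ne_zero.2 h1, op_comp_ne_zero.2 h2,
      by rw [rPar_op]; exact h3⟩

theorem _root_.HuaGeometry.AdjPres.op (hφ : AdjPres φ) :
    AdjPres (fun X => opT (φ (unopT X))) := fun A B hAB => by
  rw [← opT_sub]; exact (hφ _ _ (by rw [← unopT_sub]; exact hAB.unopT)).opT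

/-- The scalar can be moved across the product onto `x`, so one image matrix carries both row
directions. -/
theorem row_smul (H : Reg φ h g) {y : n → D} (hy : y ≠ 0) {c : D} (hc : c ≠ 0) :
    RPar (g y) (g (c • y)) := by
  obtain ⟨x, -, hx, -⟩ := H.col_nc
  have hcx : MulOpposite.op c • x ≠ 0 := smul_ne_zero (by simpa using hc) hx
  obtain ⟨a, ha, h1⟩ := H.map x (c • y) hx (smul_ne_zero hc hy)
  obtain ⟨b, hb, h2⟩ := H.map _ y hcx hy
  rw [← smul_op_vecMulVec, h2] at h1
  have := (cPar_and_rPar_of_vecMulVec_eq (H.col_ne _ hcx) (smul_ne_zero hb (H.row_ne _ hy)) h1).2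
  exact ((RPar.smul hb _).trans this).trans (RPar.smul ha _).symm

theorem col_smul (H : Reg φ h g) {x : m → D} (hx : x ≠ 0) {c : D} (hc : c ≠ 0) :
    CPar (h x) (h (MulOpposite.op c • x)) := by
  have := H.op.row_smul (y := MulOpposite.op ∘ x) (op_comp_ne_zero.2 hx)
    (c := MulOpposite.op c) (by simpa using hc)
  rwa [rPar_op] at this

theorem row_par (H : Reg φ h g) {y y' : n → D} (hy : y ≠ 0) (h1 : RPar y y') :
    RPar (g y) (g y') := by
  obtain ⟨c, hc, rfl⟩ := h1.exists_eq
  exact H.row_smul hy hc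

theorem col_par (H : Reg φ h g) {x x' : m → D} (hx : x ≠ 0) (h1 : CPar x x') :
    CPar (h x) (h x') := by
  obtain ⟨c, hc, rfl⟩ := h1.exists_eq
  exact H.col_smul hx hc

theorem map_ne_zero (H : Reg φ h g) {x : m → D} {y : n → D} (hx : x ≠ 0) (hy : y ≠ 0) :
    φ (x ⊠ y) ≠ 0 := by
  obtain ⟨c, hc, h1⟩ := H.map x y hx hy
  rw [h1]
  exact vecMulVec_ne_zero' (H.col_ne x hx) (smul_ne_zero hc (H.row_ne y hy))

theorem par_of_adjacent [Fintype q] (H : Reg φ h g) {x : m → D} {y : n → D} (hx : x ≠ 0)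
    (hy : y ≠ 0) {a : p → E} {b : q → E} (ha : a ≠ 0) (hb : b ≠ 0)
    (h1 : IsRankOne (a ⊠ b - φ (x ⊠ y))) : CPar a (h x) ∨ RPar b (g y) := by
  obtain ⟨c, hc, h2⟩ := H.map x y hx hy
  rw [h2] at h1
  rcases par_or_par_of_isRankOne_sub ha hb (H.col_ne x hx) (smul_ne_zero hc (H.row_ne y hy)) h1
    with h3 | h3
  · exact Or.inl h3
  · exact Or.inr (h3.trans (RPar.smul hc _).symm)

theorem col_add_ne_zero (H : Reg φ h g) {x x' : m → D} (hx : x ≠ 0)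
    (hp : ¬ CPar (h x) (h x')) : x + x' ≠ 0 := by
  intro h0
  apply hp
  have h1 := H.col_smul hx (c := -1) (by simp)
  have h2 : MulOpposite.op (-1 : D) • x = x' := by
    rw [eq_comm, ← sub_eq_zero, ← h0]; ext i; simp; abel
  rwa [h2] at h1

theorem row_add_ne_zero (H : Reg φ h g) {y y' : n → D} (hy : y ≠ 0)
    (hp : ¬ RPar (g y) (g y')) : y + y' ≠ 0 := by
  intro h0
  apply hp
  have h1 := H.row_smul hy (c := -1) (by simp)
  have h2 : (-1 : D) • y = y' := by
    rw [eq_comm, ← sub_eq_zero, ← h0]; ext i; simp; abel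
  rwa [h2] at h1

/-- The fibres of `g` are subspaces. -/
theorem row_fibre [Fintype q] (H : Reg φ h g) (hφ : AdjPres φ) {y₁ y₂ : n → D} (hy₁ : y₁ ≠ 0)
    (hy₂ : y₂ ≠ 0) (hy₁₂ : y₁ + y₂ ≠ 0) (hp : RPar (g y₁) (g y₂)) :
    RPar (g y₁) (g (y₁ + y₂)) := by
  by_contra hn
  have hne : y₁ - y₂ ≠ 0 := by
    intro h0
    rw [sub_eq_zero] at h0
    subst h0
    have h2 : y₁ + y₁ = (2 : D) • y₁ := by rw [two_smul]
    rw [h2] at hn hy₁₂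
    exact hn (H.row_smul hy₁ (left_ne_zero_of_smul hy₁₂))
  have hne' : y₂ - y₁ ≠ 0 := by rw [← neg_sub]; exact neg_ne_zero.2 hne
  -- If the fibre is not closed under addition, such a matrix goes to `0`. Its image `C` is adjacent
  -- to two distinct points of one line (`a1`, `a2`), hence lies in one of the two cliques through
  -- that line; in each clique, two further neighbours force a nonzero `C` to make `h x` and `h x'`
  -- proportional.
  have key : ∀ x x' : m → D, x ≠ 0 → x' ≠ 0 → ¬ CPar (h x) (h x') →
      φ (x ⊠ y₁ + x' ⊠ y₂) = 0 := by
    intro x x' hx hx' hxx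
    have hs : x + x' ≠ 0 := H.col_add_ne_zero hx hxx
    have hd : x - x' ≠ 0 := by
      intro h0; rw [sub_eq_zero] at h0; subst h0; exact hxx (CPar.refl _)
    have hd' : x' - x ≠ 0 := by rw [← neg_sub]; exact neg_ne_zero.2 hd
    have adj : ∀ {u : m → D} {v : n → D} {u' : m → D} {v' : n → D}, u' ≠ 0 → v' ≠ 0 →
        x ⊠ y₁ + x' ⊠ y₂ - u ⊠ v = u' ⊠ v' →
        IsRankOne (φ (x ⊠ y₁ + x' ⊠ y₂) - φ (u ⊠ v)) := fun hu hv he =>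
      hφ _ _ (by rw [he]; exact isRankOne_vecMulVec hu hv)
    have a1 := adj (u := x + x') (v := y₁) hx' hne' (by
      simp only [add_vecMulVec, vecMulVec_sub]; abel)
    have a2 := adj (u := x + x') (v := y₂) hx hne (by
      simp only [add_vecMulVec, vecMulVec_sub]; abel)
    have a3 := adj (u := x) (v := y₁ + y₂) hd' hy₂ (by
      simp only [sub_vecMulVec, vecMulVec_add]; abel)
    have a4 := adj (u := x') (v := y₁ + y₂) hd hy₁ (by
      simp only [sub_vecMulVec, vecMulVec_add]; abel)
    have a5 := adj (u := x) (v := y₁) hx' hy₂ (by abel)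
    have a6 := adj (u := x') (v := y₂) hx hy₁ (by abel)
    have a12 := hφ ((x + x') ⊠ y₁) ((x + x') ⊠ y₂)
      (by rw [← vecMulVec_sub]; exact isRankOne_vecMulVec hs hne)
    set C := φ (x ⊠ y₁ + x' ⊠ y₂) with hC
    have row_case : ∀ a, C = a ⊠ g y₁ → C = 0 := by
      intro a hCa
      by_contra hC0
      have ha : a ≠ 0 := by rintro rfl; simp [hCa] at hC0
      rw [hCa] at a3 a4
      have b3 := (H.par_of_adjacent hx hy₁₂ ha (H.row_ne _ hy₁) a3).resolve_right hn
      have b4 := (H.par_of_adjacent hx' hy₁₂ ha (H.row_ne _ hy₁) a4).resolve_right hn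
      exact hxx (b3.symm.trans b4)
    have col_case : ∀ b, C = h (x + x') ⊠ b → C = 0 := by
      intro b hCb
      by_contra hC0
      have hb : b ≠ 0 := by rintro rfl; simp [hCb] at hC0
      by_cases hbg : RPar b (g y₁)
      · obtain ⟨t, -, hbt⟩ := hbg.symm.exists_eq
        exact hC0 (row_case (MulOpposite.op t • h (x + x')) (by rw [hCb, hbt, smul_op_vecMulVec]))
      · rw [hCb] at a5 a6
        have b5 := (H.par_of_adjacent hx hy₁ (H.col_ne _ hs) hb a5).resolve_right hbg
        have b6 := (H.par_of_adjacent hx' hy₂ (H.col_ne _ hs) hb a6).resolve_right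
          (fun h7 => hbg (h7.trans hp.symm))
        exact hxx (b5.symm.trans b6)
    obtain ⟨c₁, hc₁, e1⟩ := H.map _ y₁ hs hy₁
    obtain ⟨c₂, hc₂, e2⟩ := H.map _ y₂ hs hy₂
    rw [e1] at a1 a12
    rw [e2] at a2 a12
    rcases mem_clique_of_adjacent (H.col_ne _ hs) (smul_ne_zero hc₂ (H.row_ne _ hy₂))
      (((RPar.smul hc₁ _).symm.trans hp).trans (RPar.smul hc₂ _))
      (by intro h0; rw [h0, sub_self] at a12; exact a12.ne_zero rfl) a1 a2 with ⟨b, hb⟩ | ⟨a, ha⟩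
    · exact col_case b hb
    · exact row_case (MulOpposite.op c₁ • a) (by rw [ha, smul_op_vecMulVec])
  -- Two adjacent matrices of this kind are both sent to `0`, which is absurd. The second one
  -- replaces `x'` or `x` by `x + x'`, according to which of the pairs stays non-proportional under
  -- `h`.
  obtain ⟨x, x', hx, hx', hxx⟩ := H.col_nc
  have hs : x + x' ≠ 0 := H.col_add_ne_zero hx hxx
  have k0 := key x x' hx hx' hxx
  by_cases h1 : CPar (h (x + x')) (h x')
  · have h2 : ¬ CPar (h x) (h (x + x')) := fun h3 => hxx (h3.trans h1)
    have k1 := key x (x + x') hx hs h2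
    have := hφ (x ⊠ y₁ + (x + x') ⊠ y₂) (x ⊠ y₁ + x' ⊠ y₂) (by
      have : x ⊠ y₁ + (x + x') ⊠ y₂ - (x ⊠ y₁ + x' ⊠ y₂) = x ⊠ y₂ := by
        rw [add_vecMulVec]; abel
      rw [this]; exact isRankOne_vecMulVec hx hy₂)
    rw [k0, k1, sub_zero] at this
    exact this.ne_zero rfl
  · have k1 := key (x + x') x' hs hx' h1
    have := hφ ((x + x') ⊠ y₁ + x' ⊠ y₂) (x ⊠ y₁ + x' ⊠ y₂) (by
      have : (x + x') ⊠ y₁ + x' ⊠ y₂ - (x ⊠ y₁ + x' ⊠ y₂) = x' ⊠ y₁ := by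
        rw [add_vecMulVec]; abel
      rw [this]; exact isRankOne_vecMulVec hx' hy₁)
    rw [k0, k1, sub_zero] at this
    exact this.ne_zero rfl

/-- The fibres of `h` are subspaces. -/
theorem col_fibre [Fintype p] (H : Reg φ h g) (hφ : AdjPres φ) {x₁ x₂ : m → D} (hx₁ : x₁ ≠ 0)
    (hx₂ : x₂ ≠ 0) (hx₁₂ : x₁ + x₂ ≠ 0) (hp : CPar (h x₁) (h x₂)) :
    CPar (h x₁) (h (x₁ + x₂)) := by
  have := H.op.row_fibre hφ.op (y₁ := MulOpposite.op ∘ x₁) (y₂ := MulOpposite.op ∘ x₂)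
    (op_comp_ne_zero.2 hx₁) (op_comp_ne_zero.2 hx₂) ?_ ?_
  · rwa [rPar_op] at this
  · intro h0
    exact hx₁₂ (funext fun i => by simpa using congrArg unop (congrFun h0 i))
  · rwa [rPar_op]

/-- Fibres are subspaces, so one containing `y₁` and `y₁ + y₂` would contain `y₂`. This provides a
third direction in every nondegenerate block. -/
theorem not_row_par_add [Fintype q] (H : Reg φ h g) (hφ : AdjPres φ) {y₁ y₂ : n → D}
    (hy₁ : y₁ ≠ 0) (hy₂ : y₂ ≠ 0) (hp : ¬ RPar (g y₁) (g y₂)) :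
    y₁ + y₂ ≠ 0 ∧ ¬ RPar (g y₁) (g (y₁ + y₂)) ∧ ¬ RPar (g y₂) (g (y₁ + y₂)) := by
  have aux : ∀ {y₁ y₂ : n → D}, y₁ ≠ 0 → y₂ ≠ 0 → ¬ RPar (g y₁) (g y₂) →
      ¬ RPar (g y₁) (g (y₁ + y₂)) := by
    intro y₁ y₂ hy₁ hy₂ hp h1
    have h0 := H.row_add_ne_zero hy₁ hp
    have h2 := H.row_smul hy₁ (c := -1) (by simp)
    have h3 := H.row_fibre hφ (y₁ := (-1 : D) • y₁) (y₂ := y₁ + y₂)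
      (smul_ne_zero (by simp) hy₁) h0 (by simpa using hy₂) (h2.symm.trans h1)
    rw [neg_one_smul, neg_add_cancel_left, ← neg_one_smul D y₁] at h3
    exact hp (h2.trans h3)
  refine ⟨H.row_add_ne_zero hy₁ hp, aux hy₁ hy₂ hp, ?_⟩
  rw [add_comm]
  exact aux hy₂ hy₁ fun h1 => hp h1.symm

theorem not_col_par_add [Fintype p] (H : Reg φ h g) (hφ : AdjPres φ) {x₁ x₂ : m → D}
    (hx₁ : x₁ ≠ 0) (hx₂ : x₂ ≠ 0) (hp : ¬ CPar (h x₁) (h x₂)) :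
    x₁ + x₂ ≠ 0 ∧ ¬ CPar (h x₁) (h (x₁ + x₂)) ∧ ¬ CPar (h x₂) (h (x₁ + x₂)) := by
  have := H.op.not_row_par_add hφ.op (y₁ := MulOpposite.op ∘ x₁) (y₂ := MulOpposite.op ∘ x₂)
    (op_comp_ne_zero.2 hx₁) (op_comp_ne_zero.2 hx₂) (by rwa [rPar_op])
  simp only [rPar_op] at this
  exact ⟨H.col_add_ne_zero hx₁ hp, this.2⟩

end Reg

/-! ### Degenerate, regular and transposed maps -/

section Grid

variable {X Y P Q : Type*}

/-- With `a` depending on `x` only and not constant, two lines with different values of `a` must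
agree in `b` at each `y`. Any third line differs in `a` from one of these two, so it has the same
`b`. -/
theorem grid_aux [Nonempty P] [Nonempty Q] {a : X → Y → P} {b : X → Y → Q}
    (h2 : ∀ x x' y, a x y = a x' y ∨ b x y = b x' y)
    (hA : ∀ x y y', a x y = a x y') :
    (∃ a₀ b₀, ∀ x y, a x y = a₀ ∨ b x y = b₀) ∨
    (∃ (h : X → P) (g : Y → Q), (∀ x y, a x y = h x ∧ b x y = g y) ∧
      (∃ x x', h x ≠ h x') ∧ ∃ y y', g y ≠ g y') := by
  classical
  by_cases hdeg : ∃ a₀ b₀, ∀ x y, a x y = a₀ ∨ b x y = b₀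
  · exact Or.inl hdeg
  right
  push Not at hdeg
  obtain ⟨x₀, y₀, -, -⟩ := hdeg (Classical.arbitrary P) (Classical.arbitrary Q)
  obtain ⟨x₁, y₁, hx₁, -⟩ := hdeg (a x₀ y₀) (Classical.arbitrary Q)
  have hg : ∀ x y, b x y = b x₀ y := by
    intro x y
    by_contra hne
    have h3 := (h2 x x₀ y).resolve_right hne
    have h4 : b x₁ y = b x₀ y := by
      refine (h2 x₁ x₀ y).resolve_left fun h5 => hx₁ ?_
      rw [hA x₁ y₁ y, h5, hA x₀ y y₀]
    have h5 := (h2 x x₁ y).resolve_right (by rwa [h4])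
    exact hx₁ (by rw [hA x₁ y₁ y, ← h5, h3, hA x₀ y y₀])
  refine ⟨fun x => a x y₀, fun y => b x₀ y, fun x y => ⟨hA x y y₀, hg x y⟩, ?_, ?_⟩
  · exact ⟨x₁, x₀, by simpa only [hA x₁ y₀ y₁] using hx₁⟩
  · obtain ⟨x, y, -, hy⟩ := hdeg (Classical.arbitrary P) (b x₀ y₀)
    exact ⟨y, y₀, by rwa [hg] at hy⟩

theorem grid_trichotomy [Nonempty P] [Nonempty Q] {a : X → Y → P} {b : X → Y → Q}
    (h1 : ∀ x y y', a x y = a x y' ∨ b x y = b x y')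
    (h2 : ∀ x x' y, a x y = a x' y ∨ b x y = b x' y) :
    (∃ a₀ b₀, ∀ x y, a x y = a₀ ∨ b x y = b₀) ∨
    (∃ (h : X → P) (g : Y → Q), (∀ x y, a x y = h x ∧ b x y = g y) ∧
      (∃ x x', h x ≠ h x') ∧ ∃ y y', g y ≠ g y') ∨
    (∃ (k : Y → P) (l : X → Q), (∀ x y, a x y = k y ∧ b x y = l x) ∧
      (∃ y y', k y ≠ k y') ∧ ∃ x x', l x ≠ l x') := by
  -- Pairs that pairwise share a coordinate, as do those with a given `x`, all share the same one.
  have rows : ∀ x, (∀ y y', a x y = a x y') ∨ (∀ y y', b x y = b x y') := by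
    intro x
    by_contra! hcon
    obtain ⟨⟨y₁, y₂, h12⟩, y₃, y₄, h34⟩ := hcon
    have e12 := (h1 x y₁ y₂).resolve_left h12
    have key : ∀ y, b x y = b x y₁ := by
      intro y
      by_contra hne
      have h3 := (h1 x y y₁).resolve_right hne
      have h4 := (h1 x y y₂).resolve_right (by rwa [← e12])
      exact h12 (h3.symm.trans h4)
    exact h34 (by rw [key, key y₄])
  by_cases hA : ∀ x y y', a x y = a x y'
  · rcases grid_aux h2 hA with h | h
    · exact Or.inl h
    · exact Or.inr (Or.inl h)
  by_cases hB : ∀ x y y', b x y = b x y'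
  · rcases grid_aux (fun x x' y => (h2 x x' y).symm) hB with ⟨b₀, a₀, h⟩ | ⟨l, k, h, hl, hk⟩
    · exact Or.inl ⟨a₀, b₀, fun x y => (h x y).symm⟩
    · exact Or.inr (Or.inr ⟨k, l, fun x y => (h x y).symm, hk, hl⟩)
  push Not at hA hB
  obtain ⟨x₂, y₂, y₂', hx₂⟩ := hA
  obtain ⟨x₁, y₁, y₁', hx₁⟩ := hB
  have c₁ : ∀ y y', a x₁ y = a x₁ y' := (rows x₁).resolve_right fun h => hx₁ (h _ _)
  have c₂ : ∀ y y', b x₂ y = b x₂ y' := (rows x₂).resolve_left fun h => hx₂ (h _ _)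
  -- Mixed case: `a` is constant on the line `x₁` and `b` on `x₂`, but not conversely. A pair
  -- outside the cross through these two values would force the other coordinate to be constant as
  -- well.
  refine Or.inl ⟨a x₁ y₁, b x₂ y₁, fun x y => ?_⟩
  by_contra! hcon
  rcases rows x with hx | hx
  · have e : ∀ y', b x₁ y' = b x₂ y₁ := by
      intro y'
      have e1 : b x y' = b x₁ y' := (h2 x x₁ y').resolve_left fun h => hcon.1
        (by rw [hx y y', h, c₁ y' y₁])
      by_contra hne
      rw [← c₂ y' y₁] at hne
      have e2 := (h2 x₁ x₂ y').resolve_right hne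
      have e3 := (h2 x x₂ y').resolve_right (by rwa [e1])
      exact hcon.1 (by rw [hx y y', e3, ← e2, c₁ y' y₁])
    exact hx₁ (by rw [e, e])
  · have e : ∀ y', a x₂ y' = a x₁ y₁ := by
      intro y'
      have e1 : a x y' = a x₂ y' := (h2 x x₂ y').resolve_right fun h => hcon.2
        (by rw [hx y y', h, c₂ y' y₁])
      by_contra hne
      rw [← c₁ y' y₁] at hne
      have e2 := (h2 x₂ x₁ y').resolve_left hne
      have e3 := (h2 x x₁ y').resolve_left (by rwa [e1])
      exact hcon.2 (by rw [hx y y', e3, ← e2, c₂ y' y₁])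
    exact hx₂ (by rw [e, e])

end Grid

/-- Points of the projective space of columns. -/
def cSetoid (p E : Type*) [DivisionRing E] : Setoid {u : p → E // u ≠ 0} where
  r u v := CPar u.1 v.1
  iseqv := ⟨fun _ => CPar.refl _, CPar.symm, CPar.trans⟩

/-- Points of the projective space of rows. -/
def rSetoid (q E : Type*) [DivisionRing E] : Setoid {u : q → E // u ≠ 0} where
  r u v := RPar u.1 v.1
  iseqv := ⟨fun _ => RPar.refl _, RPar.symm, RPar.trans⟩

/-- The image under `φ` of the matrices of rank one is contained in the union of two maximal
cliques of different types through `0`. -/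
def DegenerateAtZero (φ : Matrix m n D → Matrix p q E) : Prop :=
  ∃ (a : p → E) (b : q → E), a ≠ 0 ∧ b ≠ 0 ∧ ∀ x y, x ≠ 0 → y ≠ 0 →
    (∃ r, φ (x ⊠ y) = a ⊠ r) ∨ (∃ r, φ (x ⊠ y) = r ⊠ b)

/-- The grid lemma applies to the projective points of the column and the row of `φ (x ⊠ y)`. The
transposed case is why the target has its own division ring `E`, later specialised to `D` or its
opposite. -/
theorem degenerate_or_reg [Fintype q] [Nonempty p] [Nonempty q] {φ : Matrix m n D → Matrix p q E}
    (hφ : AdjPres φ) (h0 : φ 0 = 0) :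
    DegenerateAtZero φ ∨ (∃ h g, Reg φ h g) ∨ ∃ h g, Reg (fun X => opT (φ X)) h g := by
  classical
  have hr : ∀ (x : {x : m → D // x ≠ 0}) (y : {y : n → D // y ≠ 0}),
      ∃ (u : {u : p → E // u ≠ 0}) (v : {v : q → E // v ≠ 0}), φ (x.1 ⊠ y.1) = u.1 ⊠ v.1 := by
    intro x y
    obtain ⟨u, v, hu, hv, h⟩ := hφ (x.1 ⊠ y.1) 0
      (by rw [sub_zero]; exact isRankOne_vecMulVec x.2 y.2)
    exact ⟨⟨u, hu⟩, ⟨v, hv⟩, by simpa [h0] using h⟩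
  choose u v huv using hr
  let a : _ → _ → Quotient (cSetoid p E) := fun x y => Quotient.mk _ (u x y)
  let b : _ → _ → Quotient (rSetoid q E) := fun x y => Quotient.mk _ (v x y)
  have ab : ∀ x y x' y', IsRankOne (x.1 ⊠ y.1 - x'.1 ⊠ y'.1) →
      a x y = a x' y' ∨ b x y = b x' y' := by
    intro x y x' y' h
    have := hφ _ _ h
    rw [huv, huv] at this
    rcases par_or_par_of_isRankOne_sub (u x y).2 (v x y).2 (u x' y').2 (v x' y').2 this with h | h
    · exact Or.inl (Quotient.sound h)
    · exact Or.inr (Quotient.sound h)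
  have h1 : ∀ x y y', a x y = a x y' ∨ b x y = b x y' := by
    intro x y y'
    by_cases hy : y = y'
    · subst hy; exact Or.inl rfl
    · exact ab _ _ _ _ (by
        rw [← vecMulVec_sub]
        exact isRankOne_vecMulVec x.2 (sub_ne_zero.2 fun h => hy (Subtype.ext h)))
  have h2 : ∀ x x' y, a x y = a x' y ∨ b x y = b x' y := by
    intro x x' y
    by_cases hx : x = x'
    · subst hx; exact Or.inl rfl
    · exact ab _ _ _ _ (by
        rw [← sub_vecMulVec]
        exact isRankOne_vecMulVec (sub_ne_zero.2 fun h => hx (Subtype.ext h)) y.2)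
  have : Nonempty (Quotient (cSetoid p E)) := ⟨Quotient.mk _ ⟨fun _ => 1, by
    intro h; simpa using congrFun h (Classical.arbitrary p)⟩⟩
  have : Nonempty (Quotient (rSetoid q E)) := ⟨Quotient.mk _ ⟨fun _ => 1, by
    intro h; simpa using congrFun h (Classical.arbitrary q)⟩⟩
  have ha : ∀ {x y A}, a x y = A → ∃ c : E, c ≠ 0 ∧ (u x y).1 = op c • A.out.1 := by
    intro x y A h
    exact CPar.exists_eq (Quotient.exact (s := cSetoid p E) (by rw [Quotient.out_eq]; exact h.symm))
  have hb : ∀ {x y B}, b x y = B → ∃ c : E, c ≠ 0 ∧ (v x y).1 = c • B.out.1 := by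
    intro x y A h
    exact RPar.exists_eq (Quotient.exact (s := rSetoid q E) (by rw [Quotient.out_eq]; exact h.symm))
  rcases grid_trichotomy h1 h2 with ⟨a₀, b₀, h⟩ | ⟨h, g, hhg, ⟨x₁, x₂, hx⟩, y₁, y₂, hy⟩ |
    ⟨k, l, hkl, ⟨y₁, y₂, hy⟩, x₁, x₂, hx⟩
  · refine Or.inl ⟨a₀.out.1, b₀.out.1, a₀.out.2, b₀.out.2, fun x y hx hy => ?_⟩
    have e := huv ⟨x, hx⟩ ⟨y, hy⟩
    simp only at e
    rw [e]
    rcases h ⟨x, hx⟩ ⟨y, hy⟩ with h | h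
    · obtain ⟨c, -, h⟩ := ha h
      exact Or.inl ⟨_, by rw [h, smul_op_vecMulVec]⟩
    · obtain ⟨c, -, h⟩ := hb h
      exact Or.inr ⟨_, by rw [h, vecMulVec_smul']⟩
  -- Representatives of the classes are chosen; the value at the zero vector is arbitrary, as `Reg`
  -- concerns nonzero vectors only.
  · refine Or.inr (Or.inl ⟨fun x => if hx : x ≠ 0 then (h ⟨x, hx⟩).out.1 else 0,
      fun y => if hy : y ≠ 0 then (g ⟨y, hy⟩).out.1 else 0, ?_, ?_, ?_, ?_, ?_⟩)
    · intro x hx; rw [dif_pos hx]; exact (h ⟨x, hx⟩).out.2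
    · intro x hx; rw [dif_pos hx]; exact (g ⟨x, hx⟩).out.2
    · intro x y hx hy
      obtain ⟨c, hc, h3⟩ := ha (hhg ⟨x, hx⟩ ⟨y, hy⟩).1
      obtain ⟨d, hd, h4⟩ := hb (hhg ⟨x, hx⟩ ⟨y, hy⟩).2
      have e := huv ⟨x, hx⟩ ⟨y, hy⟩
      simp only at e
      refine ⟨c * d, mul_ne_zero hc hd, ?_⟩
      rw [e, dif_pos hx, dif_pos hy, h3, h4, smul_op_vecMulVec, mul_smul]
    · refine ⟨x₁.1, x₂.1, x₁.2, x₂.2, fun h3 => hx ?_⟩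
      rw [dif_pos x₁.2, dif_pos x₂.2] at h3
      rw [← Quotient.out_eq (h x₁), ← Quotient.out_eq (h x₂)]
      exact Quotient.sound h3
    · refine ⟨y₁.1, y₂.1, y₁.2, y₂.2, fun h3 => hy ?_⟩
      rw [dif_pos y₁.2, dif_pos y₂.2] at h3
      rw [← Quotient.out_eq (g y₁), ← Quotient.out_eq (g y₂)]
      exact Quotient.sound h3
  · refine Or.inr (Or.inr ⟨fun x => op ∘ (if hx : x ≠ 0 then (l ⟨x, hx⟩).out.1 else 0),
      fun y => op ∘ (if hy : y ≠ 0 then (k ⟨y, hy⟩).out.1 else 0), ?_, ?_, ?_, ?_, ?_⟩)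
    · intro x hx; rw [dif_pos hx]; exact op_comp_ne_zero.2 (l ⟨x, hx⟩).out.2
    · intro x hx; rw [dif_pos hx]; exact op_comp_ne_zero.2 (k ⟨x, hx⟩).out.2
    · intro x y hx hy
      obtain ⟨c, hc, h3⟩ := ha (hkl ⟨x, hx⟩ ⟨y, hy⟩).1
      obtain ⟨d, hd, h4⟩ := hb (hkl ⟨x, hx⟩ ⟨y, hy⟩).2
      have e := huv ⟨x, hx⟩ ⟨y, hy⟩
      simp only at e
      refine ⟨op (c * d), (op_ne_zero_iff _).2 (mul_ne_zero hc hd), ?_⟩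
      rw [e, dif_pos hx, dif_pos hy, h3, h4, smul_op_vecMulVec, opT_vecMulVec]
      ext i j
      simp [vecMulVec_apply, mul_assoc]
    · refine ⟨x₁.1, x₂.1, x₁.2, x₂.2, fun h3 => hx ?_⟩
      rw [dif_pos x₁.2, dif_pos x₂.2, cPar_op] at h3
      rw [← Quotient.out_eq (l x₁), ← Quotient.out_eq (l x₂)]
      exact Quotient.sound h3
    · refine ⟨y₁.1, y₂.1, y₁.2, y₂.2, fun h3 => hy ?_⟩
      rw [dif_pos y₁.2, dif_pos y₂.2, rPar_op] at h3
      rw [← Quotient.out_eq (k y₁), ← Quotient.out_eq (k y₂)]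
      exact Quotient.sound h3

/-! ### Moving the base point -/

/-- The map `φ` with the base point `A` moved to the origin. -/
def shift (φ : Matrix m n D → Matrix p q E) (A X : Matrix m n D) : Matrix p q E :=
  φ (A + X) - φ A

@[simp] theorem shift_zero (φ : Matrix m n D → Matrix p q E) (A : Matrix m n D) :
    shift φ A 0 = 0 := by simp [shift]

theorem shift_shift (φ : Matrix m n D → Matrix p q E) (A B : Matrix m n D) :
    shift (shift φ A) B = shift φ (A + B) := by
  ext X; simp [shift, add_assoc]

theorem shift_at_zero (φ : Matrix m n D → Matrix p q E) (h0 : φ 0 = 0) : shift φ 0 = φ := by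
  ext X; simp [shift, h0]

theorem AdjPres.shift {φ : Matrix m n D → Matrix p q E} (hφ : AdjPres φ) (A : Matrix m n D) :
    AdjPres (shift φ A) := fun X Y h => by
  have := hφ (A + X) (A + Y) (by simpa using h)
  simpa [HuaGeometry.shift] using this

namespace Reg

variable {φ : Matrix m n D → Matrix p q E} {h : (m → D) → p → E} {g : (n → D) → q → E}

/-- Nondegenerate matrices of rank two have images of rank two. -/
theorem map_add_ne [Fintype p] [Fintype q] (H : Reg φ h g) (hφ : AdjPres φ) {x₁ x₂ : m → D}
    {y₁ y₂ : n → D}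
    (hx₁ : x₁ ≠ 0) (hx₂ : x₂ ≠ 0) (hy₁ : y₁ ≠ 0) (hy₂ : y₂ ≠ 0) (hx : ¬ CPar (h x₁) (h x₂))
    (hy : ¬ RPar (g y₁) (g y₂)) (u : p → E) (w : q → E) : φ (x₁ ⊠ y₁ + x₂ ⊠ y₂) ≠ u ⊠ w := by
  -- Rank one is excluded by four adjacent products: if `a` is proportional to `h x₁`, then `b` must
  -- follow both `g y₁` and `g y₂`; otherwise both `g y₁` and `g (y₁ + y₂)`.
  have key : ∀ {x₁ x₂ : m → D}, x₁ ≠ 0 → x₂ ≠ 0 → ¬ CPar (h x₁) (h x₂) →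
      ¬ IsRankOne (φ (x₁ ⊠ y₁ + x₂ ⊠ y₂)) := by
    rintro x₁ x₂ hx₁ hx₂ hx ⟨a, b, ha, hb, hab⟩
    obtain ⟨hx₁₂, hxa, hxb⟩ := H.not_col_par_add hφ hx₁ hx₂ hx
    obtain ⟨hy₁₂, hya, hyb⟩ := H.not_row_par_add hφ hy₁ hy₂ hy
    have adj : ∀ {u : m → D} {v : n → D} (u' : m → D) (v' : n → D), u ≠ 0 → v ≠ 0 → u' ≠ 0 →
        v' ≠ 0 → x₁ ⊠ y₁ + x₂ ⊠ y₂ - u ⊠ v = u' ⊠ v' → CPar a (h u) ∨ RPar b (g v) :=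
      fun {u v} u' v' hu hv hu' hv' he => H.par_of_adjacent hu hv ha hb (by
        rw [← hab]
        exact hφ _ _ (by rw [he]; exact isRankOne_vecMulVec hu' hv'))
    have hyd : y₂ - y₁ ≠ 0 := by
      intro h0; rw [sub_eq_zero] at h0; subst h0; exact hy (RPar.refl _)
    have hxd : x₂ - x₁ ≠ 0 := by
      intro h0; rw [sub_eq_zero] at h0; subst h0; exact hx (CPar.refl _)
    have a1 := adj (u := x₁) (v := y₁) x₂ y₂ hx₁ hy₁ hx₂ hy₂ (by abel)
    have a2 := adj (u := x₂) (v := y₂) x₁ y₁ hx₂ hy₂ hx₁ hy₁ (by abel)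
    have a3 := adj (u := x₁) (v := y₁ + y₂) (x₂ - x₁) y₂ hx₁ hy₁₂ hxd hy₂ (by
      simp only [sub_vecMulVec, vecMulVec_add]; abel)
    have a4 := adj (u := x₁ + x₂) (v := y₁) x₂ (y₂ - y₁) hx₁₂ hy₁ hx₂ hyd (by
      simp only [add_vecMulVec, vecMulVec_sub]; abel)
    by_cases hc : CPar a (h x₁)
    · have b1 := a2.resolve_left fun h1 => hx (hc.symm.trans h1)
      have b2 := a4.resolve_left fun h1 => hxa (hc.symm.trans h1)
      exact hy (b2.symm.trans b1)
    · exact hya ((a1.resolve_left hc).symm.trans (a3.resolve_left hc))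
  intro heq
  -- The value `0` is excluded too: it would give the neighbour `x₁ ⊠ y₁ + (x₁ + x₂) ⊠ y₂` an image
  -- of rank one.
  by_cases h0 : φ (x₁ ⊠ y₁ + x₂ ⊠ y₂) = 0
  · obtain ⟨hx₁₂, hxa, hxb⟩ := H.not_col_par_add hφ hx₁ hx₂ hx
    apply key hx₁ hx₁₂ hxa
    have := hφ (x₁ ⊠ y₁ + (x₁ + x₂) ⊠ y₂) (x₁ ⊠ y₁ + x₂ ⊠ y₂) (by
      rw [add_vecMulVec]
      have : x₁ ⊠ y₁ + (x₁ ⊠ y₂ + x₂ ⊠ y₂) - (x₁ ⊠ y₁ + x₂ ⊠ y₂) = x₁ ⊠ y₂ := by abel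
      rw [this]
      exact isRankOne_vecMulVec hx₁ hy₂)
    rwa [h0, sub_zero] at this
  · apply key hx₁ hx₂ hx
    rw [heq] at h0 ⊢
    exact isRankOne_of_ne_zero h0

theorem adj_of_add [Fintype p] [Fintype q] (_ : Reg φ h g) (hφ : AdjPres φ) {x₁ x₂ : m → D}
    {y₁ y₂ : n → D} (hx₂ : x₂ ≠ 0) (hy₂ : y₂ ≠ 0) :
    IsRankOne (φ (x₁ ⊠ y₁ + x₂ ⊠ y₂) - φ (x₁ ⊠ y₁)) :=
  hφ _ _ (by rw [add_sub_cancel_left]; exact isRankOne_vecMulVec hx₂ hy₂)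

theorem _root_.HuaGeometry.not_cPar_not_rPar_of_sub_eq [Fintype p] [Fintype q]
    {a c u u' : p → E} {b d w w' : q → E}
    (ha : a ≠ 0) (hb : b ≠ 0) (hc : c ≠ 0) (hd : d ≠ 0)
    (hac : ¬ CPar a c) (hbd : ¬ RPar b d) (he : u ⊠ w - u' ⊠ w' = a ⊠ b - c ⊠ d) :
    ¬ CPar u u' ∧ ¬ RPar w w' := by
  constructor
  · intro h1
    obtain ⟨t, -, rfl⟩ := h1.exists_eq
    rw [smul_op_vecMulVec, ← vecMulVec_sub] at he
    rcases par_or_par_of_sub_eq ha hb hc hd he.symm with h | h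
    exacts [hac h, hbd h]
  · intro h1
    obtain ⟨t, -, rfl⟩ := h1.exists_eq
    rw [vecMulVec_smul', ← sub_vecMulVec] at he
    rcases par_or_par_of_sub_eq ha hb hc hd he.symm with h | h
    exacts [hac h, hbd h]

/-- The image differs from those of `x₁ ⊠ y₁` and `x₂ ⊠ y₂` by products `u ⊠ w` and `u' ⊠ w'`. Their
difference is known, and test vectors separating `u` from `u'` and `w` from `w'` place `u` and `w`
in the expected spans. -/
theorem map_add_mem [Fintype p] [Fintype q] (H : Reg φ h g) (hφ : AdjPres φ) {x₁ x₂ : m → D}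
    {y₁ y₂ : n → D}
    (hx₁ : x₁ ≠ 0) (hx₂ : x₂ ≠ 0) (hy₁ : y₁ ≠ 0) (hy₂ : y₂ ≠ 0) (hx : ¬ CPar (h x₁) (h x₂))
    (hy : ¬ RPar (g y₁) (g y₂)) : ∃ a b c d : E, φ (x₁ ⊠ y₁ + x₂ ⊠ y₂) =
      h x₁ ⊠ (a • g y₁ + b • g y₂) + h x₂ ⊠ (c • g y₁ + d • g y₂) := by
  obtain ⟨u, w, hu, hw, e1⟩ := H.adj_of_add hφ (x₁ := x₁) (y₁ := y₁) hx₂ hy₂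
  obtain ⟨u', w', hu', hw', e2⟩ := H.adj_of_add hφ (x₁ := x₂) (y₁ := y₂) hx₁ hy₁
  obtain ⟨s, hs, f1⟩ := H.map x₁ y₁ hx₁ hy₁
  obtain ⟨t, ht, f2⟩ := H.map x₂ y₂ hx₂ hy₂
  rw [f1, sub_eq_iff_eq_add] at e1
  rw [f2, add_comm (x₂ ⊠ y₂), sub_eq_iff_eq_add] at e2
  have e3 : u ⊠ w - u' ⊠ w' = h x₂ ⊠ (t • g y₂) - h x₁ ⊠ (s • g y₁) := by
    rw [sub_eq_sub_iff_add_eq_add, ← e1, e2, add_comm]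
  obtain ⟨n1, n2⟩ := not_cPar_not_rPar_of_sub_eq (H.col_ne _ hx₂)
    (smul_ne_zero ht (H.row_ne _ hy₂)) (H.col_ne _ hx₁) (smul_ne_zero hs (H.row_ne _ hy₁))
    (fun h1 => hx h1.symm)
    (fun h1 => hy (((RPar.smul ht _).trans (h1.trans (RPar.smul hs _).symm)).symm)) e3
  obtain ⟨z, z1, z2⟩ := exists_dotProduct_row hw hw' n2
  obtain ⟨z', z1', z2'⟩ := exists_dotProduct_col hu hu' n1
  have e4 := congrArg (· *ᵥ z) e3
  have e5 := congrArg (z' ᵥ* ·) e3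
  simp only [sub_mulVec, vecMulVec_mulVec, vecMul_sub, vecMul_vecMulVec, z1, z2, z1', z2', op_one,
    one_smul, op_zero, zero_smul, sub_zero] at e4 e5
  rw [e1]
  set α := t • g y₂ ⬝ᵥ z
  set β := s • g y₁ ⬝ᵥ z
  refine ⟨s + β * ((z' ⬝ᵥ h x₁) * s), -β * ((z' ⬝ᵥ h x₂) * t),
    -α * ((z' ⬝ᵥ h x₁) * s), α * ((z' ⬝ᵥ h x₂) * t), ?_⟩
  rw [e4, e5]
  ext i j
  simp only [Matrix.add_apply, vecMulVec_apply, Pi.sub_apply, Pi.smul_apply, Pi.add_apply,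
    smul_eq_mul_unop, unop_op, smul_eq_mul]
  noncomm_ring

/-- Regularity propagates to the matrices of rank two in a nondegenerate block. -/
theorem exists_shift [Fintype p] [Fintype q] (H : Reg φ h g) (hφ : AdjPres φ) {x₁ x₂ : m → D}
    {y₁ y₂ : n → D}
    (hx₁ : x₁ ≠ 0) (hx₂ : x₂ ≠ 0) (hy₁ : y₁ ≠ 0) (hy₂ : y₂ ≠ 0) (hx : ¬ CPar (h x₁) (h x₂))
    (hy : ¬ RPar (g y₁) (g y₂)) : ∃ h' g', Reg (shift φ (x₁ ⊠ y₁ + x₂ ⊠ y₂)) h' g' := by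
  have hC := H.map_add_ne hφ hx₁ hx₂ hy₁ hy₂ hx hy
  obtain ⟨hy₁₂, hya, hyb⟩ := H.not_row_par_add hφ hy₁ hy₂ hy
  have hxd : x₁ - x₂ ≠ 0 := by
    intro h0; rw [sub_eq_zero] at h0; subst h0; exact hx (CPar.refl _)
  obtain ⟨c₁, hc₁, f1⟩ := H.map x₁ y₁ hx₁ hy₁
  obtain ⟨c₂, hc₂, f2⟩ := H.map x₂ y₂ hx₂ hy₂
  obtain ⟨c₁', hc₁', f1'⟩ := H.map x₁ (y₁ + y₂) hx₁ hy₁₂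
  obtain ⟨c₂', hc₂', f2'⟩ := H.map x₂ (y₁ + y₂) hx₂ hy₁₂
  -- Four neighbours of the new base point, two in direction `y₂` and two in direction `y₁`; their
  -- images are products with columns `h x₁`, `h x₁`, `h x₂`, `h x₂`.
  have e1 : shift φ (x₁ ⊠ y₁ + x₂ ⊠ y₂) ((-x₂) ⊠ y₂) =
      φ (x₁ ⊠ y₁) - φ (x₁ ⊠ y₁ + x₂ ⊠ y₂) := by
    rw [shift, neg_vecMulVec]; congr 2; abel
  have e1' : shift φ (x₁ ⊠ y₁ + x₂ ⊠ y₂) ((x₁ - x₂) ⊠ y₂) =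
      φ (x₁ ⊠ (y₁ + y₂)) - φ (x₁ ⊠ y₁ + x₂ ⊠ y₂) := by
    rw [shift, sub_vecMulVec, vecMulVec_add]; congr 2; abel
  have e2 : shift φ (x₁ ⊠ y₁ + x₂ ⊠ y₂) ((-x₁) ⊠ y₁) =
      φ (x₂ ⊠ y₂) - φ (x₁ ⊠ y₁ + x₂ ⊠ y₂) := by
    rw [shift, neg_vecMulVec]; congr 2; abel
  have e2' : shift φ (x₁ ⊠ y₁ + x₂ ⊠ y₂) ((x₂ - x₁) ⊠ y₁) =
      φ (x₂ ⊠ (y₁ + y₂)) - φ (x₁ ⊠ y₁ + x₂ ⊠ y₂) := by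
    rw [shift, sub_vecMulVec, vecMulVec_add]; congr 2; abel
  rw [f1] at e1; rw [f1'] at e1'; rw [f2] at e2; rw [f2'] at e2'
  set C := φ (x₁ ⊠ y₁ + x₂ ⊠ y₂) with hCdef
  -- As `C` is not a product, two distinct products with column `u` cannot lie in one column clique
  -- at `C`: its column would be proportional to `u`, making `C` a product.
  have noL : ∀ {u : p → E} {w w' : q → E}, u ≠ 0 → w ≠ 0 → ¬ RPar w w' → ∀ x₀ r r',
      u ⊠ w - C = x₀ ⊠ r → u ⊠ w' - C = x₀ ⊠ r' → False := by
    intro u w w' hu hw hww x₀ r r' g1 g2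
    have g3 : u ⊠ (w - w') = x₀ ⊠ (r - r') := by
      rw [vecMulVec_sub, vecMulVec_sub, ← g1, ← g2]; abel
    have hne : w - w' ≠ 0 := by
      intro h0; rw [sub_eq_zero] at h0; subst h0; exact hww (RPar.refl _)
    obtain ⟨t, -, rfl⟩ := (cPar_and_rPar_of_vecMulVec_eq hu hne g3).1.exists_eq
    rw [sub_eq_iff_eq_add, ← sub_eq_iff_eq_add', smul_op_vecMulVec, ← vecMulVec_sub] at g1
    exact hC _ _ g1.symm
  have noR : ∀ {u u' : p → E} {w : q → E}, u ≠ 0 → w ≠ 0 → ¬ CPar u u' → ∀ y₀ r r',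
      u ⊠ w - C = r ⊠ y₀ → u' ⊠ w - C = r' ⊠ y₀ → False := by
    intro u u' w hu hw huu y₀ r r' g1 g2
    have g3 : (u - u') ⊠ w = (r - r') ⊠ y₀ := by
      rw [sub_vecMulVec, sub_vecMulVec, ← g1, ← g2]; abel
    have hne : u - u' ≠ 0 := by
      intro h0; rw [sub_eq_zero] at h0; subst h0; exact huu (CPar.refl _)
    obtain ⟨t, -, rfl⟩ := (cPar_and_rPar_of_vecMulVec_eq hne hw g3).2.exists_eq
    rw [sub_eq_iff_eq_add, ← sub_eq_iff_eq_add', vecMulVec_smul', ← sub_vecMulVec] at g1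
    exact hC _ _ g1.symm
  have noR' : ∀ {u u' : p → E} {w w' : q → E}, u ≠ 0 → w ≠ 0 → u' ≠ 0 → w' ≠ 0 → ¬ CPar u u' →
      ¬ RPar w w' → ∀ y₀ r r', u ⊠ w - C = r ⊠ y₀ → u' ⊠ w' - C = r' ⊠ y₀ → False := by
    intro u u' w w' hu hw hu' hw' huu hww y₀ r r' g1 g2
    have g3 : u ⊠ w - u' ⊠ w' = (r - r') ⊠ y₀ := by
      rw [sub_vecMulVec, ← g1, ← g2]; abel
    rcases par_or_par_of_sub_eq hu hw hu' hw' g3 with h1 | h1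
    exacts [huu h1, hww h1]
  have r1 := H.row_ne _ hy₁
  have r2 := H.row_ne _ hy₂
  have r12 := H.row_ne _ hy₁₂
  have k1 := H.col_ne _ hx₁
  have k2 := H.col_ne _ hx₂
  have sm : ∀ {c d : E} {w w' : q → E}, c ≠ 0 → d ≠ 0 → ¬ RPar w w' → ¬ RPar (c • w) (d • w') :=
    fun hc hd hw h1 => hw (((RPar.smul hc _).trans h1).trans (RPar.smul hd _).symm)
  obtain ⟨i, -⟩ := Function.ne_iff.1 k1
  obtain ⟨j, -⟩ := Function.ne_iff.1 r1
  have : Nonempty p := ⟨i⟩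
  have : Nonempty q := ⟨j⟩
  rcases degenerate_or_reg (hφ.shift (x₁ ⊠ y₁ + x₂ ⊠ y₂)) (shift_zero _ _) with
    ⟨x₀, y₀, hx₀, hy₀, hd⟩ | h1 | ⟨k, l, h1⟩
  -- By `noL`, at least one neighbour of each pair lies in the row clique given by `y₀`. Their
  -- columns are independent; `noR'` excludes independent rows and `noR` the remaining case, where
  -- both rows come from `y₁ + y₂`.
  · exfalso
    have d1 := hd _ _ (neg_ne_zero.2 hx₂) hy₂
    have d1' := hd _ _ hxd hy₂
    have d2 := hd _ _ (neg_ne_zero.2 hx₁) hy₁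
    have d2' := hd _ _ (neg_ne_zero.2 hxd) hy₁
    rw [neg_sub] at d2'
    rw [e1] at d1; rw [e1'] at d1'; rw [e2] at d2; rw [e2'] at d2'
    have s1 := noL k1 (smul_ne_zero hc₁ r1) (sm hc₁ hc₁' hya) x₀
    have s2 := noL k2 (smul_ne_zero hc₂ r2) (sm hc₂ hc₂' hyb) x₀
    have t1 : ∃ (c : E) (w : q → E), (w = g y₁ ∨ w = g (y₁ + y₂)) ∧ c ≠ 0 ∧ w ≠ 0 ∧
        ∃ r, h x₁ ⊠ (c • w) - C = r ⊠ y₀ := by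
      rcases d1 with ⟨r, d1⟩ | d1
      · rcases d1' with ⟨r', d1'⟩ | d1'
        · exact (s1 _ _ d1 d1').elim
        · exact ⟨_, _, Or.inr rfl, hc₁', r12, d1'⟩
      · exact ⟨_, _, Or.inl rfl, hc₁, r1, d1⟩
    have t2 : ∃ (c : E) (w : q → E), (w = g y₂ ∨ w = g (y₁ + y₂)) ∧ c ≠ 0 ∧ w ≠ 0 ∧
        ∃ r, h x₂ ⊠ (c • w) - C = r ⊠ y₀ := by
      rcases d2 with ⟨r, d2⟩ | d2
      · rcases d2' with ⟨r', d2'⟩ | d2'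
        · exact (s2 _ _ d2 d2').elim
        · exact ⟨_, _, Or.inr rfl, hc₂', r12, d2'⟩
      · exact ⟨_, _, Or.inl rfl, hc₂, r2, d2⟩
    obtain ⟨a, w, hw, ha, hw0, r, f⟩ := t1
    obtain ⟨a', w', hw', ha', hw0', r', f'⟩ := t2
    have gen : ¬ RPar w w' → False := fun hn =>
      noR' k1 (smul_ne_zero ha hw0) k2 (smul_ne_zero ha' hw0') hx (sm ha ha' hn) _ _ _ f f'
    rcases hw with rfl | rfl <;> rcases hw' with rfl | rfl
    · exact gen hy
    · exact gen hya
    · exact gen fun h1 => hyb h1.symm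
    · rw [← smul_op_vecMulVec] at f f'
      refine noR (smul_ne_zero (by simpa using ha) k1) r12 (fun h1 => hx ?_) _ _ _ f f'
      exact ((CPar.smul ha _).trans h1).trans (CPar.smul ha' _).symm
  · exact h1
  -- In the transposed case the two neighbours in direction `y₂` would share a column clique at `C`,
  -- against `noL`.
  · exfalso
    obtain ⟨c, -, m1⟩ := h1.map _ _ (neg_ne_zero.2 hx₂) hy₂
    obtain ⟨c', -, m2⟩ := h1.map _ _ hxd hy₂
    have m1 := congrArg unopT m1
    have m2 := congrArg unopT m2
    rw [unopT_opT, unopT_vecMulVec, e1] at m1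
    rw [unopT_opT, unopT_vecMulVec, e1'] at m2
    have hs : ∀ c : Eᵐᵒᵖ, unop ∘ (c • l y₂) = MulOpposite.op (unop c) • (unop ∘ l y₂) := by
      intro c; ext i; simp
    rw [hs, smul_op_vecMulVec] at m1 m2
    exact noL k1 (smul_ne_zero hc₁ r1) (sm hc₁ hc₁' hya) _ _ _ m1 m2

end Reg

/-! ### Regular maps on two by two matrices -/

theorem exists_row_coords {y₁ y₂ : Fin 2 → D} (hy₁ : y₁ ≠ 0) (hy₂ : y₂ ≠ 0) (h : ¬ RPar y₁ y₂)
    (y : Fin 2 → D) : ∃ a b : D, y = a • y₁ + b • y₂ := by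
  have hli : LinearIndependent D ![y₁, y₂] := by
    rw [LinearIndependent.pair_iff]
    intro s t hst
    by_cases ht : t = 0
    · subst ht
      simpa [hy₁] using hst
    · exfalso
      have hs : s ≠ 0 := by rintro rfl; simp [ht, hy₂] at hst
      refine h ⟨-(t⁻¹ * s), by simp [hs, ht], fun j => ?_⟩
      have := congrFun hst j
      simp only [Pi.add_apply, Pi.smul_apply, smul_eq_mul, Pi.zero_apply] at this
      rw [add_comm, add_eq_zero_iff_eq_neg] at this
      rw [neg_mul, mul_assoc, ← mul_neg, ← this, ← mul_assoc, inv_mul_cancel₀ ht, one_mul]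
  have := hli.span_eq_top_of_card_eq_finrank (by simp)
  have hy : y ∈ Submodule.span D (Set.range ![y₁, y₂]) := by rw [this]; trivial
  rw [Matrix.range_cons, Matrix.range_cons, Matrix.range_empty, Set.union_empty,
    Set.singleton_union, Submodule.mem_span_pair] at hy
  obtain ⟨a, b, h⟩ := hy
  exact ⟨a, b, h.symm⟩

theorem exists_not_rPar (y : Fin 2 → D) : ∃ y' : Fin 2 → D, y' ≠ 0 ∧ ¬ RPar y y' := by
  by_cases h0 : y 0 = 0
  · refine ⟨![1, 0], by simp, ?_⟩
    rintro ⟨c, hc, h⟩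
    simpa [h0] using h 0
  · refine ⟨![0, 1], by simp, ?_⟩
    rintro ⟨c, hc, h⟩
    have := h 0
    simp [h0, hc] at this

theorem exists_not_cPar (x : Fin 2 → D) : ∃ x' : Fin 2 → D, x' ≠ 0 ∧ ¬ CPar x x' := by
  obtain ⟨y, hy, h⟩ := exists_not_rPar (op ∘ x)
  refine ⟨unop ∘ y, unop_comp_ne_zero.2 hy, fun h1 => h ?_⟩
  rw [← rPar_op] at h1
  exact h1

namespace Reg

section

variable {φ : Matrix m n D → Matrix p q E} {h : (m → D) → p → E} {g : (n → D) → q → E}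

theorem not_row_par_sub [Fintype q] (H : Reg φ h g) (hφ : AdjPres φ) {y₁ y₂ : n → D}
    (hy₁ : y₁ ≠ 0) (hy₂ : y₂ ≠ 0) (hp : ¬ RPar (g y₁) (g y₂)) :
    y₂ - y₁ ≠ 0 ∧ ¬ RPar (g y₁) (g (y₂ - y₁)) := by
  have hne : y₂ - y₁ ≠ 0 := by
    intro h0; rw [sub_eq_zero] at h0; subst h0; exact hp (RPar.refl _)
  refine ⟨hne, fun h1 => hp ?_⟩
  have := H.row_fibre hφ hy₁ hne (by simpa using hy₂) h1
  rwa [add_sub_cancel] at this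

/-- The matrix `x₁ ⊠ y₁ + x₂ ⊠ y₂` equals `(x₁ + x₂) ⊠ y₁ + x₂ ⊠ (y₂ - y₁)`. Both expansions of its
image are compared at an entry of the row multiplying `h (x₁ + x₂)`; this row is nonzero because the
image is not a product. -/
theorem col_add_mem [Fintype p] [Fintype q] (H : Reg φ h g) (hφ : AdjPres φ) {x₁ x₂ : m → D}
    (hx₁ : x₁ ≠ 0) (hx₂ : x₂ ≠ 0) (hx : ¬ CPar (h x₁) (h x₂)) :
    ∃ s t : E, h (x₁ + x₂) = MulOpposite.op s • h x₁ + MulOpposite.op t • h x₂ := by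
  obtain ⟨y₁, y₂, hy₁, hy₂, hy⟩ := H.row_nc
  obtain ⟨hx₁₂, -, hxb⟩ := H.not_col_par_add hφ hx₁ hx₂ hx
  obtain ⟨hyd, hy'⟩ := H.not_row_par_sub hφ hy₁ hy₂ hy
  obtain ⟨a, b, c, d, e1⟩ := H.map_add_mem hφ hx₁ hx₂ hy₁ hy₂ hx hy
  obtain ⟨a', b', c', d', e2⟩ := H.map_add_mem hφ hx₁₂ hx₂ hy₁ hyd (fun h1 => hxb h1.symm) hy'
  have hne := H.map_add_ne hφ hx₁₂ hx₂ hy₁ hyd (fun h1 => hxb h1.symm) hy'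
  have e3 : (x₁ + x₂) ⊠ y₁ + x₂ ⊠ (y₂ - y₁) = x₁ ⊠ y₁ + x₂ ⊠ y₂ := by
    rw [add_vecMulVec, vecMulVec_sub]; abel
  have hs : a' • g y₁ + b' • g (y₂ - y₁) ≠ 0 := by
    intro h0
    rw [h0, vecMulVec_zero_right, zero_add] at e2
    exact hne _ _ e2
  rw [e3, e1] at e2
  set s₁ := a' • g y₁ + b' • g (y₂ - y₁)
  set s₂ := c' • g y₁ + d' • g (y₂ - y₁)
  set r₁ := a • g y₁ + b • g y₂
  set r₂ := c • g y₁ + d • g y₂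
  obtain ⟨j, hj⟩ := Function.ne_iff.1 hs
  have hj' : s₁ j ≠ 0 := hj
  refine ⟨r₁ j * (s₁ j)⁻¹, (r₂ j - s₂ j) * (s₁ j)⁻¹, ?_⟩
  ext i
  have := congrFun (congrFun e2 i) j
  simp only [Matrix.add_apply, vecMulVec_apply] at this
  have h3 : h (x₁ + x₂) i * s₁ j = h x₁ i * r₁ j + h x₂ i * (r₂ j - s₂ j) := by
    rw [mul_sub, ← add_sub_assoc, this]; abel
  simp only [Pi.add_apply, Pi.smul_apply, smul_eq_mul_unop, unop_op]
  rw [← mul_assoc, ← mul_assoc, ← add_mul, ← h3, mul_assoc, mul_inv_cancel₀ hj', mul_one]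

theorem row_add_mem [Fintype p] [Fintype q] (H : Reg φ h g) (hφ : AdjPres φ) {y₁ y₂ : n → D}
    (hy₁ : y₁ ≠ 0) (hy₂ : y₂ ≠ 0) (hy : ¬ RPar (g y₁) (g y₂)) :
    ∃ s t : E, g (y₁ + y₂) = s • g y₁ + t • g y₂ := by
  obtain ⟨s, t, h1⟩ := H.op.col_add_mem hφ.op (x₁ := MulOpposite.op ∘ y₁)
    (x₂ := MulOpposite.op ∘ y₂) (op_comp_ne_zero.2 hy₁) (op_comp_ne_zero.2 hy₂) (by rwa [cPar_op])
  refine ⟨unop s, unop t, funext fun j => ?_⟩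
  exact congrArg unop (congrFun h1 j)

end

variable {φ : Matrix (Fin 2) (Fin 2) D → Matrix p q E} {h : (Fin 2 → D) → p → E}
  {g : (Fin 2 → D) → q → E}

/-- In dimension two a fibre containing two independent rows is everything, so `g` would be
projectively constant. -/
theorem not_rPar [Fintype q] (H : Reg φ h g) (hφ : AdjPres φ) {y₁ y₂ : Fin 2 → D}
    (hy₁ : y₁ ≠ 0) (hy₂ : y₂ ≠ 0) (hp : ¬ RPar y₁ y₂) : ¬ RPar (g y₁) (g y₂) := by
  intro h1
  have key : ∀ y, y ≠ 0 → RPar (g y₁) (g y) := by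
    intro y hy
    obtain ⟨a, b, rfl⟩ := exists_row_coords hy₁ hy₂ hp y
    by_cases ha : a = 0
    · subst ha
      rw [zero_smul, zero_add] at hy ⊢
      exact h1.trans (H.row_smul hy₂ (left_ne_zero_of_smul hy))
    by_cases hb : b = 0
    · subst hb
      rw [zero_smul, add_zero] at hy ⊢
      exact H.row_smul hy₁ ha
    · have ha' := H.row_smul hy₁ ha
      have hb' := H.row_smul hy₂ hb
      exact ha'.trans (H.row_fibre hφ (smul_ne_zero ha hy₁) (smul_ne_zero hb hy₂) hy
        ((ha'.symm.trans h1).trans hb'))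
  obtain ⟨y, y', hy, hy', hn⟩ := H.row_nc
  exact hn ((key y hy).symm.trans (key y' hy'))

theorem not_cPar [Fintype p] (H : Reg φ h g) (hφ : AdjPres φ) {x₁ x₂ : Fin 2 → D}
    (hx₁ : x₁ ≠ 0) (hx₂ : x₂ ≠ 0) (hp : ¬ CPar x₁ x₂) : ¬ CPar (h x₁) (h x₂) := by
  have := H.op.not_rPar hφ.op (y₁ := MulOpposite.op ∘ x₁) (y₂ := MulOpposite.op ∘ x₂)
    (op_comp_ne_zero.2 hx₁) (op_comp_ne_zero.2 hx₂) (by rwa [rPar_op])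
  rwa [rPar_op] at this

theorem eq_vecMulVec_add (X : Matrix (Fin 2) (Fin 2) D) :
    X = ![1, 0] ⊠ X 0 + ![0, 1] ⊠ X 1 := by
  ext i j
  rw [Matrix.add_apply, vecMulVec_apply, vecMulVec_apply]
  fin_cases i <;> simp

/-- A map on `2 × 2` matrices which is regular somewhere is regular everywhere. -/
theorem exists_shift_two [Fintype p] [Fintype q] (hφ : AdjPres φ) (A₀ : Matrix (Fin 2) (Fin 2) D)
    (H : ∃ h g, Reg (shift φ A₀) h g) (A : Matrix (Fin 2) (Fin 2) D) :
    ∃ h g, Reg (shift φ A) h g := by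
  have step : ∀ {A : Matrix (Fin 2) (Fin 2) D} {x₁ x₂ y₁ y₂ : Fin 2 → D}, x₁ ≠ 0 → x₂ ≠ 0 →
      y₁ ≠ 0 → y₂ ≠ 0 → ¬ CPar x₁ x₂ → ¬ RPar y₁ y₂ → (∃ h g, Reg (shift φ A) h g) →
      ∃ h g, Reg (shift φ (A + (x₁ ⊠ y₁ + x₂ ⊠ y₂))) h g := by
    rintro A x₁ x₂ y₁ y₂ hx₁ hx₂ hy₁ hy₂ hx hy ⟨h, g, H⟩
    rw [← shift_shift]
    exact H.exists_shift (hφ.shift A) hx₁ hx₂ hy₁ hy₂ (H.not_cPar (hφ.shift A) hx₁ hx₂ hx)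
      (H.not_rPar (hφ.shift A) hy₁ hy₂ hy)
  -- A displacement of rank one is a sum of two of rank two: `x ⊠ y = (x ⊠ y' + x' ⊠ y) + (x ⊠ (y -
  -- y') - x' ⊠ y)`.
  have one : ∀ {A : Matrix (Fin 2) (Fin 2) D} (x y : Fin 2 → D), x ≠ 0 →
      (∃ h g, Reg (shift φ A) h g) → ∃ h g, Reg (shift φ (A + x ⊠ y)) h g := by
    intro A x y hx hA
    by_cases hy : y = 0
    · simpa [hy] using hA
    obtain ⟨x', hx', hxx⟩ := exists_not_cPar x
    obtain ⟨y', hy', hyy⟩ := exists_not_rPar y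
    have hyd : y - y' ≠ 0 := by
      intro h0; rw [sub_eq_zero] at h0; subst h0; exact hyy (RPar.refl _)
    have s1 := step hx hx' hy' hy hxx (fun h1 => hyy h1.symm) hA
    have s2 := step hx (neg_ne_zero.2 hx') hyd hy ?_ ?_ s1
    · have e : A + x ⊠ y = A + (x ⊠ y' + x' ⊠ y) + (x ⊠ (y - y') + (-x') ⊠ y) := by
        rw [vecMulVec_sub, neg_vecMulVec]; abel
      rwa [e]
    · rintro ⟨c, hc, h1⟩
      exact hxx ⟨-c, neg_ne_zero.2 hc, fun i => by rw [mul_neg, ← h1]; simp⟩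
    · rintro ⟨c, hc, h1⟩
      refine hyy ⟨1 - c⁻¹, ?_, fun i => ?_⟩
      · intro h0
        rw [sub_eq_zero, eq_comm, inv_eq_one] at h0
        subst h0
        refine hy' (funext fun i => ?_)
        exact sub_eq_self.1 ((one_mul ((y - y') i)).symm.trans (h1 i).symm)
      · have := h1 i
        simp only [Pi.sub_apply] at this
        rw [sub_mul, one_mul, eq_sub_iff_add_eq, ← eq_sub_iff_add_eq', this, ← mul_assoc,
          inv_mul_cancel₀ hc, one_mul, ← this]
  have := one ![0, 1] ((A - A₀) 1) (by simp) (one ![1, 0] ((A - A₀) 0) (by simp) H)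
  rwa [add_assoc, ← eq_vecMulVec_add, add_sub_cancel] at this

/-- A regular map on `2 × 2` matrices takes its values in a `2 × 2` block. -/
theorem exists_two_by_two [Fintype p] [Fintype q] (H : Reg φ h g) (hφ : AdjPres φ)
    (h0 : φ 0 = 0) : ∃ (U : Matrix p (Fin 2) E) (V : Matrix (Fin 2) q E)
      (ψ : Matrix (Fin 2) (Fin 2) D → Matrix (Fin 2) (Fin 2) E),
      (∀ X, φ X = U * ψ X * V) ∧ ψ 0 = 0 ∧ AdjPres ψ ∧
      ∃ h' g', Reg ψ h' g' := by
  have n1 : (![1, 0] : Fin 2 → D) ≠ 0 := by simp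
  have n2 : (![0, 1] : Fin 2 → D) ≠ 0 := by simp
  have hx : ¬ CPar (h ![1, 0]) (h ![0, 1]) := H.not_cPar hφ n1 n2 (by
    rintro ⟨c, hc, h⟩; simpa [eq_comm, hc] using h 0)
  have hy : ¬ RPar (g ![1, 0]) (g ![0, 1]) := H.not_rPar hφ n1 n2 (by
    rintro ⟨c, hc, h⟩; simpa [eq_comm, hc] using h 0)
  obtain ⟨z₁, z11, z12⟩ := exists_dotProduct_col (H.col_ne _ n1) (H.col_ne _ n2) hx
  obtain ⟨z₂, z22, z21⟩ := exists_dotProduct_col (H.col_ne _ n2) (H.col_ne _ n1)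
    fun h1 => hx h1.symm
  obtain ⟨t₁, t11, t12⟩ := exists_dotProduct_row (H.row_ne _ n1) (H.row_ne _ n2) hy
  obtain ⟨t₂, t22, t21⟩ := exists_dotProduct_row (H.row_ne _ n2) (H.row_ne _ n1)
    fun h1 => hy h1.symm
  have colmem : ∀ x, x ≠ 0 → ∃ s t : E,
      h x = MulOpposite.op s • h ![1, 0] + MulOpposite.op t • h ![0, 1] := by
    intro x hx0
    have ex : x = MulOpposite.op (x 0) • ![1, 0] + MulOpposite.op (x 1) • ![0, 1] := by
      ext i; fin_cases i <;> simp
    by_cases ha : x 0 = 0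
    · have hb : x 1 ≠ 0 := by
        intro hb; apply hx0; rw [ex, ha, hb]; simp
      obtain ⟨c, -, hc⟩ := (H.col_smul n2 hb).exists_eq
      rw [ha, MulOpposite.op_zero, zero_smul, zero_add] at ex
      rw [← ex] at hc
      exact ⟨0, c, by rw [hc]; simp⟩
    by_cases hb : x 1 = 0
    · obtain ⟨c, -, hc⟩ := (H.col_smul n1 ha).exists_eq
      rw [hb, MulOpposite.op_zero, zero_smul, add_zero] at ex
      rw [← ex] at hc
      exact ⟨c, 0, by rw [hc]; simp⟩
    · have ha' := H.col_smul n1 ha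
      have hb' := H.col_smul n2 hb
      obtain ⟨s, t, e⟩ := H.col_add_mem hφ (x₁ := MulOpposite.op (x 0) • ![1, 0])
        (x₂ := MulOpposite.op (x 1) • ![0, 1]) (smul_ne_zero (by simpa using ha) n1)
        (smul_ne_zero (by simpa using hb) n2)
        (fun h1 => hx ((ha'.trans h1).trans hb'.symm))
      obtain ⟨c, -, hc⟩ := ha'.exists_eq
      obtain ⟨d, -, hd⟩ := hb'.exists_eq
      rw [← ex, hc, hd, smul_smul, smul_smul, ← op_mul, ← op_mul] at e
      exact ⟨_, _, e⟩
  have rowmem : ∀ y, y ≠ 0 → ∃ s t : E, g y = s • g ![1, 0] + t • g ![0, 1] := by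
    intro y hy0
    have ey : y = y 0 • ![1, 0] + y 1 • ![0, 1] := by
      ext i; fin_cases i <;> simp
    by_cases ha : y 0 = 0
    · have hb : y 1 ≠ 0 := by
        intro hb; apply hy0; rw [ey, ha, hb]; simp
      obtain ⟨c, -, hc⟩ := (H.row_smul n2 hb).exists_eq
      rw [ha, zero_smul, zero_add] at ey
      rw [← ey] at hc
      exact ⟨0, c, by rw [hc]; simp⟩
    by_cases hb : y 1 = 0
    · obtain ⟨c, -, hc⟩ := (H.row_smul n1 ha).exists_eq
      rw [hb, zero_smul, add_zero] at ey
      rw [← ey] at hc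
      exact ⟨c, 0, by rw [hc]; simp⟩
    · have ha' := H.row_smul n1 ha
      have hb' := H.row_smul n2 hb
      obtain ⟨s, t, e⟩ := H.row_add_mem hφ (y₁ := y 0 • ![1, 0])
        (y₂ := y 1 • ![0, 1]) (smul_ne_zero ha n1) (smul_ne_zero hb n2)
        (fun h1 => hy ((ha'.trans h1).trans hb'.symm))
      obtain ⟨c, -, hc⟩ := ha'.exists_eq
      obtain ⟨d, -, hd⟩ := hb'.exists_eq
      rw [← ey, hc, hd, smul_smul, smul_smul] at e
      exact ⟨_, _, e⟩
  -- `U` and `V` are built from the images of the basis vectors; the separating vectors `z` and `t`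
  -- give one-sided inverses `U'` and `V'`, and the reduced map is `U' * φ X * V'`.
  set U : Matrix p (Fin 2) E := of fun i => ![h ![1, 0] i, h ![0, 1] i] with hU
  set V : Matrix (Fin 2) q E := of ![g ![1, 0], g ![0, 1]] with hV
  set U' : Matrix (Fin 2) p E := of ![z₁, z₂] with hU'
  set V' : Matrix q (Fin 2) E := of fun i => ![t₁ i, t₂ i] with hV'
  have UU : U' * U = 1 := by
    ext i j
    fin_cases i <;> fin_cases j <;>
      simpa [mul_apply, U, U', dotProduct] using by assumption
  have VV : V * V' = 1 := by
    ext i j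
    fin_cases i <;> fin_cases j <;>
      simpa [mul_apply, V, V', dotProduct] using by assumption
  have hUm : ∀ s t : E, MulOpposite.op s • h ![1, 0] + MulOpposite.op t • h ![0, 1] =
      U *ᵥ ![s, t] := by
    intro s t; ext i; simp [U, mulVec, dotProduct]
  have hVm : ∀ s t : E, s • g ![1, 0] + t • g ![0, 1] = ![s, t] ᵥ* V := by
    intro s t; ext i; simp [V, vecMul, dotProduct]
  have hfix : ∀ Y : Matrix (Fin 2) (Fin 2) E, U' * (U * Y * V) * V' = Y := by
    intro Y
    rw [Matrix.mul_assoc U, ← Matrix.mul_assoc, UU, Matrix.one_mul, Matrix.mul_assoc, VV,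
      Matrix.mul_one]
  have rk : ∀ x y, x ≠ 0 → y ≠ 0 → ∃ Y : Matrix (Fin 2) (Fin 2) E, φ (x ⊠ y) = U * Y * V := by
    intro x y hx0 hy0
    obtain ⟨c, -, e⟩ := H.map x y hx0 hy0
    obtain ⟨s, t, e1⟩ := colmem x hx0
    obtain ⟨s', t', e2⟩ := rowmem y hy0
    rw [e, e1, e2, hUm, hVm, ← smul_vecMul, ← vecMulVec_mul, ← mul_vecMulVec]
    exact ⟨_, rfl⟩
  have sp : ∀ X, ∃ Y : Matrix (Fin 2) (Fin 2) E, φ X = U * Y * V := by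
    intro X
    have eX := eq_vecMulVec_add X
    by_cases ha : X 0 = 0
    · rw [ha, vecMulVec_zero_right, zero_add] at eX
      by_cases hb : X 1 = 0
      · rw [hb, vecMulVec_zero_right] at eX
        exact ⟨0, by rw [eX, h0]; simp⟩
      · rw [eX]; exact rk _ _ n2 hb
    by_cases hb : RPar (X 0) (X 1)
    · obtain ⟨c, -, hc⟩ := hb.exists_eq
      rw [hc, vecMulVec_smul', ← add_vecMulVec] at eX
      rw [eX]
      refine rk _ _ (fun h1 => ?_) ha
      simpa using congrFun h1 0
    by_cases hb0 : X 1 = 0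
    · rw [hb0, vecMulVec_zero_right, add_zero] at eX
      rw [eX]; exact rk _ _ n1 ha
    · obtain ⟨a, b, c, d, e⟩ := H.map_add_mem hφ n1 n2 ha hb0 hx (H.not_rPar hφ ha hb0 hb)
      obtain ⟨s, t, e1⟩ := rowmem _ ha
      obtain ⟨s', t', e2⟩ := rowmem _ hb0
      rw [← eX] at e
      have u1 : h ![1, 0] = U *ᵥ ![1, 0] := by rw [← hUm]; simp
      have u2 : h ![0, 1] = U *ᵥ ![0, 1] := by rw [← hUm]; simp
      rw [e, e1, e2, hVm, hVm, u1, u2]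
      simp only [← smul_vecMul, ← add_vecMul, ← vecMulVec_mul, ← mul_vecMulVec, ← Matrix.add_mul,
        ← Matrix.mul_add]
      exact ⟨_, rfl⟩
  have sp' : ∀ X, φ X = U * (U' * φ X * V') * V := by
    intro X
    obtain ⟨Y, hY⟩ := sp X
    rw [hY, hfix]
  refine ⟨U, V, fun X => U' * φ X * V', sp', by simp [h0], ?_, ?_⟩
  · intro A B hAB
    obtain ⟨u, w, hu, hw, e⟩ := hφ A B hAB
    have e' : U' * φ A * V' - U' * φ B * V' = (U' *ᵥ u) ⊠ (w ᵥ* V') := by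
      rw [← Matrix.sub_mul, ← Matrix.mul_sub, e, mul_vecMulVec, vecMulVec_mul]
    show IsRankOne (U' * φ A * V' - U' * φ B * V')
    rw [e']
    apply isRankOne_of_ne_zero
    rw [← e', sub_ne_zero]
    intro h1
    have := (hφ A B hAB).ne_zero
    rw [sp' A, sp' B, h1, sub_self] at this
    exact this rfl
  · have hne : ∀ x y, x ≠ 0 → y ≠ 0 → U' *ᵥ h x ≠ 0 ∧ g y ᵥ* V' ≠ 0 := by
      intro x y hx0 hy0
      obtain ⟨c, -, e⟩ := H.map x y hx0 hy0
      have := H.map_ne_zero hx0 hy0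
      rw [sp', e, mul_vecMulVec, vecMulVec_mul, smul_vecMul] at this
      constructor <;> intro h1 <;> apply this <;> rw [h1] <;> simp
    refine ⟨fun x => U' *ᵥ h x, fun y => g y ᵥ* V', fun x hx0 => (hne x _ hx0 n1).1,
      fun y hy0 => (hne _ y n1 hy0).2, ?_, ⟨![1, 0], ![0, 1], n1, n2, ?_⟩,
      ⟨![1, 0], ![0, 1], n1, n2, ?_⟩⟩
    · intro x y hx0 hy0
      obtain ⟨c, hc, e⟩ := H.map x y hx0 hy0
      exact ⟨c, hc, by rw [e, mul_vecMulVec, vecMulVec_mul, smul_vecMul]⟩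
    · rintro ⟨c, hc, h1⟩
      have := h1 0
      simp [U', mulVec, z11, z12, hc, eq_comm] at this
    · rintro ⟨c, hc, h1⟩
      have := h1 0
      have e1 : (g ![1, 0] ᵥ* V') 0 = 1 := t11
      have e2 : (g ![0, 1] ᵥ* V') 0 = 0 := t12
      simp [e1, e2, hc, eq_comm] at this

end Reg

/-! ### Affine coordinates -/

section Space

variable {Q : Type*} [AddCommGroup Q] [Module E Q]

theorem vec_two_eq (w : Fin 2 → D) : w = w 0 • ![1, 0] + w 1 • ![0, 1] := by
  ext i; fin_cases i <;> simp

/-- A point off the second axis has the form `(1 - t) p + t q` with `p`, `q` on the two axes. This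
needs a scalar `t` other than `0` and `1`: with two scalars, lines carry no information. -/
theorem mem_span_of_mem_lines (h3 : ∃ t : D, t ≠ 0 ∧ t ≠ 1) {P : (Fin 2 → D) → Q}
    (hline : ∀ w y (s : D), y ≠ 0 → P (w + s • y) ∈ Submodule.span E {P w, P (w + y)})
    (w : Fin 2 → D) : P w ∈ Submodule.span E {P 0, P ![1, 0], P ![0, 1]} := by
  obtain ⟨t, ht0, ht1⟩ := h3
  set K := Submodule.span E {P 0, P ![1, 0], P ![0, 1]} with hK
  have k0 : P 0 ∈ K := Submodule.subset_span (by simp)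
  have k1 : P ![1, 0] ∈ K := Submodule.subset_span (by simp)
  have k2 : P ![0, 1] ∈ K := Submodule.subset_span (by simp)
  have gen : ∀ w y (s : D), y ≠ 0 → P w ∈ K → P (w + y) ∈ K → P (w + s • y) ∈ K := by
    intro w y s hy h1 h2
    refine Submodule.span_le.2 ?_ (hline w y s hy)
    rintro _ (rfl | rfl)
    exacts [h1, h2]
  have ax1 : ∀ s : D, P (s • ![1, 0]) ∈ K := fun s => by
    have := gen 0 ![1, 0] s (by simp) k0 (by rwa [zero_add])
    rwa [zero_add] at this
  have ax2 : ∀ s : D, P (s • ![0, 1]) ∈ K := fun s => by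
    have := gen 0 ![0, 1] s (by simp) k0 (by rwa [zero_add])
    rwa [zero_add] at this
  by_cases h0 : w 0 = 0
  · rw [vec_two_eq w, h0, zero_smul, zero_add]; exact ax2 _
  have h1t : 1 - t ≠ 0 := sub_ne_zero.2 ht1.symm
  have := gen (((1 - t)⁻¹ * w 0) • ![1, 0])
    ((t⁻¹ * w 1) • ![0, 1] - ((1 - t)⁻¹ * w 0) • ![1, 0]) t ?_ (ax1 _)
    (by rw [add_sub_cancel]; exact ax2 _)
  · have e : ((1 - t)⁻¹ * w 0) • ![1, 0] +
        t • ((t⁻¹ * w 1) • ![0, 1] - ((1 - t)⁻¹ * w 0) • ![1, 0]) = w := by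
      ext i
      fin_cases i
      · have : (1 - t)⁻¹ * w 0 - t * ((1 - t)⁻¹ * w 0) = w 0 := by
          rw [← one_sub_mul, ← mul_assoc, mul_inv_cancel₀ h1t, one_mul]
        simpa [← sub_eq_add_neg] using this
      · simp [← mul_assoc, ht0]
    rwa [e] at this
  · intro h
    have := congrFun h 0
    simp [h0, h1t] at this

/-- Coordinates of a family of points outside a hyperplane, when the lines in a given direction
meet the hyperplane in a common point. -/
theorem exists_affine_coords {K : Submodule E Q} {P : (Fin 2 → D) → Q} {δ : (Fin 2 → D) → Q}
    (hPK : ∀ w, P w ∉ K) (hP : ∀ w, P w ∈ Submodule.span E {P 0, P ![1, 0], P ![0, 1]})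
    (hδ0 : ∀ y, y ≠ 0 → δ y ≠ 0) (hδK : ∀ y, y ≠ 0 → δ y ∈ K)
    (hδ : ∀ y, y ≠ 0 → ∀ w (s : D), s ≠ 0 → δ y ∈ Submodule.span E {P w, P (w + s • y)}) :
    ∃ S : (Fin 2 → D) → (Fin 2 → E), S 0 = 0 ∧
      (∀ w, ∃ c : E, c ≠ 0 ∧ P w = c • (P 0 + S w 0 • δ ![1, 0] + S w 1 • δ ![0, 1])) ∧
      ∀ y, y ≠ 0 → ∀ w (s : D), s ≠ 0 → ∃ c : E, c ≠ 0 ∧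
        c • δ y = (S (w + s • y) - S w) 0 • δ ![1, 0] + (S (w + s • y) - S w) 1 • δ ![0, 1] := by
  have n1 : (![1, 0] : Fin 2 → D) ≠ 0 := by simp
  have n2 : (![0, 1] : Fin 2 → D) ≠ 0 := by simp
  have hsmul : ∀ w (a : E), a • P w ∈ K → a = 0 := by
    intro w a h
    by_contra ha
    have := K.smul_mem a⁻¹ h
    rw [smul_smul, inv_mul_cancel₀ ha, one_smul] at this
    exact hPK w this
  have ax : ∀ y, y ≠ 0 → ∃ a b : E, P y = a • P 0 + b • δ y := by
    intro y hy
    have := hδ y hy 0 1 one_ne_zero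
    rw [one_smul, zero_add, Submodule.mem_span_pair] at this
    obtain ⟨a, b, h⟩ := this
    have hb : b ≠ 0 := by
      rintro rfl
      rw [zero_smul, add_zero] at h
      have ha := hsmul 0 a (by rw [h]; exact hδK y hy)
      rw [ha, zero_smul] at h
      exact hδ0 y hy h.symm
    refine ⟨-(b⁻¹ * a), b⁻¹, ?_⟩
    rw [← h, smul_add, smul_smul, smul_smul, inv_mul_cancel₀ hb, one_smul, neg_smul,
      neg_add_cancel_left]
  obtain ⟨a₁, b₁, e₁⟩ := ax _ n1
  obtain ⟨a₂, b₂, e₂⟩ := ax _ n2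
  -- The coefficient of `P 0` is nonzero because `P w ∉ K`, so it can be normalised to `1`.
  have co : ∀ w, ∃ (s : Fin 2 → E) (c : E), c ≠ 0 ∧
      P w = c • (P 0 + s 0 • δ ![1, 0] + s 1 • δ ![0, 1]) := by
    intro w
    have := hP w
    rw [Submodule.mem_span_triple] at this
    obtain ⟨a, b, c, h⟩ := this
    have h' : P w = (a + b * a₁ + c * a₂) • P 0 + (b * b₁) • δ ![1, 0] +
        (c * b₂) • δ ![0, 1] := by
      rw [← h, e₁, e₂]; simp only [smul_add, add_smul, smul_smul]; abel
    have hne : a + b * a₁ + c * a₂ ≠ 0 := by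
      intro h0
      rw [h0, zero_smul, zero_add] at h'
      apply hPK w
      rw [h']
      exact K.add_mem (K.smul_mem _ (hδK _ n1)) (K.smul_mem _ (hδK _ n2))
    refine ⟨![(a + b * a₁ + c * a₂)⁻¹ * (b * b₁), (a + b * a₁ + c * a₂)⁻¹ * (c * b₂)],
      _, hne, ?_⟩
    simp only [cons_val_zero, cons_val_one, smul_add, smul_smul, ← mul_assoc, mul_inv_cancel₀ hne,
      one_mul]
    exact h'
  choose S hS using co
  classical
  -- Uniqueness of coordinates is not available here, so `S 0 = 0` is imposed.
  refine ⟨fun w => if w = 0 then 0 else S w, by simp, ?_, ?_⟩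
  · intro w
    by_cases hw : w = 0
    · exact ⟨1, one_ne_zero, by simp [hw]⟩
    · simpa [hw] using hS w
  intro y hy w s hs
  set T : (Fin 2 → D) → Fin 2 → E := fun w => if w = 0 then 0 else S w with hT
  have hTw : ∀ w, ∃ c : E, c ≠ 0 ∧ P w = c • (P 0 + T w 0 • δ ![1, 0] + T w 1 • δ ![0, 1]) := by
    intro w
    by_cases hw : w = 0
    · exact ⟨1, one_ne_zero, by simp [hT, hw]⟩
    · simpa [hT, hw] using hS w
  obtain ⟨c, hc, hcw⟩ := hTw w
  obtain ⟨c', hc', hcw'⟩ := hTw (w + s • y)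
  have hmem := hδ y hy w s hs
  rw [Submodule.mem_span_pair] at hmem
  obtain ⟨a, b, h⟩ := hmem
  rw [hcw, hcw'] at h
  have hK1 : ∀ w, T w 0 • δ ![1, 0] + T w 1 • δ ![0, 1] ∈ K := fun w =>
    K.add_mem (K.smul_mem _ (hδK _ n1)) (K.smul_mem _ (hδK _ n2))
  -- The point `δ y` lies in `K` and `P 0` does not, so the coefficient of `P 0` vanishes and only
  -- the difference of coordinates remains.
  have hz : a * c + b * c' = 0 := by
    apply hsmul 0
    have e : (a * c + b * c') • P 0 = δ y -
        ((a * c) • (T w 0 • δ ![1, 0] + T w 1 • δ ![0, 1]) +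
          (b * c') • (T (w + s • y) 0 • δ ![1, 0] + T (w + s • y) 1 • δ ![0, 1])) := by
      rw [← h]; simp only [smul_add, add_smul, smul_smul, mul_assoc]; abel
    rw [e]
    exact K.sub_mem (hδK y hy) (K.add_mem (K.smul_mem _ (hK1 _)) (K.smul_mem _ (hK1 _)))
  have hz' : a * c = -(b * c') := eq_neg_of_add_eq_zero_left hz
  have h' : δ y = (b * c') • ((T (w + s • y) - T w) 0 • δ ![1, 0] +
      (T (w + s • y) - T w) 1 • δ ![0, 1]) := by
    rw [← h, smul_smul, hz']
    simp only [Pi.sub_apply, smul_add, smul_smul, neg_smul, sub_smul, smul_sub, neg_mul,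
      mul_assoc]
    abel
  have hne : b * c' ≠ 0 := by
    intro h0
    rw [h0, zero_smul] at h'
    exact hδ0 y hy h'
  refine ⟨(b * c')⁻¹, inv_ne_zero hne, ?_⟩
  rw [h', smul_smul, inv_mul_cancel₀ hne, one_smul]

end Space

/-- Two maps of the affine plane which map parallel lines to parallel lines, with the same action
on directions, are semilinear with respect to the same ring homomorphism. -/
theorem exists_ringHom_of_directions {S T d : (Fin 2 → D) → (Fin 2 → E)} (hS0 : S 0 = 0)
    (hT0 : T 0 = 0) (d1 : d ![1, 0] = ![1, 0]) (d2 : d ![0, 1] = ![0, 1])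
    (hS : ∀ y, y ≠ 0 → ∀ w (s : D), s ≠ 0 → ∃ c : E, c ≠ 0 ∧ S (w + s • y) - S w = c • d y)
    (hT : ∀ y, y ≠ 0 → ∀ w (s : D), s ≠ 0 → ∃ c : E, c ≠ 0 ∧ T (w + s • y) - T w = c • d y) :
    ∃ (τ : D →+* E) (α β μ : E), μ ≠ 0 ∧ (∀ w, S w = ![τ (w 0) * α, τ (w 1) * β]) ∧
      ∀ w, T w = ![μ * (τ (w 0) * α), μ * (τ (w 1) * β)] := by
  have n1 : (![1, 0] : Fin 2 → D) ≠ 0 := by simp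
  have n2 : (![0, 1] : Fin 2 → D) ≠ 0 := by simp
  -- The two axis directions are fixed, so each coordinate of the image depends only on the same
  -- coordinate of the argument.
  have sep : ∀ {R : (Fin 2 → D) → (Fin 2 → E)}, R 0 = 0 →
      (∀ y, y ≠ 0 → ∀ w (s : D), s ≠ 0 → ∃ c : E, c ≠ 0 ∧ R (w + s • y) - R w = c • d y) →
      (∀ a b : D, R ![a, b] = ![R ![a, 0] 0, R ![0, b] 1]) ∧
      (∀ a : D, R ![a, 0] 1 = 0) ∧ ∀ b : D, R ![0, b] 0 = 0 := by
    intro R hR0 hR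
    have r1 : ∀ a b, R ![a, b] 1 = R ![0, b] 1 := by
      intro a b
      by_cases ha : a = 0
      · rw [ha]
      obtain ⟨c, -, h⟩ := hR _ n1 ![0, b] a ha
      have := congrFun h 1
      simpa [d1, sub_eq_zero] using this
    have r0 : ∀ a b, R ![a, b] 0 = R ![a, 0] 0 := by
      intro a b
      by_cases hb : b = 0
      · rw [hb]
      obtain ⟨c, -, h⟩ := hR _ n2 ![a, 0] b hb
      have := congrFun h 0
      simpa [d2, sub_eq_zero] using this
    have z : (![0, 0] : Fin 2 → D) = 0 := by ext i; fin_cases i <;> rfl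
    refine ⟨fun a b => ?_, fun a => ?_, fun b => ?_⟩
    · ext i; fin_cases i
      · exact r0 a b
      · exact r1 a b
    · rw [r1, z, hR0]; rfl
    · rw [r0, z, hR0]; rfl
  obtain ⟨hSs, hS1, hS2⟩ := sep hS0 hS
  obtain ⟨hTs, hT1, hT2⟩ := sep hT0 hT
  set σ₁ : D → E := fun a => S ![a, 0] 0 with hσ₁
  set σ₂ : D → E := fun b => S ![0, b] 1 with hσ₂
  set ρ₁ : D → E := fun a => T ![a, 0] 0 with hρ₁
  set ρ₂ : D → E := fun b => T ![0, b] 1 with hρ₂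
  have hSs' : ∀ a b, S ![a, b] = ![σ₁ a, σ₂ b] := hSs
  have hTs' : ∀ a b, T ![a, b] = ![ρ₁ a, ρ₂ b] := hTs
  have z : (![0, 0] : Fin 2 → D) = 0 := by ext i; fin_cases i <;> rfl
  have s10 : σ₁ 0 = 0 := by simp only [hσ₁, z, hS0]; rfl
  have s20 : σ₂ 0 = 0 := by simp only [hσ₂, z, hS0]; rfl
  have t10 : ρ₁ 0 = 0 := by simp only [hρ₁, z, hT0]; rfl
  have t20 : ρ₂ 0 = 0 := by simp only [hρ₂, z, hT0]; rfl
  have hα : σ₁ 1 ≠ 0 := by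
    obtain ⟨c, hc, h⟩ := hS _ n1 0 1 one_ne_zero
    rw [one_smul, zero_add, hS0, sub_zero, d1] at h
    have := congrFun h 0
    simp only [hσ₁, this]
    simpa using hc
  have hβ : σ₂ 1 ≠ 0 := by
    obtain ⟨c, hc, h⟩ := hS _ n2 0 1 one_ne_zero
    rw [one_smul, zero_add, hS0, sub_zero, d2] at h
    have := congrFun h 1
    simp only [hσ₂, this]
    simpa using hc
  set α := σ₁ 1 with hα'
  set β := σ₂ 1 with hβ'
  have dir : ∀ {R : (Fin 2 → D) → (Fin 2 → E)},
      (∀ y, y ≠ 0 → ∀ w (s : D), s ≠ 0 → ∃ c : E, c ≠ 0 ∧ R (w + s • y) - R w = c • d y) →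
      ∀ (a : D) w (s : D), s ≠ 0 →
        ∃ c : E, c ≠ 0 ∧ R (w + s • ![1, a]) - R w = c • ![α, σ₂ a] := by
    intro R hR a w s hs
    have na : (![1, a] : Fin 2 → D) ≠ 0 := by intro h; simpa using congrFun h 0
    obtain ⟨c, hc, h⟩ := hS _ na 0 1 one_ne_zero
    obtain ⟨c', hc', h'⟩ := hR _ na w s hs
    rw [one_smul, zero_add, hS0, sub_zero, hSs'] at h
    refine ⟨c' * c⁻¹, mul_ne_zero hc' (inv_ne_zero hc), ?_⟩
    rw [h', h, smul_smul, mul_assoc, inv_mul_cancel₀ hc, mul_one]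
  -- Lines of direction `(1, 1)` through `(a, 0)` give additivity; lines of direction `(1, a)`
  -- through `0` give multiplicativity.
  have add : ∀ a t : D, ∃ c, σ₁ (a + t) - σ₁ a = c * α ∧ σ₂ t = c * β := by
    intro a t
    by_cases ht : t = 0
    · exact ⟨0, by simp [ht, s20]⟩
    obtain ⟨c, -, h⟩ := dir hS 1 ![a, 0] t ht
    have e : ![a, 0] + t • ![1, 1] = ![a + t, t] := by ext i; fin_cases i <;> simp
    rw [e, hSs', hSs', s20] at h
    exact ⟨c, by simpa using congrFun h 0, by simpa using congrFun h 1⟩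
  have mul : ∀ t a : D, ∃ c, σ₁ t = c * α ∧ σ₂ (t * a) = c * σ₂ a := by
    intro t a
    by_cases ht : t = 0
    · exact ⟨0, by simp [ht, s10, s20]⟩
    obtain ⟨c, -, h⟩ := dir hS a 0 t ht
    have e : 0 + t • ![1, a] = ![t, t * a] := by ext i; fin_cases i <;> simp
    rw [e, hSs', hS0, sub_zero] at h
    exact ⟨c, by simpa using congrFun h 0, by simpa using congrFun h 1⟩
  -- The slope on the right is the one of `S`; this common slope ties the coordinates of `T` to the
  -- homomorphism found for `S`.
  have mulT : ∀ t a : D, ∃ c, ρ₁ t = c * α ∧ ρ₂ (t * a) = c * σ₂ a := by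
    intro t a
    by_cases ht : t = 0
    · exact ⟨0, by simp [ht, t10, t20]⟩
    obtain ⟨c, -, h⟩ := dir hT a 0 t ht
    have e : 0 + t • ![1, a] = ![t, t * a] := by ext i; fin_cases i <;> simp
    rw [e, hTs', hT0, sub_zero] at h
    exact ⟨c, by simpa using congrFun h 0, by simpa using congrFun h 1⟩
  set τ : D → E := fun t => σ₁ t * α⁻¹ with hτ
  have e1 : ∀ t, σ₁ t = τ t * α := fun t => by simp [hτ, hα]
  have cancel : ∀ {c t}, σ₁ t = c * α → c = τ t := fun {c t} h => by
    rw [e1] at h; exact (mul_right_cancel₀ hα h).symm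
  have e2 : ∀ t, σ₂ t = τ t * β := by
    intro t
    obtain ⟨c, h1, h2⟩ := add 0 t
    rw [zero_add, s10, sub_zero] at h1
    rw [h2, cancel h1]
  have τ1 : τ 1 = 1 := by simp [hτ, ← hα', hα]
  have τadd : ∀ a t, τ (a + t) = τ a + τ t := by
    intro a t
    obtain ⟨c, h1, h2⟩ := add a t
    rw [e2] at h2
    have h3 := mul_right_cancel₀ hβ h2
    rw [← h3, e1, e1, ← sub_mul] at h1
    have h4 := mul_right_cancel₀ hα h1
    rw [← h4, add_sub_cancel]
  have τmul : ∀ t a, τ (t * a) = τ t * τ a := by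
    intro t a
    obtain ⟨c, h1, h2⟩ := mul t a
    rw [cancel h1, e2, e2, ← mul_assoc] at h2
    exact mul_right_cancel₀ hβ h2
  set κ : D → E := fun t => ρ₁ t * α⁻¹ with hκ
  have k1 : ∀ t, ρ₁ t = κ t * α := fun t => by simp [hκ, hα]
  have k2 : ∀ t a, ρ₂ (t * a) = κ t * (τ a * β) := by
    intro t a
    obtain ⟨c, h1, h2⟩ := mulT t a
    rw [k1] at h1
    rw [h2, e2, mul_right_cancel₀ hα h1]
  have k3 : ∀ t, κ t = κ 1 * τ t := by
    intro t
    have h1 := k2 t 1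
    have h2 := k2 1 t
    rw [mul_one] at h1
    rw [one_mul, h1, τ1, one_mul, ← mul_assoc] at h2
    exact mul_right_cancel₀ hβ h2
  have hμ : κ 1 ≠ 0 := by
    obtain ⟨c, hc, h⟩ := hT _ n1 0 1 one_ne_zero
    rw [one_smul, zero_add, hT0, sub_zero, d1] at h
    have := congrFun h 0
    simp only [hκ, hρ₁, this]
    simpa using ⟨hc, hα⟩
  refine ⟨{ toFun := τ, map_one' := τ1, map_mul' := τmul, map_zero' := by simp [hτ, s10],
            map_add' := τadd }, α, β, κ 1, hμ, fun w => ?_, fun w => ?_⟩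
  · have : w = ![w 0, w 1] := by ext i; fin_cases i <;> rfl
    rw [this, hSs', e1, e2]; rfl
  · have : w = ![w 0, w 1] := by ext i; fin_cases i <;> rfl
    have h2 := k2 1 (w 1)
    rw [one_mul] at h2
    rw [this, hTs', k1, h2, k3, mul_assoc]; rfl

/-! ### The cliques given by a row -/

theorem Reg.comp {m' n' : Type*} [Fintype m'] [Fintype m] [Fintype n] [Fintype n']
    {φ : Matrix m n D → Matrix p q E}
    {h : (m → D) → p → E} {g : (n → D) → q → E} (H : Reg φ h g) {P : Matrix m m' D}
    {Q : Matrix n' n D} (hP : ∀ x, x ≠ 0 → P *ᵥ x ≠ 0) (hQ : ∀ y, y ≠ 0 → y ᵥ* Q ≠ 0)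
    (hPn : ∃ x₁ x₂, x₁ ≠ 0 ∧ x₂ ≠ 0 ∧ ¬ CPar (h (P *ᵥ x₁)) (h (P *ᵥ x₂)))
    (hQn : ∃ y₁ y₂, y₁ ≠ 0 ∧ y₂ ≠ 0 ∧ ¬ RPar (g (y₁ ᵥ* Q)) (g (y₂ ᵥ* Q))) :
    Reg (fun X : Matrix m' n' D => φ (P * X * Q)) (fun x => h (P *ᵥ x)) (fun y => g (y ᵥ* Q)) where
  col_ne x hx := H.col_ne _ (hP x hx)
  row_ne y hy := H.row_ne _ (hQ y hy)
  map x y hx hy := by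
    rw [mul_vecMulVec, vecMulVec_mul]
    exact H.map _ _ (hP x hx) (hQ y hy)
  col_nc := hPn
  row_nc := hQn

theorem AdjPres.comp {m' n' : Type*} [Fintype m'] [Fintype m] [Fintype n] [Fintype n']
    {φ : Matrix m n D → Matrix p q E} (hφ : AdjPres φ) {P : Matrix m m' D}
    {Q : Matrix n' n D} (hP : ∀ x, x ≠ 0 → P *ᵥ x ≠ 0) (hQ : ∀ y, y ≠ 0 → y ᵥ* Q ≠ 0) :
    AdjPres (fun X : Matrix m' n' D => φ (P * X * Q)) := by
  intro A B hAB
  apply hφ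
  obtain ⟨x, y, hx, hy, e⟩ := hAB
  refine ⟨_, _, hP x hx, hQ y hy, ?_⟩
  rw [← Matrix.sub_mul, ← Matrix.mul_sub, e, mul_vecMulVec, vecMulVec_mul]

theorem exists_dotProduct_eq_zero (k : Fin 2 → E) : ∃ v : Fin 2 → E, v ≠ 0 ∧ v ⬝ᵥ k = 0 := by
  by_cases hk : k = 0
  · exact ⟨![1, 0], by simp, by simp [hk]⟩
  obtain ⟨k', hk', hn⟩ := exists_not_cPar k
  obtain ⟨z, h1, h2⟩ := exists_dotProduct_col hk' hk fun h => hn h.symm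
  refine ⟨z, ?_, h2⟩
  rintro rfl
  simp at h1

theorem eq_zero_of_dotProduct {k₁ k₂ v : Fin 2 → E} (hk₁ : k₁ ≠ 0) (hk₂ : k₂ ≠ 0)
    (hk : ¬ CPar k₁ k₂) (h1 : v ⬝ᵥ k₁ = 0) (h2 : v ⬝ᵥ k₂ = 0) : v = 0 := by
  ext i
  obtain ⟨a, b, h⟩ := exists_row_coords (y₁ := op ∘ k₁) (y₂ := op ∘ k₂) (op_comp_ne_zero.2 hk₁)
    (op_comp_ne_zero.2 hk₂) (by rwa [rPar_op]) (op ∘ Pi.single i (1 : E))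
  have h' : Pi.single i (1 : E) = op (unop a) • k₁ + op (unop b) • k₂ := by
    ext j
    exact congrArg unop (congrFun h j)
  have := congrArg (v ⬝ᵥ ·) h'
  simpa [dotProduct_add, dotProduct_smul, h1, h2] using this

/-- The points `(v, w)` of the projective plane given by a matrix `M` and a direction `r`. -/
def pencil (M : Matrix (Fin 2) (Fin 2) E) (r : Fin 2 → E) :
    ((Fin 2 → E) × E) →ₗ[E] (Fin 2 → E) × (Fin 2 → E) where
  toFun x := (x.1, x.1 ᵥ* M + x.2 • r)
  map_add' x y := by
    ext i <;> simp [add_vecMul, add_smul]; abel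
  map_smul' c x := by
    ext i <;> simp [smul_vecMul, mul_assoc]

/-- This range is the projective plane spanned by the line of the points `(v, v ᵥ* M)` and the point
`(0, r)`. It contains the lines of all matrices `M + u ⊠ r`. -/
theorem mem_range_pencil {M : Matrix (Fin 2) (Fin 2) E} {r v w : Fin 2 → E} :
    (v, w) ∈ LinearMap.range (pencil M r) ↔ ∃ s : E, w = v ᵥ* M + s • r := by
  constructor
  · rintro ⟨⟨v', s⟩, h⟩
    simp only [pencil, LinearMap.coe_mk, AddHom.coe_mk, Prod.mk.injEq] at h
    obtain ⟨rfl, rfl⟩ := h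
    exact ⟨s, rfl⟩
  · rintro ⟨s, rfl⟩
    exact ⟨(v, s), rfl⟩

theorem finrank_range_pencil (M : Matrix (Fin 2) (Fin 2) E) {r : Fin 2 → E} (hr : r ≠ 0) :
    Module.finrank E (LinearMap.range (pencil M r)) = 3 := by
  rw [LinearMap.finrank_range_of_inj]
  · simp
  · rintro ⟨v, s⟩ ⟨v', s'⟩ h
    simp only [pencil, LinearMap.coe_mk, AddHom.coe_mk, Prod.mk.injEq] at h
    obtain ⟨rfl, h⟩ := h
    rw [add_right_inj] at h
    rw [Prod.mk.injEq]
    exact ⟨rfl, smul_left_injective E hr h⟩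

theorem finrank_inf_of_ne {V : Type*} [AddCommGroup V] [Module E V] [FiniteDimensional E V]
    (hV : Module.finrank E V = 4) {S T : Submodule E V} (hS : Module.finrank E S = 3)
    (hT : Module.finrank E T = 3) (hne : S ≠ T) : Module.finrank E (S ⊓ T : Submodule E V) = 2 := by
  have h1 := Submodule.finrank_sup_add_finrank_inf_eq S T
  have h2 : Module.finrank E (S ⊔ T : Submodule E V) ≤ 4 := hV ▸ Submodule.finrank_le _
  have h3 : S < S ⊔ T := by
    refine lt_of_le_of_ne le_sup_left fun h => hne ?_
    have : T ≤ S := by rw [h]; exact le_sup_right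
    exact (Submodule.eq_of_le_of_finrank_eq this (by rw [hS, hT])).symm
  have h4 := Submodule.finrank_lt_finrank_of_lt h3
  omega

theorem finrank_span_pair {V : Type*} [AddCommGroup V] [Module E V] {a b : V} (ha : a ≠ 0)
    (h : ∀ c : E, b ≠ c • a) : Module.finrank E (Submodule.span E {a, b}) = 2 := by
  have hli : LinearIndependent E ![a, b] := by
    rw [LinearIndependent.pair_iff]
    intro s t hst
    have ht : t = 0 := by
      by_contra ht
      apply h (-(t⁻¹ * s))
      rw [add_comm, add_eq_zero_iff_eq_neg] at hst
      rw [neg_smul, mul_smul, ← smul_neg, ← hst, smul_smul, inv_mul_cancel₀ ht, one_smul]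
    subst ht
    simpa [ha] using hst
  have := finrank_span_eq_card hli
  rwa [Matrix.range_cons, Matrix.range_cons, Matrix.range_empty, Set.union_empty,
    Set.singleton_union, Fintype.card_fin] at this

/-! ### Points of projective three-space attached to the first row -/

section TwoByTwo

variable {φ : Matrix (Fin 2) (Fin 2) D → Matrix (Fin 2) (Fin 2) E}

/-- The restriction of `φ` to the matrices with a given first row is contained in a maximal
clique, the matrices `M` with `V * M = W` for some rows `V`, `W`. -/
def IsRowPoint (φ : Matrix (Fin 2) (Fin 2) D → Matrix (Fin 2) (Fin 2) E)
    (V W : (Fin 2 → D) → Fin 2 → E) : Prop :=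
  (∀ a, V a ≠ 0) ∧ ∀ A, V (A 0) ᵥ* φ A = W (A 0)

variable {h g : Matrix (Fin 2) (Fin 2) D → (Fin 2 → D) → Fin 2 → E}

theorem map_add_vecMulVec (H : ∀ A, Reg (shift φ A) (h A) (g A)) (A : Matrix (Fin 2) (Fin 2) D)
    {x y : Fin 2 → D} (hx : x ≠ 0) (hy : y ≠ 0) :
    ∃ c : E, c ≠ 0 ∧ φ (A + x ⊠ y) = φ A + h A x ⊠ (c • g A y) := by
  obtain ⟨c, hc, e⟩ := (H A).map x y hx hy
  exact ⟨c, hc, by rw [← e, shift]; abel⟩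

theorem vecMul_map_add (H : ∀ A, Reg (shift φ A) (h A) (g A)) (A : Matrix (Fin 2) (Fin 2) D)
    {x y : Fin 2 → D} (hx : x ≠ 0) (hy : y ≠ 0) :
    ∃ c : E, c ≠ 0 ∧ ∀ v, v ᵥ* φ (A + x ⊠ y) = v ᵥ* φ A + ((v ⬝ᵥ h A x) * c) • g A y := by
  obtain ⟨c, hc, e⟩ := map_add_vecMulVec H A hx hy
  exact ⟨c, hc, fun v => by rw [e, vecMul_add, vecMul_vecMulVec, mul_smul]⟩

/-- Matrices with first row `a` differ from `of ![a, 0]` by a product with column `![0, 1]`, so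
their images differ by products with one fixed column. `V a` is a row annihilating it. -/
theorem exists_isRowPoint (H : ∀ A, Reg (shift φ A) (h A) (g A)) :
    ∃ V W, IsRowPoint φ V W := by
  have : ∀ a : Fin 2 → D, ∃ v : Fin 2 → E, v ≠ 0 ∧ v ⬝ᵥ h (of ![a, 0]) ![0, 1] = 0 :=
    fun a => exists_dotProduct_eq_zero _
  choose V hV hV0 using this
  refine ⟨V, fun a => V a ᵥ* φ (of ![a, 0]), hV, fun A => ?_⟩
  have eA : A = of ![A 0, 0] + ![0, 1] ⊠ A 1 := by
    ext i j
    rw [Matrix.add_apply, vecMulVec_apply]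
    fin_cases i <;> simp
  by_cases h1 : A 1 = 0
  · rw [h1, vecMulVec_zero_right, add_zero] at eA
    show V (A 0) ᵥ* φ A = V (A 0) ᵥ* φ (of ![A 0, 0])
    rw [← eA]
  · obtain ⟨c, -, e⟩ := vecMul_map_add H (of ![A 0, 0]) (x := ![0, 1]) (y := A 1) (by simp) h1
    rw [← eA] at e
    rw [e, hV0, zero_mul, zero_smul, add_zero]

variable {V W : (Fin 2 → D) → Fin 2 → E}

theorem add_vecMulVec_row (A : Matrix (Fin 2) (Fin 2) D) (x z : Fin 2 → D) (i : Fin 2) :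
    (A + x ⊠ z) i = A i + x i • z := by
  ext j; rw [Matrix.add_apply, vecMulVec_apply]; rfl

/-- Adding `![1, 0] ⊠ (s • y)` moves the first row by `s • y` and the image by a column times a
multiple of `g A y`. -/
theorem IsRowPoint.mem_pencil (hVW : IsRowPoint φ V W) (H : ∀ A, Reg (shift φ A) (h A) (g A))
    (A : Matrix (Fin 2) (Fin 2) D) {y : Fin 2 → D} (hy : y ≠ 0) (s : D) :
    (V (A 0 + s • y), W (A 0 + s • y)) ∈ LinearMap.range (pencil (φ A) (g A y)) := by
  rw [mem_range_pencil]
  by_cases hs : s = 0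
  · exact ⟨0, by rw [hs]; simp [← hVW.2 A]⟩
  obtain ⟨c, -, e⟩ := vecMul_map_add H A (x := ![1, 0]) (by simp) (smul_ne_zero hs hy)
  obtain ⟨d, -, hd⟩ := ((H A).row_smul hy hs).exists_eq
  have := hVW.2 (A + ![1, 0] ⊠ (s • y))
  rw [add_vecMulVec_row, e, hd] at this
  simp only [cons_val_zero, one_mul, smul_smul] at this
  exact ⟨_, this.symm⟩

/-- Adding `x ⊠ z` with `x 0 = 1` always gives first row `A 0 + z`. In this plane, `V (A 0 + z)`
would annihilate `h A x` for `x = ![1, 0]` and `x = ![1, 1]`, two independent columns, hence vanish.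
-/
theorem IsRowPoint.not_mem_pencil (hVW : IsRowPoint φ V W) (hφ : AdjPres φ)
    (H : ∀ A, Reg (shift φ A) (h A) (g A))
    (A : Matrix (Fin 2) (Fin 2) D) {y z : Fin 2 → D} (hy : y ≠ 0) (hz : z ≠ 0)
    (hyz : ¬ RPar y z) :
    (V (A 0 + z), W (A 0 + z)) ∉ LinearMap.range (pencil (φ A) (g A y)) := by
  rw [mem_range_pencil]
  rintro ⟨s, hs⟩
  have hg : ¬ RPar (g A y) (g A z) := (H A).not_rPar (hφ.shift A) hy hz hyz
  obtain ⟨t, t1, t2⟩ := exists_dotProduct_row ((H A).row_ne z hz) ((H A).row_ne y hy)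
    fun h => hg h.symm
  have key : ∀ x : Fin 2 → D, x ≠ 0 → x 0 = 1 → V (A 0 + z) ⬝ᵥ h A x = 0 := by
    intro x hx hx0
    obtain ⟨c, hc, e⟩ := vecMul_map_add H A hx hz
    have := hVW.2 (A + x ⊠ z)
    rw [add_vecMulVec_row, e, hx0, one_smul, hs, add_right_inj] at this
    have := congrArg (· ⬝ᵥ t) this
    simp only [smul_dotProduct, t1, t2, smul_eq_mul, mul_one, mul_zero, mul_eq_zero] at this
    exact this.resolve_right hc
  have n1 : (![1, 0] : Fin 2 → D) ≠ 0 := by simp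
  have n2 : (![1, 1] : Fin 2 → D) ≠ 0 := by simp
  refine hVW.1 (A 0 + z) (eq_zero_of_dotProduct ((H A).col_ne _ n1) ((H A).col_ne _ n2)
    ((H A).not_cPar (hφ.shift A) n1 n2 ?_) (key _ n1 rfl) (key _ n2 rfl))
  rintro ⟨c, hc, h⟩
  simpa using h 1

theorem IsRowPoint.ne_smul (hVW : IsRowPoint φ V W) (hφ : AdjPres φ)
    (H : ∀ A, Reg (shift φ A) (h A) (g A)) (w : Fin 2 → D) {y : Fin 2 → D} (hy : y ≠ 0) (c : E) :
    (V (w + y), W (w + y)) ≠ c • (V w, W w) := by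
  intro h1
  obtain ⟨y', hy', hn⟩ := exists_not_rPar y
  have h2 := hVW.not_mem_pencil hφ H (of ![w, 0]) hy' hy fun h => hn h.symm
  have h3 := hVW.mem_pencil H (of ![w, 0]) hy' 0
  simp only [zero_smul, add_zero] at h3
  have e : (of ![w, 0] : Matrix (Fin 2) (Fin 2) D) 0 = w := rfl
  rw [e] at h2 h3
  rw [h1] at h2
  exact h2 (Submodule.smul_mem _ _ h3)

theorem IsRowPoint.finrank_line (hVW : IsRowPoint φ V W) (hφ : AdjPres φ)
    (H : ∀ A, Reg (shift φ A) (h A) (g A)) (w : Fin 2 → D) {y : Fin 2 → D} (hy : y ≠ 0) :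
    Module.finrank E (Submodule.span E {(V w, W w), (V (w + y), W (w + y))}) = 2 :=
  finrank_span_pair (fun h => hVW.1 w (congrArg Prod.fst h)) (hVW.ne_smul hφ H w hy)

theorem IsRowPoint.line_le_pencil (hVW : IsRowPoint φ V W)
    (H : ∀ A, Reg (shift φ A) (h A) (g A))
    (A : Matrix (Fin 2) (Fin 2) D) {y : Fin 2 → D} (hy : y ≠ 0) (s : D) :
    Submodule.span E {(V (A 0), W (A 0)), (V (A 0 + s • y), W (A 0 + s • y))} ≤
      LinearMap.range (pencil (φ A) (g A y)) := by
  rw [Submodule.span_le]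
  rintro _ (rfl | rfl)
  · simpa using hVW.mem_pencil H A hy 0
  · exact hVW.mem_pencil H A hy s

/-- The points on a line of `D²` lie in the plane of `A` in direction `y`, whatever the second row
of `A` is. Two second rows differing by `z` give distinct planes, which meet in a line. -/
theorem IsRowPoint.mem_line (hVW : IsRowPoint φ V W) (hφ : AdjPres φ)
    (H : ∀ A, Reg (shift φ A) (h A) (g A)) (w : Fin 2 → D) {y : Fin 2 → D} (hy : y ≠ 0) (s : D) :
    (V (w + s • y), W (w + s • y)) ∈
      Submodule.span E {(V w, W w), (V (w + y), W (w + y))} := by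
  obtain ⟨z, hz, hn⟩ := exists_not_rPar y
  have n2 : (![0, 1] : Fin 2 → D) ≠ 0 := by simp
  set A : Matrix (Fin 2) (Fin 2) D := of ![w, 0] with hA
  set B : Matrix (Fin 2) (Fin 2) D := A + ![0, 1] ⊠ z with hB
  have eA : A 0 = w := rfl
  have eB : B 0 = w := by rw [hB, add_vecMulVec_row]; simp [eA]
  have hne : LinearMap.range (pencil (φ A) (g A y)) ≠ LinearMap.range (pencil (φ B) (g B y)) := by
    intro heq
    obtain ⟨c, hc, e⟩ := vecMul_map_add H A n2 hz
    obtain ⟨k, hk, hkn⟩ := exists_not_cPar (h A ![0, 1])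
    obtain ⟨v, v1, -⟩ := exists_dotProduct_col ((H A).col_ne _ n2) hk hkn
    have : (v, v ᵥ* φ B) ∈ LinearMap.range (pencil (φ A) (g A y)) := by
      rw [heq, mem_range_pencil]; exact ⟨0, by simp⟩
    rw [mem_range_pencil] at this
    obtain ⟨s, hs⟩ := this
    rw [hB, e, v1, one_mul, add_right_inj] at hs
    apply (H A).not_rPar (hφ.shift A) hy hz hn
    refine ⟨c⁻¹ * s, ?_, fun j => ?_⟩
    · intro h0
      have hs0 : s = 0 := by simpa [hc] using h0
      rw [hs0, zero_smul, smul_eq_zero] at hs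
      exact hs.elim hc ((H A).row_ne _ hz)
    · have := congrFun hs j
      simp only [Pi.smul_apply, smul_eq_mul] at this
      rw [mul_assoc, ← this, ← mul_assoc, inv_mul_cancel₀ hc, one_mul]
  have hr := finrank_inf_of_ne (by simp) (finrank_range_pencil (φ A) ((H A).row_ne y hy))
    (finrank_range_pencil (φ B) ((H B).row_ne y hy)) hne
  have l1 := hVW.line_le_pencil H A hy 1
  have l2 := hVW.line_le_pencil H B hy 1
  have m1 := hVW.mem_pencil H A hy s
  have m2 := hVW.mem_pencil H B hy s
  rw [one_smul, eA] at l1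
  rw [one_smul, eB] at l2
  rw [eA] at m1
  rw [eB] at m2
  rw [Submodule.eq_of_le_of_finrank_eq (le_inf l1 l2) (by rw [hr, hVW.finrank_line hφ H w hy])]
  exact ⟨m1, m2⟩

/-- The plane of `0` in direction `![1, 0]` contains the first two points but not the third. -/
theorem IsRowPoint.finrank_plane (hVW : IsRowPoint φ V W) (hφ : AdjPres φ)
    (H : ∀ A, Reg (shift φ A) (h A) (g A)) :
    Module.finrank E (Submodule.span E {(V 0, W 0), (V ![1, 0], W ![1, 0]),
      (V ![0, 1], W ![0, 1])}) = 3 := by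
  have n1 : (![1, 0] : Fin 2 → D) ≠ 0 := by simp
  have n2 : (![0, 1] : Fin 2 → D) ≠ 0 := by simp
  have hn : ¬ RPar (![1, 0] : Fin 2 → D) ![0, 1] := by
    rintro ⟨c, hc, h⟩; simpa [eq_comm, hc] using h 0
  have h1 := hVW.line_le_pencil H 0 n1 1
  have h2 := hVW.not_mem_pencil hφ H 0 n1 n2 hn
  have e : (0 : Matrix (Fin 2) (Fin 2) D) 0 = 0 := rfl
  rw [e, one_smul, zero_add] at h1
  rw [e, zero_add] at h2
  have h3 := hVW.finrank_line hφ H 0 n1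
  rw [zero_add] at h3
  set L := Submodule.span E {(V 0, W 0), (V ![1, 0], W ![1, 0])}
  have hlt : L < Submodule.span E {(V 0, W 0), (V ![1, 0], W ![1, 0]),
      (V ![0, 1], W ![0, 1])} := by
    refine lt_of_le_of_ne (Submodule.span_mono (by simp [Set.insert_subset_iff])) fun heq => h2 ?_
    apply h1
    rw [heq]
    exact Submodule.subset_span (by simp)
  have h4 := Submodule.finrank_lt_finrank_of_lt hlt
  have h5 : Module.finrank E (Submodule.span E (Set.range ![(V 0, W 0), (V ![1, 0], W ![1, 0]),
      (V ![0, 1], W ![0, 1])])) ≤ 3 := by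
    have := finrank_range_le_card (R := E) ![(V 0, W 0), (V ![1, 0], W ![1, 0]),
      (V ![0, 1], W ![0, 1])]
    rwa [Fintype.card_fin] at this
  have e3 : Set.range ![(V 0, W 0), (V ![1, 0], W ![1, 0]), (V ![0, 1], W ![0, 1])] =
      {(V 0, W 0), (V ![1, 0], W ![1, 0]), (V ![0, 1], W ![0, 1])} := by
    rw [Matrix.range_cons, Matrix.range_cons, Matrix.range_cons, Matrix.range_empty,
      Set.union_empty, Set.singleton_union, Set.singleton_union]
  rw [e3] at h5
  omega

end TwoByTwo

/-! ### Regular maps between two by two matrices, more than two scalars -/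

section Space

variable {Q : Type*} [AddCommGroup Q] [Module E Q] [FiniteDimensional E Q]

theorem eq_of_le_of_finrank_le_one {S T : Submodule E Q} (h : S ≤ T) (hS : S ≠ ⊥)
    (hT : Module.finrank E T ≤ 1) : S = T := by
  refine Submodule.eq_of_le_of_finrank_le h (hT.trans ?_)
  rw [Nat.one_le_iff_ne_zero]
  intro h0
  exact hS (Submodule.finrank_eq_zero.1 h0)

theorem finrank_inf_le_one {S T : Submodule E Q} (hS : Module.finrank E S = 2) (h : ¬ S ≤ T) :
    Module.finrank E (S ⊓ T : Submodule E Q) ≤ 1 := by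
  have h1 : S ⊓ T < S := lt_of_le_of_ne inf_le_left fun h2 => h (inf_eq_left.1 h2)
  have := Submodule.finrank_lt_finrank_of_lt h1
  omega

/-- If every line of a first family, contained in a subspace `E₁`, meets every line of a second
family, contained in `E₂`, then all these lines have a common point. -/
theorem exists_common_point {I J : Type*} [Nonempty I] [Nonempty J] {N₁ : I → Submodule E Q}
    {N₂ : J → Submodule E Q} {E₁ E₂ : Submodule E Q} (h1 : ∀ i, Module.finrank E (N₁ i) = 2)
    (h2 : ∀ j, Module.finrank E (N₂ j) = 2) (l1 : ∀ i, N₁ i ≤ E₁) (l2 : ∀ j, N₂ j ≤ E₂)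
    (n1 : ∀ i, ¬ N₁ i ≤ E₂) (n2 : ∀ j, ¬ N₂ j ≤ E₁) (hb : ∀ i j, N₁ i ⊓ N₂ j ≠ ⊥) :
    ∃ x, x ≠ 0 ∧ (∀ i, x ∈ N₁ i) ∧ ∀ j, x ∈ N₂ j := by
  -- A line not inside `E₂` meets it in at most one point, so its intersection with `N₂ j` does not
  -- depend on `j`; the symmetric remark removes the dependence on `i`.
  have e1 : ∀ i j, N₁ i ⊓ N₂ j = N₁ i ⊓ E₂ := fun i j =>
    eq_of_le_of_finrank_le_one (inf_le_inf_left _ (l2 j)) (hb i j)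
      (finrank_inf_le_one (h1 i) (n1 i))
  have e2 : ∀ i j, N₁ i ⊓ N₂ j = N₂ j ⊓ E₁ := fun i j =>
    eq_of_le_of_finrank_le_one (by rw [inf_comm]; exact inf_le_inf_left _ (l1 i)) (hb i j)
      (finrank_inf_le_one (h2 j) (n2 j))
  obtain ⟨i₀⟩ := ‹Nonempty I›
  obtain ⟨j₀⟩ := ‹Nonempty J›
  obtain ⟨x, hx, hx0⟩ := Submodule.exists_mem_ne_zero_of_ne_bot (hb i₀ j₀)
  refine ⟨x, hx0, fun i => ?_, fun j => ?_⟩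
  · have : x ∈ N₁ i ⊓ N₂ j₀ := by rw [e2, ← e2 i₀]; exact hx
    exact this.1
  · have : x ∈ N₁ i₀ ⊓ N₂ j := by rw [e1, ← e1 i₀ j₀]; exact hx
    exact this.2

end Space

section TwoByTwo

variable {φ : Matrix (Fin 2) (Fin 2) D → Matrix (Fin 2) (Fin 2) E}
variable {h g : Matrix (Fin 2) (Fin 2) D → (Fin 2 → D) → Fin 2 → E}
variable {V W V' W' : (Fin 2 → D) → Fin 2 → E}

theorem reg_left_mul (H : ∀ A, Reg (shift φ A) (h A) (g A)) {G G' : Matrix (Fin 2) (Fin 2) D}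
    (hG : G * G' = 1) (hG' : G' * G = 1) (A : Matrix (Fin 2) (Fin 2) D) :
    Reg (shift (fun X => φ (G * X)) A) (fun x => h (G * A) (G *ᵥ x)) (g (G * A)) := by
  have hne : ∀ {G G' : Matrix (Fin 2) (Fin 2) D}, G' * G = 1 → ∀ x, x ≠ 0 → G *ᵥ x ≠ 0 := by
    intro G G' hG' x hx h0
    apply hx
    rw [← one_mulVec x, ← hG', ← mulVec_mulVec, h0, mulVec_zero]
  have e : shift (fun X => φ (G * X)) A = fun X => shift φ (G * A) (G * X * 1) := by
    ext X; simp [shift, Matrix.mul_add]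
  rw [e]
  have := (H (G * A)).comp (P := G) (Q := (1 : Matrix (Fin 2) (Fin 2) D)) (hne hG')
    (fun y hy => by rwa [vecMul_one]) ?_ ?_
  · simpa using this
  · obtain ⟨x₁, x₂, h1, h2, h3⟩ := (H (G * A)).col_nc
    refine ⟨G' *ᵥ x₁, G' *ᵥ x₂, hne hG _ h1, hne hG _ h2, ?_⟩
    rwa [mulVec_mulVec, mulVec_mulVec, hG, one_mulVec, one_mulVec]
  · simpa using (H (G * A)).row_nc

theorem adjPres_left_mul (hφ : AdjPres φ) {G G' : Matrix (Fin 2) (Fin 2) D} (hG : G' * G = 1) :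
    AdjPres (fun X => φ (G * X)) := by
  intro A B hAB
  apply hφ
  obtain ⟨x, y, hx, hy, e⟩ := hAB
  refine ⟨G *ᵥ x, y, ?_, hy, by rw [← Matrix.mul_sub, e, mul_vecMulVec]⟩
  intro h
  apply hx
  rw [← one_mulVec x, ← hG, ← mulVec_mulVec, h, mulVec_zero]

theorem dotProduct_eq_zero_of_vecMul_eq (H : ∀ A, Reg (shift φ A) (h A) (g A))
    {A : Matrix (Fin 2) (Fin 2) D} {x y : Fin 2 → D} (hx : x ≠ 0) (hy : y ≠ 0) {v : Fin 2 → E}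
    (hv : v ᵥ* φ (A + x ⊠ y) = v ᵥ* φ A) : v ⬝ᵥ h A x = 0 := by
  obtain ⟨c, hc, e⟩ := vecMul_map_add H A hx hy
  rw [e, add_eq_left, smul_eq_zero, mul_eq_zero] at hv
  exact (hv.resolve_right ((H A).row_ne _ hy)).resolve_right hc

/-- The analogue of `IsRowPoint` for the second row. -/
def IsRowPoint' (φ : Matrix (Fin 2) (Fin 2) D → Matrix (Fin 2) (Fin 2) E)
    (V W : (Fin 2 → D) → Fin 2 → E) : Prop :=
  (∀ a, V a ≠ 0) ∧ ∀ A, V (A 1) ᵥ* φ A = W (A 1)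

/-- The matrix exchanging two rows. -/
def swap (D : Type*) [DivisionRing D] : Matrix (Fin 2) (Fin 2) D := of ![![0, 1], ![1, 0]]

theorem swap_mul (A : Matrix (Fin 2) (Fin 2) D) : swap D * A = of ![A 1, A 0] := by
  ext i j
  fin_cases i <;> simp [swap, Matrix.mul_apply, Fin.sum_univ_two]

theorem swap_swap : swap D * swap D = 1 := by
  rw [swap_mul]
  ext i j
  fin_cases i <;> fin_cases j <;> simp [swap]

theorem swap_swap_mul (A : Matrix (Fin 2) (Fin 2) D) : swap D * (swap D * A) = A := by
  rw [← Matrix.mul_assoc, swap_swap, Matrix.one_mul]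

theorem IsRowPoint'.swap (hVW : IsRowPoint' φ V W) :
    IsRowPoint (fun X => φ (swap D * X)) V W :=
  ⟨hVW.1, fun A => by
    have := hVW.2 (HuaGeometry.swap D * A)
    show V (A 0) ᵥ* φ (HuaGeometry.swap D * A) = W (A 0)
    rw [swap_mul] at this ⊢
    exact this⟩

theorem IsRowPoint.swap (hVW : IsRowPoint φ V W) :
    IsRowPoint' (fun X => φ (swap D * X)) V W :=
  ⟨hVW.1, fun A => by
    have := hVW.2 (HuaGeometry.swap D * A)
    show V (A 1) ᵥ* φ (HuaGeometry.swap D * A) = W (A 1)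
    rw [swap_mul] at this ⊢
    exact this⟩

theorem exists_isRowPoint' (H : ∀ A, Reg (shift φ A) (h A) (g A)) :
    ∃ V W, IsRowPoint' φ V W := by
  obtain ⟨V, W, hVW⟩ := exists_isRowPoint (reg_left_mul H swap_swap swap_swap)
  refine ⟨V, W, ?_⟩
  have := hVW.swap
  simp only [swap_swap_mul] at this
  exact this

/-- At `of ![a, b]`, `V a` annihilates the image of the column `![0, 1]` and `V' b` that of `![1,
0]`. Proportional rows would annihilate both, and these columns are independent. -/
theorem IsRowPoint.not_rPar (hVW : IsRowPoint φ V W) (hVW' : IsRowPoint' φ V' W')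
    (hφ : AdjPres φ) (H : ∀ A, Reg (shift φ A) (h A) (g A)) (a b : Fin 2 → D) :
    ¬ RPar (V a) (V' b) := by
  intro hp
  obtain ⟨c, hc, e⟩ := hp.symm.exists_eq
  have n1 : (![1, 0] : Fin 2 → D) ≠ 0 := by simp
  have n2 : (![0, 1] : Fin 2 → D) ≠ 0 := by simp
  have ea : (of ![a, b] : Matrix (Fin 2) (Fin 2) D) 0 = a := rfl
  have eb : (of ![a, b] : Matrix (Fin 2) (Fin 2) D) 1 = b := rfl
  have d2 : V a ⬝ᵥ h (of ![a, b]) ![0, 1] = 0 := by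
    refine dotProduct_eq_zero_of_vecMul_eq H n2 n1 ?_
    have h1 := hVW.2 (of ![a, b])
    have h2 := hVW.2 (of ![a, b] + ![0, 1] ⊠ ![1, 0])
    rw [add_vecMulVec_row] at h2
    rw [show (![0, 1] : Fin 2 → D) 0 = 0 from rfl, zero_smul, add_zero, ea] at h2
    rw [ea] at h1
    rw [h1, h2]
  have d1 : V' b ⬝ᵥ h (of ![a, b]) ![1, 0] = 0 := by
    refine dotProduct_eq_zero_of_vecMul_eq H n1 n1 ?_
    have h1 := hVW'.2 (of ![a, b])
    have h2 := hVW'.2 (of ![a, b] + ![1, 0] ⊠ ![1, 0])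
    rw [add_vecMulVec_row] at h2
    rw [show (![1, 0] : Fin 2 → D) 1 = 0 from rfl, zero_smul, add_zero, eb] at h2
    rw [eb] at h1
    rw [h1, h2]
  have d3 : V a ⬝ᵥ h (of ![a, b]) ![1, 0] = 0 := by
    rw [e, smul_dotProduct, d1, smul_zero]
  refine hVW.1 a (eq_zero_of_dotProduct ((H _).col_ne _ n1) ((H _).col_ne _ n2)
    ((H _).not_cPar (hφ.shift _) n1 n2 ?_) d3 d2)
  rintro ⟨c, hc, h⟩
  simpa [hc, eq_comm] using h 0

/-- `K` contains the line of `φ (of ![w, b])` for every `b`, since it contains two points of it.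
Differences along these lines give all `(0, g A y)`, and so the whole space. -/
theorem IsRowPoint.eq_top (hVW : IsRowPoint φ V W) (hVW' : IsRowPoint' φ V' W')
    (hφ : AdjPres φ) (H : ∀ A, Reg (shift φ A) (h A) (g A))
    {K : Submodule E ((Fin 2 → E) × (Fin 2 → E))} (hK : ∀ b, (V' b, W' b) ∈ K) {w : Fin 2 → D}
    (hw : (V w, W w) ∈ K) : K = ⊤ := by
  have n1 : (![1, 0] : Fin 2 → D) ≠ 0 := by simp
  have n2 : (![0, 1] : Fin 2 → D) ≠ 0 := by simp
  have hn : ¬ RPar (![1, 0] : Fin 2 → D) ![0, 1] := by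
    rintro ⟨c, hc, h⟩; simpa [eq_comm, hc] using h 0
  have all : ∀ b v, (v, v ᵥ* φ (of ![w, b])) ∈ K := by
    intro b v
    obtain ⟨s, t, rfl⟩ := exists_row_coords (hVW.1 w) (hVW'.1 b) (hVW.not_rPar hVW' hφ H w b) v
    have h1 := hVW.2 (of ![w, b])
    have h2 := hVW'.2 (of ![w, b])
    rw [show (of ![w, b] : Matrix (Fin 2) (Fin 2) D) 0 = w from rfl] at h1
    rw [show (of ![w, b] : Matrix (Fin 2) (Fin 2) D) 1 = b from rfl] at h2
    have := K.add_mem (K.smul_mem s hw) (K.smul_mem t (hK b))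
    rw [← h1, ← h2] at this
    simpa [add_vecMul, smul_vecMul] using this
  set A : Matrix (Fin 2) (Fin 2) D := of ![w, 0] with hA
  obtain ⟨k, hk, hkn⟩ := exists_not_cPar (h A ![0, 1])
  obtain ⟨v, v1, -⟩ := exists_dotProduct_col ((H A).col_ne _ n2) hk hkn
  have dir : ∀ y, y ≠ 0 → ((0 : Fin 2 → E), g A y) ∈ K := by
    intro y hy
    obtain ⟨c, hc, e⟩ := vecMul_map_add H A n2 hy
    have eA : A + ![0, 1] ⊠ y = of ![w, y] := by
      ext i j
      rw [Matrix.add_apply, vecMulVec_apply]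
      fin_cases i <;> simp [hA]
    have h1 := K.sub_mem (all y v) (all 0 v)
    rw [← eA, e, v1, one_mul, Prod.mk_sub_mk, sub_self, add_sub_cancel_left] at h1
    have h2 := K.smul_mem c⁻¹ h1
    rwa [Prod.smul_mk, smul_zero, smul_smul, inv_mul_cancel₀ hc, one_smul] at h2
  rw [eq_top_iff]
  rintro ⟨x, r⟩ -
  obtain ⟨s, t, hst⟩ := exists_row_coords ((H A).row_ne _ n1) ((H A).row_ne _ n2)
    ((H A).not_rPar (hφ.shift A) n1 n2 hn) (r - x ᵥ* φ A)
  have := K.add_mem (all 0 x)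
    (K.add_mem (K.smul_mem s (dir _ n1)) (K.smul_mem t (dir _ n2)))
  have e : (x, x ᵥ* φ A) + (s • ((0 : Fin 2 → E), g A ![1, 0]) +
      t • ((0 : Fin 2 → E), g A ![0, 1])) = (x, r) := by
    refine Prod.ext (by simp) ?_
    show x ᵥ* φ A + (s • g A ![1, 0] + t • g A ![0, 1]) = r
    rw [← hst]; abel
  rwa [← e]

/-- In a plane, if `d = a • x₁ + b • x₂` with `a ≠ 0`, then `x₁ - a⁻¹ • d` is a multiple of `x₂`.
All scalars `c` and `c'` are needed, which is why homomorphisms must be onto. -/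
theorem eq_zero_of_forall_not_rPar {x₁ x₂ d : Fin 2 → E} (h₁ : ∀ c : E, x₁ + c • d ≠ 0)
    (h₂ : ∀ c : E, x₂ + c • d ≠ 0) (h : ∀ c c' : E, ¬ RPar (x₁ + c • d) (x₂ + c' • d)) :
    d = 0 := by
  have z1 : x₁ ≠ 0 := by simpa using h₁ 0
  have z2 : x₂ ≠ 0 := by simpa using h₂ 0
  have z : ¬ RPar x₁ x₂ := by simpa using h 0 0
  obtain ⟨a, b, hd⟩ := exists_row_coords z1 z2 z d
  have ha : a = 0 := by
    by_contra ha
    have e : x₁ + (-a⁻¹) • d = (-(a⁻¹ * b)) • x₂ := by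
      rw [hd, smul_add, smul_smul, smul_smul, neg_mul, inv_mul_cancel₀ ha, neg_one_smul, neg_mul]
      abel
    have hb : -(a⁻¹ * b) ≠ 0 := by
      intro h0
      rw [h0, zero_smul] at e
      exact h₁ _ e
    have := h (-a⁻¹) 0
    rw [e, zero_smul, add_zero] at this
    exact this (RPar.smul hb _).symm
  have hb : b = 0 := by
    by_contra hb
    have e : x₂ + (-b⁻¹) • d = (-(b⁻¹ * a)) • x₁ := by
      rw [hd, smul_add, smul_smul, smul_smul, neg_mul, neg_mul, inv_mul_cancel₀ hb, neg_one_smul]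
      abel
    rw [ha, mul_zero, neg_zero, zero_smul] at e
    exact h₂ _ e
  rw [hd, ha, hb, zero_smul, zero_smul, add_zero]

/-- A matrix whose rows are independent is cancellable on the left. -/
theorem exists_left_inverse {x₁ x₂ : Fin 2 → E} (h₁ : x₁ ≠ 0) (h₂ : x₂ ≠ 0) (h : ¬ RPar x₁ x₂) :
    ∃ Y : Matrix (Fin 2) (Fin 2) E, Y * of ![x₁, x₂] = 1 := by
  obtain ⟨a, b, e1⟩ := exists_row_coords h₁ h₂ h ![1, 0]
  obtain ⟨c, d, e2⟩ := exists_row_coords h₁ h₂ h ![0, 1]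
  refine ⟨of ![![a, b], ![c, d]], ?_⟩
  ext i j
  have f1 := congrFun e1 j
  have f2 := congrFun e2 j
  fin_cases i
  · simp only [Matrix.mul_apply, Fin.sum_univ_two]
    simp at f1 ⊢
    rw [← f1]
    fin_cases j <;> simp
  · simp only [Matrix.mul_apply, Fin.sum_univ_two]
    simp at f2 ⊢
    rw [← f2]
    fin_cases j <;> simp

/-- The points of the two rows span planes `E₁` and `E₂`. All lines with direction `y` meet in a
point `δ y` of `E₁ ∩ E₂`, so in affine coordinates both families are given by one homomorphism `τ`.
Once the first components of the directions vanish, `V₁` and `V₂` are constant up to factors, and `φ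
A` can be read off row by row. -/
theorem standard_two_of_three (hDE : ∀ f : D →+* E, Function.Surjective f)
    (h3 : ∃ t : D, t ≠ 0 ∧ t ≠ 1) (hφ : AdjPres φ) (h0 : φ 0 = 0)
    (H : ∀ A, Reg (shift φ A) (h A) (g A)) :
    ∃ (τ : D →+* E) (X Y : Matrix (Fin 2) (Fin 2) E), ∀ A, φ A = X * A.map τ * Y := by
  have n1 : (![1, 0] : Fin 2 → D) ≠ 0 := by simp
  have n2 : (![0, 1] : Fin 2 → D) ≠ 0 := by simp
  obtain ⟨V₁, W₁, R₁⟩ := exists_isRowPoint H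
  obtain ⟨V₂, W₂, R₂⟩ := exists_isRowPoint' H
  have Hs := reg_left_mul H swap_swap swap_swap
  have hφs := adjPres_left_mul hφ (swap_swap (D := D))
  have R₂s := R₂.swap
  set P₁ : (Fin 2 → D) → (Fin 2 → E) × (Fin 2 → E) := fun w => (V₁ w, W₁ w) with hP₁
  set P₂ : (Fin 2 → D) → (Fin 2 → E) × (Fin 2 → E) := fun w => (V₂ w, W₂ w) with hP₂
  have p1 := mem_span_of_mem_lines (E := E) (P := P₁) h3 fun w y s hy => R₁.mem_line hφ H w hy s
  have p2 := mem_span_of_mem_lines (E := E) (P := P₂) h3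
    fun w y s hy => R₂s.mem_line hφs Hs w hy s
  have r1 : Module.finrank E (Submodule.span E {P₁ 0, P₁ ![1, 0], P₁ ![0, 1]}) = 3 :=
    R₁.finrank_plane hφ H
  have r2 : Module.finrank E (Submodule.span E {P₂ 0, P₂ ![1, 0], P₂ ![0, 1]}) = 3 :=
    R₂s.finrank_plane hφs Hs
  set E₁ := Submodule.span E {P₁ 0, P₁ ![1, 0], P₁ ![0, 1]} with hE₁
  set E₂ := Submodule.span E {P₂ 0, P₂ ![1, 0], P₂ ![0, 1]} with hE₂
  have top : Module.finrank E (⊤ : Submodule E ((Fin 2 → E) × (Fin 2 → E))) = 4 := by simp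
  have q1 : ∀ w, P₁ w ∉ E₂ := fun w hw => by
    have := R₁.eq_top R₂ hφ H p2 hw
    rw [this, top] at r2
    omega
  have q2 : ∀ w, P₂ w ∉ E₁ := fun w hw => by
    have := R₂s.eq_top R₁.swap hφs Hs p1 hw
    rw [this, top] at r1
    omega
  have sp : ∀ {K : Submodule E ((Fin 2 → E) × (Fin 2 → E))} {a b}, a ∈ K → b ∈ K →
      Submodule.span E {a, b} ≤ K := by
    intro K a b ha hb
    rw [Submodule.span_le]
    rintro _ (rfl | rfl)
    exacts [ha, hb]
  have hδ : ∀ y, y ≠ 0 → ∃ x, x ≠ 0 ∧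
      (∀ w, x ∈ Submodule.span E {P₁ w, P₁ (w + y)}) ∧
      ∀ w, x ∈ Submodule.span E {P₂ w, P₂ (w + y)} := by
    intro y hy
    refine exists_common_point (E₁ := E₁) (E₂ := E₂) (fun w => R₁.finrank_line hφ H w hy)
      (fun w => R₂s.finrank_line hφs Hs w hy) (fun w => sp (p1 _) (p1 _))
      (fun w => sp (p2 _) (p2 _)) (fun w hw => q1 w (hw (Submodule.subset_span (by simp))))
      (fun w hw => q2 w (hw (Submodule.subset_span (by simp)))) ?_
    -- Both lines lie in the plane of `of ![a, b]` in direction `y`, and two lines of a plane meet.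
    intro a b hbot
    have l1 := R₁.line_le_pencil H (of ![a, b]) hy 1
    have l2 := R₂s.line_le_pencil Hs (of ![b, a]) hy 1
    have es : swap D * of ![b, a] = of ![a, b] := by rw [swap_mul]; rfl
    have l1' : Submodule.span E {P₁ a, P₁ (a + y)} ≤
        LinearMap.range (pencil (φ (of ![a, b])) (g (of ![a, b]) y)) := by
      rw [one_smul] at l1; exact l1
    have l2' : Submodule.span E {P₂ b, P₂ (b + y)} ≤
        LinearMap.range (pencil (φ (of ![a, b])) (g (of ![a, b]) y)) := by
      rw [one_smul, es] at l2; exact l2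
    have d1 := Submodule.finrank_sup_add_finrank_inf_eq (Submodule.span E {P₁ a, P₁ (a + y)})
      (Submodule.span E {P₂ b, P₂ (b + y)})
    have d2 : Module.finrank E (Submodule.span E {P₁ a, P₁ (a + y)}) = 2 :=
      R₁.finrank_line hφ H a hy
    have d3 : Module.finrank E (Submodule.span E {P₂ b, P₂ (b + y)}) = 2 :=
      R₂s.finrank_line hφs Hs b hy
    have d4 := Submodule.finrank_mono (sup_le l1' l2')
    rw [finrank_range_pencil _ ((H _).row_ne y hy)] at d4
    have d5 : Module.finrank E ((Submodule.span E {P₁ a, P₁ (a + y)} ⊓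
      Submodule.span E {P₂ b, P₂ (b + y)} : Submodule E _)) = 0 := by
      rw [hbot]; simp
    rw [d2, d3, d5] at d1
    omega
  choose! δ δ0 δ1 δ2 using hδ
  have hs1 : ∀ y, y ≠ 0 → ∀ w (s : D), s ≠ 0 → δ y ∈ Submodule.span E {P₁ w, P₁ (w + s • y)} := by
    intro y hy w s hs
    have hle : Submodule.span E {P₁ w, P₁ (w + s • y)} ≤ Submodule.span E {P₁ w, P₁ (w + y)} :=
      sp (Submodule.subset_span (by simp)) (R₁.mem_line hφ H w hy s)
    rw [Submodule.eq_of_le_of_finrank_eq hle ((R₁.finrank_line hφ H w (smul_ne_zero hs hy)).trans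
      (R₁.finrank_line hφ H w hy).symm)]
    exact δ1 y hy w
  have hs2 : ∀ y, y ≠ 0 → ∀ w (s : D), s ≠ 0 → δ y ∈ Submodule.span E {P₂ w, P₂ (w + s • y)} := by
    intro y hy w s hs
    have hle : Submodule.span E {P₂ w, P₂ (w + s • y)} ≤ Submodule.span E {P₂ w, P₂ (w + y)} :=
      sp (Submodule.subset_span (by simp)) (R₂s.mem_line hφs Hs w hy s)
    rw [Submodule.eq_of_le_of_finrank_eq hle
      ((R₂s.finrank_line hφs Hs w (smul_ne_zero hs hy)).trans
      (R₂s.finrank_line hφs Hs w hy).symm)]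
    exact δ2 y hy w
  have δE1 : ∀ y, y ≠ 0 → δ y ∈ E₁ := fun y hy => sp (p1 _) (p1 _) (δ1 y hy 0)
  have δE2 : ∀ y, y ≠ 0 → δ y ∈ E₂ := fun y hy => sp (p2 _) (p2 _) (δ2 y hy 0)
  obtain ⟨S, S0, hS, dS⟩ := exists_affine_coords q1 p1 δ0 δE2 hs1
  obtain ⟨T, T0, hT, dT⟩ := exists_affine_coords q2 p2 δ0 δE1 hs2
  -- Otherwise `δ ![0, 1]` would lie on the line through `P₁ 0` and `P₁ ![1, 0]`, and then so would
  -- `P₁ ![0, 1]`, although the three points span a plane.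
  have hind : ∀ a b : E, a • δ ![1, 0] + b • δ ![0, 1] = 0 → a = 0 ∧ b = 0 := by
    intro a b hab
    have hb : b = 0 := by
      by_contra hb
      have f1 := δ1 _ n1 0
      have f2 := δ1 _ n2 0
      rw [zero_add] at f1 f2
      have f3 : δ ![0, 1] ∈ Submodule.span E {P₁ 0, P₁ ![1, 0]} := by
        have : δ ![0, 1] = (-(b⁻¹ * a)) • δ ![1, 0] := by
          rw [add_comm, add_eq_zero_iff_eq_neg] at hab
          rw [neg_smul, mul_smul, ← smul_neg, ← hab, smul_smul, inv_mul_cancel₀ hb, one_smul]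
        rw [this]
        exact Submodule.smul_mem _ _ f1
      obtain ⟨s, t, hst⟩ := Submodule.mem_span_pair.1 f2
      have ht : t ≠ 0 := by
        rintro rfl
        rw [zero_smul, add_zero] at hst
        have hs : s ≠ 0 := by
          rintro rfl
          rw [zero_smul] at hst
          exact δ0 _ n2 hst.symm
        apply q1 0
        have := E₂.smul_mem s⁻¹ (δE2 _ n2)
        rwa [← hst, smul_smul, inv_mul_cancel₀ hs, one_smul] at this
      have f4 : P₁ ![0, 1] ∈ Submodule.span E {P₁ 0, P₁ ![1, 0]} := by
        have : P₁ ![0, 1] = t⁻¹ • (δ ![0, 1] - s • P₁ 0) := by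
          rw [← hst, add_sub_cancel_left, smul_smul, inv_mul_cancel₀ ht, one_smul]
        rw [this]
        exact Submodule.smul_mem _ _ (Submodule.sub_mem _ f3
          (Submodule.smul_mem _ _ (Submodule.subset_span (by simp))))
      have f5 : E₁ ≤ Submodule.span E {P₁ 0, P₁ ![1, 0]} := by
        rw [hE₁, Submodule.span_le]
        rintro _ (rfl | rfl | rfl)
        · exact Submodule.subset_span (by simp)
        · exact Submodule.subset_span (by simp)
        · exact f4
      have f6 := Submodule.finrank_mono f5
      have f7 := R₁.finrank_line hφ H 0 n1
      rw [zero_add] at f7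
      rw [r1, f7] at f6
      omega
    subst hb
    rw [zero_smul, add_zero, smul_eq_zero] at hab
    exact ⟨hab.resolve_right (δ0 _ n1), rfl⟩
  have huniq : ∀ {a b a' b' : E}, a • δ ![1, 0] + b • δ ![0, 1] =
      a' • δ ![1, 0] + b' • δ ![0, 1] → a = a' ∧ b = b' := by
    intro a b a' b' hab
    have := hind (a - a') (b - b') (by
      rw [sub_smul, sub_smul, ← sub_eq_zero.2 hab]; abel)
    exact ⟨sub_eq_zero.1 this.1, sub_eq_zero.1 this.2⟩
  have hd : ∀ y, y ≠ 0 → ∃ d : Fin 2 → E, δ y = d 0 • δ ![1, 0] + d 1 • δ ![0, 1] := by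
    intro y hy
    obtain ⟨c, hc, e⟩ := dS y hy 0 1 one_ne_zero
    refine ⟨c⁻¹ • (S (0 + (1 : D) • y) - S 0), ?_⟩
    rw [Pi.smul_apply, Pi.smul_apply, smul_eq_mul, smul_eq_mul, mul_smul, mul_smul, ← smul_add,
      ← e, smul_smul, inv_mul_cancel₀ hc, one_smul]
  choose! d hd using hd
  have d1 : d ![1, 0] = ![1, 0] := by
    have := huniq (a' := 1) (b' := 0) ((hd _ n1).symm.trans (by rw [one_smul, zero_smul, add_zero]))
    ext i; fin_cases i
    exacts [this.1, this.2]
  have d2 : d ![0, 1] = ![0, 1] := by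
    have := huniq (a' := 0) (b' := 1) ((hd _ n2).symm.trans (by rw [one_smul, zero_smul, zero_add]))
    ext i; fin_cases i
    exacts [this.1, this.2]
  have conv : ∀ {R : (Fin 2 → D) → Fin 2 → E}, (∀ y, y ≠ 0 → ∀ w (s : D), s ≠ 0 →
      ∃ c : E, c ≠ 0 ∧ c • δ y = (R (w + s • y) - R w) 0 • δ ![1, 0] +
        (R (w + s • y) - R w) 1 • δ ![0, 1]) → ∀ y, y ≠ 0 → ∀ w (s : D), s ≠ 0 →
      ∃ c : E, c ≠ 0 ∧ R (w + s • y) - R w = c • d y := by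
    intro R hR y hy w s hs
    obtain ⟨c, hc, e⟩ := hR y hy w s hs
    refine ⟨c, hc, ?_⟩
    rw [hd y hy, smul_add, smul_smul, smul_smul] at e
    have := huniq e
    ext i; fin_cases i
    exacts [this.1.symm, this.2.symm]
  obtain ⟨τ, α, β, μ, hμ, eS, eT⟩ := exists_ringHom_of_directions S0 T0 d1 d2 (conv dS) (conv dT)
  have hτ := hDE τ
  set Δ₁ := α • (δ ![1, 0]).1 with hΔ₁
  set Δ₂ := β • (δ ![0, 1]).1 with hΔ₂
  have v1 : ∀ w, ∃ c : E, c ≠ 0 ∧ V₁ w = c • (V₁ 0 + τ (w 0) • Δ₁ + τ (w 1) • Δ₂) ∧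
      W₁ w = c • (τ (w 0) • α • (δ ![1, 0]).2 + τ (w 1) • β • (δ ![0, 1]).2) := by
    intro w
    obtain ⟨c, hc, e⟩ := hS w
    rw [eS] at e
    have w0 : W₁ 0 = 0 := by
      have := R₁.2 0
      rw [h0, vecMul_zero] at this
      exact this.symm
    refine ⟨c, hc, ?_, ?_⟩
    · have := congrArg Prod.fst e
      simpa [hP₁, mul_smul] using this
    · have := congrArg Prod.snd e
      simpa [hP₁, mul_smul, w0] using this
  have v2 : ∀ w, ∃ c : E, c ≠ 0 ∧
      V₂ w = c • (V₂ 0 + (μ * τ (w 0)) • Δ₁ + (μ * τ (w 1)) • Δ₂) ∧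
      W₂ w = c • (μ • (τ (w 0) • α • (δ ![1, 0]).2 + τ (w 1) • β • (δ ![0, 1]).2)) := by
    intro w
    obtain ⟨c, hc, e⟩ := hT w
    rw [eT] at e
    have w0 : W₂ 0 = 0 := by
      have := R₂.2 0
      rw [h0, vecMul_zero] at this
      exact this.symm
    refine ⟨c, hc, ?_, ?_⟩
    · have := congrArg Prod.fst e
      simpa [hP₂, mul_smul] using this
    · have := congrArg Prod.snd e
      simpa [hP₂, mul_smul, w0] using this
  have sμ : ∀ c : E, ∃ a : D, μ * τ a = c := fun c => by
    obtain ⟨a, ha⟩ := hτ (μ⁻¹ * c)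
    exact ⟨a, by rw [ha, ← mul_assoc, mul_inv_cancel₀ hμ, one_mul]⟩
  have par : ∀ {u u' r r' : Fin 2 → E}, (∃ c : E, c ≠ 0 ∧ r = c • u) → (∃ c : E, c ≠ 0 ∧ r' = c • u') →
      ¬ RPar r r' → ¬ RPar u u' := by
    rintro u u' r r' ⟨c, hc, rfl⟩ ⟨c', hc', rfl⟩ hn hp
    exact hn (((RPar.smul hc u).symm.trans hp).trans (RPar.smul hc' u'))
  -- As `τ` is onto, `V₁ ![a, 0]` and `V₂ ![a, 0]` run, up to factors, through all `V₁ 0 + c • Δ₁`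
  -- and `V₂ 0 + c • Δ₁`; these are never proportional.
  have z1 : Δ₁ = 0 := by
    have w1 : ∀ c : E, ∃ a : D, ∃ l : E, l ≠ 0 ∧ V₁ ![a, 0] = l • (V₁ 0 + c • Δ₁) := by
      intro c
      obtain ⟨a, rfl⟩ := hτ c
      obtain ⟨l, hl, e, -⟩ := v1 ![a, 0]
      exact ⟨a, l, hl, by simpa using e⟩
    have w2 : ∀ c : E, ∃ a : D, ∃ l : E, l ≠ 0 ∧ V₂ ![a, 0] = l • (V₂ 0 + c • Δ₁) := by
      intro c
      obtain ⟨a, rfl⟩ := sμ c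
      obtain ⟨l, hl, e, -⟩ := v2 ![a, 0]
      exact ⟨a, l, hl, by simpa using e⟩
    refine eq_zero_of_forall_not_rPar (x₁ := V₁ 0) (x₂ := V₂ 0) ?_ ?_ ?_
    · intro c h
      obtain ⟨a, l, -, e⟩ := w1 c
      rw [h, smul_zero] at e
      exact R₁.1 _ e
    · intro c h
      obtain ⟨a, l, -, e⟩ := w2 c
      rw [h, smul_zero] at e
      exact R₂.1 _ e
    · intro c c'
      obtain ⟨a, e⟩ := w1 c
      obtain ⟨a', e'⟩ := w2 c'
      exact par e e' (R₁.not_rPar R₂ hφ H _ _)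
  have z2 : Δ₂ = 0 := by
    have w1 : ∀ c : E, ∃ a : D, ∃ l : E, l ≠ 0 ∧ V₁ ![0, a] = l • (V₁ 0 + c • Δ₂) := by
      intro c
      obtain ⟨a, rfl⟩ := hτ c
      obtain ⟨l, hl, e, -⟩ := v1 ![0, a]
      exact ⟨a, l, hl, by simpa using e⟩
    have w2 : ∀ c : E, ∃ a : D, ∃ l : E, l ≠ 0 ∧ V₂ ![0, a] = l • (V₂ 0 + c • Δ₂) := by
      intro c
      obtain ⟨a, rfl⟩ := sμ c
      obtain ⟨l, hl, e, -⟩ := v2 ![0, a]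
      exact ⟨a, l, hl, by simpa using e⟩
    refine eq_zero_of_forall_not_rPar (x₁ := V₁ 0) (x₂ := V₂ 0) ?_ ?_ ?_
    · intro c h
      obtain ⟨a, l, -, e⟩ := w1 c
      rw [h, smul_zero] at e
      exact R₁.1 _ e
    · intro c h
      obtain ⟨a, l, -, e⟩ := w2 c
      rw [h, smul_zero] at e
      exact R₂.1 _ e
    · intro c c'
      obtain ⟨a, e⟩ := w1 c
      obtain ⟨a', e'⟩ := w2 c'
      exact par e e' (R₁.not_rPar R₂ hφ H _ _)
  set Y : Matrix (Fin 2) (Fin 2) E := of ![α • (δ ![1, 0]).2, β • (δ ![0, 1]).2] with hY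
  have cancel : ∀ {c : E} {u u' : Fin 2 → E}, c ≠ 0 → c • u = c • u' → u = u' :=
    fun hc e => smul_right_injective _ hc e
  have m1 : ∀ A, V₁ 0 ᵥ* φ A = (fun j => τ (A 0 j)) ᵥ* Y := by
    intro A
    obtain ⟨c, hc, e, e'⟩ := v1 (A 0)
    rw [z1, z2, smul_zero, smul_zero, add_zero, add_zero] at e
    have := R₁.2 A
    rw [e, e', smul_vecMul] at this
    rw [cancel hc this]
    ext j
    simp [vecMul, dotProduct, Fin.sum_univ_two, hY]
  have m2 : ∀ A, (μ⁻¹ • V₂ 0) ᵥ* φ A = (fun j => τ (A 1 j)) ᵥ* Y := by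
    intro A
    obtain ⟨c, hc, e, e'⟩ := v2 (A 1)
    rw [z1, z2, smul_zero, smul_zero, add_zero, add_zero] at e
    have := R₂.2 A
    rw [e, e', smul_vecMul] at this
    rw [smul_vecMul, cancel hc this, smul_smul, inv_mul_cancel₀ hμ, one_smul]
    ext j
    simp [vecMul, dotProduct, Fin.sum_univ_two, hY]
  obtain ⟨X, hX⟩ := exists_left_inverse (x₁ := V₁ 0) (x₂ := μ⁻¹ • V₂ 0) (R₁.1 0)
    (smul_ne_zero (inv_ne_zero hμ) (R₂.1 0))
    fun hp => R₁.not_rPar R₂ hφ H 0 0 (hp.trans (RPar.smul (inv_ne_zero hμ) _).symm)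
  refine ⟨τ, X, Y, fun A => ?_⟩
  have e : of ![V₁ 0, μ⁻¹ • V₂ 0] * φ A = A.map τ * Y := by
    ext i j
    fin_cases i
    · exact congrFun (m1 A) j
    · exact congrFun (m2 A) j
  rw [Matrix.mul_assoc, ← e, ← Matrix.mul_assoc, hX, Matrix.one_mul]

end TwoByTwo

/-! ### Regular maps between two by two matrices, two scalars -/

section Binary

variable {φ : Matrix (Fin 2) (Fin 2) D → Matrix (Fin 2) (Fin 2) E}
variable {h g : Matrix (Fin 2) (Fin 2) D → (Fin 2 → D) → Fin 2 → E}

theorem one_add_one_of_binary (hD : ∀ d : D, d = 0 ∨ d = 1) : (1 : D) + 1 = 0 :=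
  (hD (1 + 1)).resolve_right fun h => one_ne_zero (add_eq_left.1 h)

/-- The homomorphism between two division rings with two elements. -/
theorem exists_ringHom_of_binary (hD : ∀ d : D, d = 0 ∨ d = 1) (hE : ∀ e : E, e = 0 ∨ e = 1) :
    Nonempty (D →+* E) := by
  classical
  have d2 := one_add_one_of_binary hD
  have e2 := one_add_one_of_binary hE
  refine ⟨{ toFun := fun d => if d = 0 then 0 else 1, map_one' := by simp, map_zero' := by simp,
            map_mul' := ?_, map_add' := ?_ }⟩ <;>
  · intro a b
    rcases hD a with rfl | rfl <;> rcases hD b with rfl | rfl <;> simp [d2, e2]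

theorem eq_add_of_binary (hE : ∀ e : E, e = 0 ∨ e = 1) {x y z : Fin 2 → E} (hx : x ≠ 0)
    (hy : y ≠ 0) (hz : z ≠ 0) (hxy : ¬ RPar x y) (hxz : ¬ RPar x z) (hyz : ¬ RPar y z) :
    z = x + y := by
  obtain ⟨a, b, rfl⟩ := exists_row_coords hx hy hxy z
  rcases hE a with rfl | rfl <;> rcases hE b with rfl | rfl <;> simp [RPar.refl] at *

/-- Elementary operations on the rows. -/
theorem elementary_mul (A : Matrix (Fin 2) (Fin 2) D) :
    of ![![1, 0], ![-1, 1]] * A = of ![A 0, A 1 - A 0] ∧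
    of ![![1, 0], ![1, 1]] * A = of ![A 0, A 0 + A 1] ∧
    of ![![1, -1], ![0, 1]] * A = of ![A 0 - A 1, A 1] := by
  refine ⟨?_, ?_, ?_⟩ <;>
  · ext i j
    fin_cases i <;> simp [Matrix.mul_apply, Fin.sum_univ_two] <;> abel

/-- A third family of points, attached to the sum of the rows, replaces the projective argument. For
all `a`, `b`, `c` the rows `V₁ a`, `V₂ b`, `V₃ c` are pairwise non-proportional, so `V₃ c = V₁ a +
V₂ b` over two scalars and all three are constant. -/
theorem standard_two_of_binary (hD : ∀ d : D, d = 0 ∨ d = 1) (hE : ∀ e : E, e = 0 ∨ e = 1)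
    (hφ : AdjPres φ) (h0 : φ 0 = 0) (H : ∀ A, Reg (shift φ A) (h A) (g A)) :
    ∃ (τ : D →+* E) (X Y : Matrix (Fin 2) (Fin 2) E), ∀ A, φ A = X * A.map τ * Y := by
  set P : Matrix (Fin 2) (Fin 2) D := of ![![1, 0], ![-1, 1]]
  set P' : Matrix (Fin 2) (Fin 2) D := of ![![1, 0], ![1, 1]]
  set Q : Matrix (Fin 2) (Fin 2) D := of ![![1, -1], ![0, 1]]
  set Q' : Matrix (Fin 2) (Fin 2) D := of ![![1, 1], ![0, 1]]
  have eP : ∀ A, P * A = of ![A 0, A 1 - A 0] := fun A => (elementary_mul A).1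
  have eP' : ∀ A, P' * A = of ![A 0, A 0 + A 1] := fun A => (elementary_mul A).2.1
  have eQ : ∀ A, Q * A = of ![A 0 - A 1, A 1] := fun A => (elementary_mul A).2.2
  have PP' : P * P' = 1 := by
    ext i j; fin_cases i <;> fin_cases j <;> simp [P, P', Matrix.mul_apply, Fin.sum_univ_two]
  have P'P : P' * P = 1 := by
    ext i j; fin_cases i <;> fin_cases j <;> simp [P, P', Matrix.mul_apply, Fin.sum_univ_two]
  have QQ' : Q * Q' = 1 := by
    ext i j; fin_cases i <;> fin_cases j <;> simp [Q, Q', Matrix.mul_apply, Fin.sum_univ_two]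
  have Q'Q : Q' * Q = 1 := by
    ext i j; fin_cases i <;> fin_cases j <;> simp [Q, Q', Matrix.mul_apply, Fin.sum_univ_two]
  obtain ⟨V₁, W₁, R₁⟩ := exists_isRowPoint H
  obtain ⟨V₂, W₂, R₂⟩ := exists_isRowPoint' H
  have HP := reg_left_mul H PP' P'P
  have HQ := reg_left_mul H QQ' Q'Q
  obtain ⟨V₃, W₃, R₃⟩ := exists_isRowPoint' HP
  have r3 : ∀ A, V₃ (A 0 + A 1) ᵥ* φ A = W₃ (A 0 + A 1) := by
    intro A
    have := R₃.2 (P' * A)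
    change V₃ ((P' * A) 1) ᵥ* φ (P * (P' * A)) = W₃ ((P' * A) 1) at this
    rw [← Matrix.mul_assoc, PP', Matrix.one_mul, eP'] at this
    exact this
  -- The sum of the rows of `P * X` is the second row of `X`, and that of `Q * X` is its first row;
  -- hence `V₃` can be compared with both `V₁` and `V₂`.
  have R₁' : IsRowPoint (fun X => φ (P * X)) V₁ W₁ := ⟨R₁.1, fun A => by
    have := R₁.2 (P * A)
    rwa [show (P * A) 0 = A 0 by rw [eP]; rfl] at this⟩
  have R₂' : IsRowPoint' (fun X => φ (Q * X)) V₂ W₂ := ⟨R₂.1, fun A => by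
    have := R₂.2 (Q * A)
    rwa [show (Q * A) 1 = A 1 by rw [eQ]; rfl] at this⟩
  have R₃' : IsRowPoint (fun X => φ (Q * X)) V₃ W₃ := ⟨R₃.1, fun A => by
    have := r3 (Q * A)
    rwa [show (Q * A) 0 + (Q * A) 1 = A 0 by
      rw [eQ]; exact sub_add_cancel (A 0) (A 1)] at this⟩
  have n12 := R₁.not_rPar R₂ hφ H
  have n13 := R₁'.not_rPar R₃ (adjPres_left_mul hφ P'P) HP
  have n32 := R₃'.not_rPar R₂' (adjPres_left_mul hφ Q'Q) HQ
  have e3 : ∀ a b c, V₃ c = V₁ a + V₂ b := fun a b c =>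
    eq_add_of_binary hE (R₁.1 a) (R₂.1 b) (R₃.1 c) (n12 a b) (n13 a c)
      fun hp => n32 c b hp.symm
  have c1 : ∀ a, V₁ a = V₁ 0 := fun a => by
    have := (e3 a 0 0).symm.trans (e3 0 0 0)
    exact add_right_cancel this
  have c2 : ∀ b, V₂ b = V₂ 0 := fun b => by
    have := (e3 0 b 0).symm.trans (e3 0 0 0)
    exact add_left_cancel this
  have w1 : ∀ A, V₁ 0 ᵥ* φ A = W₁ (A 0) := fun A => by rw [← R₁.2, c1 (A 0)]
  have w2 : ∀ A, V₂ 0 ᵥ* φ A = W₂ (A 1) := fun A => by rw [← R₂.2, c2 (A 1)]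
  -- With `V₃ = V₁ + V₂` this yields `W₁ = W₂ = W₃` and additivity; over two scalars, additive maps
  -- are linear.
  have w3 : ∀ a b, W₁ a + W₂ b = W₃ (a + b) := fun a b => by
    have h1 := w1 (of ![a, b])
    have h2 := w2 (of ![a, b])
    have h3 := r3 (of ![a, b])
    rw [e3 0 0, add_vecMul, h1, h2] at h3
    exact h3
  have z1 : W₁ 0 = 0 := (w1 0).symm.trans (by rw [h0, vecMul_zero])
  have z2 : W₂ 0 = 0 := (w2 0).symm.trans (by rw [h0, vecMul_zero])
  have e12 : ∀ a, W₂ a = W₁ a := fun a => by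
    have h1 := w3 a 0
    have h2 := w3 0 a
    rw [z2, add_zero, add_zero] at h1
    rw [z1, zero_add, zero_add] at h2
    rw [h1, h2]
  have add : ∀ a b, W₁ (a + b) = W₁ a + W₁ b := fun a b => by
    have h1 := w3 (a + b) 0
    rw [z2, add_zero, add_zero] at h1
    rw [h1, ← w3, e12]
  obtain ⟨τ⟩ := exists_ringHom_of_binary hD hE
  have hW : ∀ a, W₁ a = τ (a 0) • W₁ ![1, 0] + τ (a 1) • W₁ ![0, 1] := by
    have hs : ∀ (d : D) w, W₁ (d • w) = τ d • W₁ w := by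
      intro d w
      rcases hD d with rfl | rfl
      · rw [map_zero, zero_smul, zero_smul, z1]
      · rw [map_one, one_smul, one_smul]
    intro a
    rw [← hs, ← hs, ← add]
    congr 1
    ext i; fin_cases i <;> simp
  obtain ⟨X, hX⟩ := exists_left_inverse (R₁.1 0) (R₂.1 0) (n12 0 0)
  refine ⟨τ, X, of ![W₁ ![1, 0], W₁ ![0, 1]], fun A => ?_⟩
  have e : of ![V₁ 0, V₂ 0] * φ A = A.map τ * of ![W₁ ![1, 0], W₁ ![0, 1]] := by
    ext i j
    fin_cases i
    · refine (congrFun ((w1 A).trans (hW _)) j).trans ?_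
      simp [Matrix.mul_apply, Fin.sum_univ_two]
    · refine (congrFun ((w2 A).trans ((e12 _).trans (hW _))) j).trans ?_
      simp [Matrix.mul_apply, Fin.sum_univ_two]
  rw [Matrix.mul_assoc, ← e, ← Matrix.mul_assoc, hX, Matrix.one_mul]

end Binary

/-- A regular map on `2 × 2` matrices is standard. -/
theorem Reg.standard_two [Fintype p] [Fintype q] {φ : Matrix (Fin 2) (Fin 2) D → Matrix p q E}
    {h : (Fin 2 → D) → p → E} {g : (Fin 2 → D) → q → E}
    (H : Reg φ h g) (hφ : AdjPres φ) (h0 : φ 0 = 0) (hDE : ∀ f : D →+* E, Function.Surjective f)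
    (hB : (∀ d : D, d = 0 ∨ d = 1) → ∀ e : E, e = 0 ∨ e = 1) :
    ∃ (τ : D →+* E) (U : Matrix p (Fin 2) E) (V : Matrix (Fin 2) q E),
      ∀ A, φ A = U * A.map τ * V := by
  obtain ⟨U, V, ψ, hφψ, hψ0, hψ, h', g', H'⟩ := H.exists_two_by_two hφ h0
  have Hall := exists_shift_two hψ 0 ⟨h', g', by rwa [shift_at_zero ψ hψ0]⟩
  choose h'' g'' H'' using Hall
  have : ∃ (τ : D →+* E) (X Y : Matrix (Fin 2) (Fin 2) E), ∀ A, ψ A = X * A.map τ * Y := by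
    by_cases hD : ∀ d : D, d = 0 ∨ d = 1
    · exact standard_two_of_binary hD (hB hD) hψ hψ0 H''
    · push Not at hD
      exact standard_two_of_three hDE hD hψ hψ0 H''
  obtain ⟨τ, X, Y, e⟩ := this
  exact ⟨τ, U * X, Y * V, fun A => by rw [hφψ, e]; simp only [Matrix.mul_assoc]⟩

/-! ### Regular maps are standard -/

/-- The hypotheses on the division rings: every homomorphism is onto, and the second one has two
elements if the first one has. -/
structure OntoHoms (D E : Type*) [DivisionRing D] [DivisionRing E] : Prop where
  surjective : ∀ f : D →+* E, Function.Surjective f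
  binary : (∀ d : D, d = 0 ∨ d = 1) → ∀ e : E, e = 0 ∨ e = 1

theorem OntoHoms.op (hDE : OntoHoms D E) : OntoHoms Dᵐᵒᵖ Eᵐᵒᵖ where
  surjective f e := by
    obtain ⟨d, hd⟩ := hDE.surjective (RingHom.unop f) (unop e)
    exact ⟨MulOpposite.op d, congrArg MulOpposite.op hd⟩
  binary hD e := by
    have := hDE.binary (fun d => (hD (MulOpposite.op d)).imp (congrArg unop) (congrArg unop))
      (unop e)
    exact this.imp (congrArg MulOpposite.op) (congrArg MulOpposite.op)

/-! ### Blocks spanned by two columns and two rows -/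

/-- The matrix with two given columns. -/
def colPair (x₁ x₂ : m → D) : Matrix m (Fin 2) D := of fun i => ![x₁ i, x₂ i]

theorem colPair_mulVec (x₁ x₂ : m → D) (s : Fin 2 → D) :
    colPair x₁ x₂ *ᵥ s = op (s 0) • x₁ + op (s 1) • x₂ := by
  ext i; simp [colPair, mulVec, dotProduct, Fin.sum_univ_two]

theorem vecMul_rowPair (y₁ y₂ : n → D) (t : Fin 2 → D) :
    t ᵥ* of ![y₁, y₂] = t 0 • y₁ + t 1 • y₂ := by
  ext i; simp [vecMul, dotProduct, Fin.sum_univ_two]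

theorem vecMul_rowPair_ne_zero {y₁ y₂ : n → D} (h₁ : y₁ ≠ 0) (h₂ : y₂ ≠ 0) (h : ¬ RPar y₁ y₂)
    {t : Fin 2 → D} (ht : t ≠ 0) : t ᵥ* of ![y₁, y₂] ≠ 0 := by
  rw [vecMul_rowPair]
  intro h0
  by_cases t1 : t 1 = 0
  · rw [t1, zero_smul, add_zero, smul_eq_zero] at h0
    apply ht
    ext i; fin_cases i
    exacts [h0.resolve_right h₁, t1]
  · have e : y₂ = (-((t 1)⁻¹ * t 0)) • y₁ := by
      rw [add_comm, add_eq_zero_iff_eq_neg] at h0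
      rw [neg_smul, mul_smul, ← smul_neg, ← h0, smul_smul, inv_mul_cancel₀ t1, one_smul]
    refine h ⟨_, fun hc => h₂ ?_, fun j => congrFun e j⟩
    rw [e, hc, zero_smul]

theorem colPair_mulVec_ne_zero {x₁ x₂ : m → D} (h₁ : x₁ ≠ 0) (h₂ : x₂ ≠ 0) (h : ¬ CPar x₁ x₂)
    {s : Fin 2 → D} (hs : s ≠ 0) : colPair x₁ x₂ *ᵥ s ≠ 0 := by
  have := vecMul_rowPair_ne_zero (op_comp_ne_zero.2 h₁) (op_comp_ne_zero.2 h₂)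
    (by rwa [rPar_op]) (op_comp_ne_zero.2 hs)
  rw [vecMul_rowPair] at this
  rw [colPair_mulVec]
  intro h0
  apply this
  ext i
  exact congrArg op (congrFun h0 i)

theorem map_vecMulVec (τ : D →+* E) (x : m → D) (y : n → D) :
    (x ⊠ y).map τ = (τ ∘ x) ⊠ (τ ∘ y) := by
  ext i j; simp [vecMulVec_apply]

namespace Reg

variable [Fintype m] [Fintype n] [Fintype p] [Fintype q]
variable {φ : Matrix m n D → Matrix p q E} {h : (m → D) → p → E} {g : (n → D) → q → E}

theorem standard_block (H : Reg φ h g) (hφ : AdjPres φ) (h0 : φ 0 = 0) (hDE : OntoHoms D E)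
    {x₁ x₂ : m → D} {y₁ y₂ : n → D} (hx₁ : x₁ ≠ 0) (hx₂ : x₂ ≠ 0) (hy₁ : y₁ ≠ 0) (hy₂ : y₂ ≠ 0)
    (hx : ¬ CPar (h x₁) (h x₂)) (hy : ¬ RPar (g y₁) (g y₂)) :
    ∃ (τ : D →+* E) (U : Matrix p (Fin 2) E) (V : Matrix (Fin 2) q E), ∀ s t,
      φ ((colPair x₁ x₂ *ᵥ s) ⊠ (t ᵥ* of ![y₁, y₂])) = (U *ᵥ (τ ∘ s)) ⊠ ((τ ∘ t) ᵥ* V) ∧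
      ∀ s' t', φ ((colPair x₁ x₂ *ᵥ s) ⊠ (t ᵥ* of ![y₁, y₂]) +
          (colPair x₁ x₂ *ᵥ s') ⊠ (t' ᵥ* of ![y₁, y₂])) =
        φ ((colPair x₁ x₂ *ᵥ s) ⊠ (t ᵥ* of ![y₁, y₂])) +
          φ ((colPair x₁ x₂ *ᵥ s') ⊠ (t' ᵥ* of ![y₁, y₂])) := by
  have n1 : (![1, 0] : Fin 2 → D) ≠ 0 := by simp
  have n2 : (![0, 1] : Fin 2 → D) ≠ 0 := by simp
  have c1 : colPair x₁ x₂ *ᵥ ![1, 0] = x₁ := by rw [colPair_mulVec]; simp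
  have c2 : colPair x₁ x₂ *ᵥ ![0, 1] = x₂ := by rw [colPair_mulVec]; simp
  have r1 : ![1, 0] ᵥ* of ![y₁, y₂] = y₁ := by rw [vecMul_rowPair]; simp
  have r2 : ![0, 1] ᵥ* of ![y₁, y₂] = y₂ := by rw [vecMul_rowPair]; simp
  have hP : ∀ s, s ≠ 0 → colPair x₁ x₂ *ᵥ s ≠ 0 := fun s hs =>
    colPair_mulVec_ne_zero hx₁ hx₂ (fun hp => hx (H.col_par hx₁ hp)) hs
  have hQ : ∀ t, t ≠ 0 → t ᵥ* of ![y₁, y₂] ≠ 0 := fun t ht =>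
    vecMul_rowPair_ne_zero hy₁ hy₂ (fun hp => hy (H.row_par hy₁ hp)) ht
  have Hb := H.comp (P := colPair x₁ x₂) (Q := of ![y₁, y₂]) hP hQ
    ⟨_, _, n1, n2, by rwa [c1, c2]⟩ ⟨_, _, n1, n2, by rwa [r1, r2]⟩
  obtain ⟨τ, U, V, e⟩ := Hb.standard_two (hφ.comp hP hQ) (by simpa using h0) hDE.surjective
    hDE.binary
  refine ⟨τ, U, V, fun s t => ⟨?_, fun s' t' => ?_⟩⟩
  · have := e (s ⊠ t)
    rwa [mul_vecMulVec, vecMulVec_mul, map_vecMulVec, mul_vecMulVec, vecMulVec_mul] at this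
  · have hm : (s ⊠ t + s' ⊠ t').map τ = (s ⊠ t).map τ + (s' ⊠ t').map τ := by
      ext i j; simp
    have e0 : φ (colPair x₁ x₂ * (s ⊠ t + s' ⊠ t') * of ![y₁, y₂]) =
        φ (colPair x₁ x₂ * (s ⊠ t) * of ![y₁, y₂]) +
          φ (colPair x₁ x₂ * (s' ⊠ t') * of ![y₁, y₂]) := by
      rw [e, e, e, hm, Matrix.mul_add, Matrix.add_mul]
    simpa only [Matrix.mul_add, Matrix.add_mul, mul_vecMulVec, vecMulVec_mul] using e0

/-- In a standard block, `h` is given up to factors by `U *ᵥ (τ ∘ s)`. As `τ` is onto, every point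
of the line joining `h a` and `h c` is reached from the span of `a` and `c`. -/
theorem exists_cPar_map (H : Reg φ h g) (hφ : AdjPres φ) (h0 : φ 0 = 0) (hDE : OntoHoms D E)
    {a c : m → D} (ha : a ≠ 0) (hc : c ≠ 0) (hac : ¬ CPar (h a) (h c)) {α β : E}
    (hu : MulOpposite.op α • h a + MulOpposite.op β • h c ≠ 0) :
    ∃ s t : D, MulOpposite.op s • a + MulOpposite.op t • c ≠ 0 ∧
      CPar (MulOpposite.op α • h a + MulOpposite.op β • h c) (h (MulOpposite.op s • a + MulOpposite.op t • c)) := by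
  obtain ⟨y₁, y₂, hy₁, hy₂, hy⟩ := H.row_nc
  obtain ⟨τ, U, V, e⟩ := H.standard_block hφ h0 hDE ha hc hy₁ hy₂ hac hy
  have r1 : ![1, 0] ᵥ* of ![y₁, y₂] = y₁ := by rw [vecMul_rowPair]; simp
  have key : ∀ s : Fin 2 → D, colPair a c *ᵥ s ≠ 0 →
      CPar (h (colPair a c *ᵥ s)) (U *ᵥ (τ ∘ s)) := by
    intro s hs
    have := (e s ![1, 0]).1
    rw [r1] at this
    obtain ⟨l, hl, e'⟩ := H.map _ _ hs hy₁
    rw [e'] at this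
    exact (cPar_and_rPar_of_vecMulVec_eq (H.col_ne _ hs) (smul_ne_zero hl (H.row_ne _ hy₁)) this).1
  have c1 : colPair a c *ᵥ ![1, 0] = a := by rw [colPair_mulVec]; simp
  have c2 : colPair a c *ᵥ ![0, 1] = c := by rw [colPair_mulVec]; simp
  obtain ⟨l, hl, e1⟩ := (key ![1, 0] (by rwa [c1])).symm.exists_eq
  obtain ⟨k, hk, e2⟩ := (key ![0, 1] (by rwa [c2])).symm.exists_eq
  rw [c1] at e1
  rw [c2] at e2
  obtain ⟨s, hs⟩ := hDE.surjective τ (l * α)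
  obtain ⟨t, ht⟩ := hDE.surjective τ (k * β)
  have eU : MulOpposite.op α • h a + MulOpposite.op β • h c = U *ᵥ (τ ∘ ![s, t]) := by
    rw [e1, e2]
    ext i
    simp [mulVec, dotProduct, Fin.sum_univ_two, hs, ht, mul_assoc]
  have hst : (![s, t] : Fin 2 → D) ≠ 0 := by
    intro h1
    apply hu
    rw [eU, h1]
    ext i; simp [mulVec, dotProduct]
  have hne := colPair_mulVec_ne_zero ha hc (fun hp => hac (H.col_par ha hp)) hst
  have := (key _ hne).symm
  rw [← eU, colPair_mulVec] at this
  rw [colPair_mulVec] at hne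
  exact ⟨s, t, hne, this⟩

/-- Suppose `h c` and `h d` agree, and choose `a` outside their fibre. The point `h (a + c)` lies on
the line of `h a` and `h d`, so it is also the image of some `-a + d r`. Adding `a + c` and `-a + d
r` puts `c + d r` in the fibre of `a + c`; but it is also in the fibre of `c`. -/
theorem not_cPar_of_onto (H : Reg φ h g) (hφ : AdjPres φ) (h0 : φ 0 = 0) (hDE : OntoHoms D E)
    {c d : m → D} (hc : c ≠ 0) (hd : d ≠ 0) (hcd : ¬ CPar c d) : ¬ CPar (h c) (h d) := by
  intro hp
  obtain ⟨a, ha, hac⟩ : ∃ a, a ≠ 0 ∧ ¬ CPar (h a) (h c) := by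
    obtain ⟨x₁, x₂, h1, h2, h12⟩ := H.col_nc
    by_cases h3 : CPar (h x₁) (h c)
    · exact ⟨x₂, h2, fun h4 => h12 (h3.trans h4.symm)⟩
    · exact ⟨x₁, h1, h3⟩
  obtain ⟨hac0, n1, n2⟩ := H.not_col_par_add hφ ha hc hac
  obtain ⟨α, β, e⟩ := H.col_add_mem hφ ha hc hac
  obtain ⟨k, hk, ek⟩ := hp.symm.exists_eq
  rw [ek, smul_smul, ← op_mul] at e
  have hne := H.col_ne _ hac0
  rw [e] at hne
  obtain ⟨s, t, hst, hpar⟩ := H.exists_cPar_map hφ h0 hDE ha hd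
    (fun h1 => hac (h1.trans hp.symm)) hne
  rw [← e] at hpar
  have hs : s ≠ 0 := by
    rintro rfl
    rw [op_zero, zero_smul, zero_add] at hst hpar
    have ht : t ≠ 0 := by rintro rfl; simp at hst
    exact n2 (hp.trans ((H.col_smul hd ht).trans hpar.symm))
  have hpar' := hpar.trans (H.col_smul hst (neg_ne_zero.2 (inv_ne_zero hs)))
  have e1 : MulOpposite.op (-s⁻¹) • (MulOpposite.op s • a + MulOpposite.op t • d) = -a + MulOpposite.op (t * -s⁻¹) • d := by
    rw [smul_add, smul_smul, smul_smul, ← op_mul, ← op_mul, mul_neg, mul_inv_cancel₀ hs]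
    simp
  rw [e1] at hpar'
  set r := t * -s⁻¹
  have hr : r ≠ 0 := by
    intro h1
    rw [h1, op_zero, zero_smul, add_zero] at hpar'
    have := H.col_smul ha (c := (-1 : D)) (by simp)
    rw [op_neg, op_one, neg_one_smul] at this
    exact n1 (this.trans hpar'.symm)
  have hne2 : c + MulOpposite.op r • d ≠ 0 := by
    intro h1
    refine hcd ((CPar.symm ⟨-r, neg_ne_zero.2 hr, fun i => ?_⟩))
    have := congrFun h1 i
    simp only [Pi.add_apply, Pi.smul_apply, op_smul_eq_mul, Pi.zero_apply] at this
    rw [mul_neg]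
    exact eq_neg_of_add_eq_zero_left this
  have f1 : CPar (h c) (h (c + MulOpposite.op r • d)) :=
    H.col_fibre hφ hc (smul_ne_zero (by simpa using hr) hd) hne2 (hp.trans (H.col_smul hd hr))
  have e2 : a + c + (-a + MulOpposite.op r • d) = c + MulOpposite.op r • d := by abel
  have hne3 : -a + MulOpposite.op r • d ≠ 0 := by
    rw [← e1]
    exact smul_ne_zero (by simpa using hs) hst
  have f2 : CPar (h (a + c)) (h (c + MulOpposite.op r • d)) := by
    rw [← e2]
    exact H.col_fibre hφ hac0 hne3 (by rwa [e2]) hpar'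
  exact n2 (f1.trans f2.symm)

theorem not_rPar_of_onto (H : Reg φ h g) (hφ : AdjPres φ) (h0 : φ 0 = 0) (hDE : OntoHoms D E)
    {y z : n → D} (hy : y ≠ 0) (hz : z ≠ 0) (hyz : ¬ RPar y z) : ¬ RPar (g y) (g z) := by
  have := H.op.not_cPar_of_onto hφ.op (by rw [unopT_zero, h0, opT_zero]) hDE.op
    (c := MulOpposite.op ∘ y) (d := MulOpposite.op ∘ z)
    (op_comp_ne_zero.2 hy) (op_comp_ne_zero.2 hz) (by rwa [cPar_op])
  rwa [cPar_op] at this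

end Reg

/-- Two columns in a space of dimension at least two lie in a plane. -/
theorem exists_colPair (hm : ∃ a b : m → D, a ≠ 0 ∧ b ≠ 0 ∧ ¬ CPar a b) (x₀ x : m → D) :
    ∃ x₁, x₁ ≠ 0 ∧ ¬ CPar x₀ x₁ ∧ ∃ s, x = colPair x₀ x₁ *ᵥ s := by
  by_cases hx : x ≠ 0 ∧ ¬ CPar x₀ x
  · exact ⟨x, hx.1, hx.2, ![0, 1], by rw [colPair_mulVec]; simp⟩
  obtain ⟨x₁, h₁, h₂⟩ : ∃ x₁, x₁ ≠ 0 ∧ ¬ CPar x₀ x₁ := by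
    obtain ⟨a, b, ha, hb, hab⟩ := hm
    by_cases h : CPar x₀ a
    · exact ⟨b, hb, fun h' => hab (h.symm.trans h')⟩
    · exact ⟨a, ha, h⟩
  refine ⟨x₁, h₁, h₂, ?_⟩
  by_cases hx0 : x = 0
  · exact ⟨0, by rw [mulVec_zero, hx0]⟩
  · have : CPar x₀ x := by by_contra h; exact hx ⟨hx0, h⟩
    obtain ⟨c, -, rfl⟩ := this.exists_eq
    exact ⟨![c, 0], by rw [colPair_mulVec]; simp⟩

theorem exists_rowPair (hn : ∃ a b : n → D, a ≠ 0 ∧ b ≠ 0 ∧ ¬ RPar a b) (y₀ y : n → D) :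
    ∃ y₁, y₁ ≠ 0 ∧ ¬ RPar y₀ y₁ ∧ ∃ t, y = t ᵥ* of ![y₀, y₁] := by
  obtain ⟨a, b, ha, hb, hab⟩ := hn
  obtain ⟨x₁, h₁, h₂, s, e⟩ := exists_colPair (D := Dᵐᵒᵖ) (m := n)
    ⟨op ∘ a, op ∘ b, op_comp_ne_zero.2 ha, op_comp_ne_zero.2 hb, by rwa [cPar_op]⟩
    (op ∘ y₀) (op ∘ y)
  refine ⟨unop ∘ x₁, unop_comp_ne_zero.2 h₁, fun h => h₂ (cPar_op.2 h), unop ∘ s, ?_⟩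
  rw [colPair_mulVec] at e
  rw [vecMul_rowPair]
  ext j
  exact congrArg unop (congrFun e j)

/-! ### Gluing the standard blocks -/

namespace Reg

variable [Fintype m] [Fintype n] [Fintype p] [Fintype q]
variable {φ : Matrix m n D → Matrix p q E} {h : (m → D) → p → E} {g : (n → D) → q → E}

theorem exists_not_cPar (H : Reg φ h g) : ∃ a b : m → D, a ≠ 0 ∧ b ≠ 0 ∧ ¬ CPar a b := by
  obtain ⟨a, b, ha, hb, hab⟩ := H.col_nc
  exact ⟨a, b, ha, hb, fun hp => hab (H.col_par ha hp)⟩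

theorem exists_not_rPar (H : Reg φ h g) : ∃ a b : n → D, a ≠ 0 ∧ b ≠ 0 ∧ ¬ RPar a b := by
  obtain ⟨a, b, ha, hb, hab⟩ := H.row_nc
  exact ⟨a, b, ha, hb, fun hp => hab (H.row_par ha hp)⟩

/-- Two columns and two rows belong to a standard block. -/
theorem exists_standard_pair (H : Reg φ h g) (hφ : AdjPres φ) (h0 : φ 0 = 0)
    (hDE : OntoHoms D E) {x₀ : m → D} {y₀ : n → D} (hx₀ : x₀ ≠ 0) (hy₀ : y₀ ≠ 0)
    (x : m → D) (y : n → D) :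
    φ (x₀ ⊠ y₀ + x ⊠ y) = φ (x₀ ⊠ y₀) + φ (x ⊠ y) ∧
    ∃ (τ : D →+* E) (u₀ u : p → E) (v₀ v : q → E), ∀ d,
      φ (x₀ ⊠ (d • y₀)) = u₀ ⊠ (τ d • v₀) ∧ φ (x ⊠ (d • y₀)) = u ⊠ (τ d • v₀) ∧
      φ (x₀ ⊠ (d • y)) = u₀ ⊠ (τ d • v) ∧ φ (x ⊠ (d • y)) = u ⊠ (τ d • v) := by
  obtain ⟨x₁, hx₁, hx, s, rfl⟩ := exists_colPair H.exists_not_cPar x₀ x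
  obtain ⟨y₁, hy₁, hy, t, rfl⟩ := exists_rowPair H.exists_not_rPar y₀ y
  obtain ⟨τ, U, V, e⟩ := H.standard_block hφ h0 hDE hx₀ hx₁ hy₀ hy₁
    (H.not_cPar_of_onto hφ h0 hDE hx₀ hx₁ hx) (H.not_rPar_of_onto hφ h0 hDE hy₀ hy₁ hy)
  have c1 : colPair x₀ x₁ *ᵥ ![1, 0] = x₀ := by rw [colPair_mulVec]; simp
  have r1 : ![1, 0] ᵥ* of ![y₀, y₁] = y₀ := by rw [vecMul_rowPair]; simp
  have hs : ∀ (d : D) (t : Fin 2 → D), (τ ∘ (d • t)) ᵥ* V = τ d • ((τ ∘ t) ᵥ* V) := by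
    intro d t
    rw [← smul_vecMul]
    congr 1
    ext i; simp
  constructor
  · have := (e ![1, 0] ![1, 0]).2 s t
    rwa [c1, r1] at this
  · refine ⟨τ, U *ᵥ (τ ∘ ![1, 0]), U *ᵥ (τ ∘ s), (τ ∘ ![1, 0]) ᵥ* V, (τ ∘ t) ᵥ* V, fun d => ?_⟩
    have key := fun s t => (e s (d • t)).1
    simp only [hs, smul_vecMul] at key
    have k1 := key ![1, 0] ![1, 0]
    have k2 := key s ![1, 0]
    have k3 := key ![1, 0] t
    rw [c1, r1] at k1
    rw [r1] at k2
    rw [c1] at k3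
    exact ⟨k1, k2, k3, key s t⟩

theorem map_add_vecMulVec (H : Reg φ h g) (hφ : AdjPres φ) (h0 : φ 0 = 0)
    (hDE : OntoHoms D E) (x₀ x : m → D) (y₀ y : n → D) :
    φ (x₀ ⊠ y₀ + x ⊠ y) = φ (x₀ ⊠ y₀) + φ (x ⊠ y) := by
  by_cases hx : x₀ = 0
  · rw [hx, zero_vecMulVec, zero_add, h0, zero_add]
  by_cases hy : y₀ = 0
  · rw [hy, vecMulVec_zero_right, zero_add, h0, zero_add]
  exact (H.exists_standard_pair hφ h0 hDE hx hy x y).1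

/-- Additivity on two products says that moving the base point by one product changes nothing on
products. The shifted map is regular with the same `h` and `g`, so the move can be repeated over the
rows of `A`. -/
theorem shift_vecMulVec (H : Reg φ h g) (hφ : AdjPres φ) (h0 : φ 0 = 0) (hDE : OntoHoms D E)
    (A : Matrix m n D) : Reg (shift φ A) h g ∧ ∀ x y, shift φ A (x ⊠ y) = φ (x ⊠ y) := by
  classical
  have step : ∀ A (x₀ : m → D) (y₀ : n → D),
      (Reg (shift φ A) h g ∧ ∀ x y, shift φ A (x ⊠ y) = φ (x ⊠ y)) →
      Reg (shift φ (A + x₀ ⊠ y₀)) h g ∧ ∀ x y, shift φ (A + x₀ ⊠ y₀) (x ⊠ y) = φ (x ⊠ y) := by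
    rintro A x₀ y₀ ⟨HA, e⟩
    have key : ∀ x y, shift φ (A + x₀ ⊠ y₀) (x ⊠ y) = φ (x ⊠ y) := by
      intro x y
      rw [← shift_shift, shift, HA.map_add_vecMulVec (hφ.shift A) (shift_zero φ A) hDE,
        add_sub_cancel_left, e]
    refine ⟨⟨H.col_ne, H.row_ne, fun x y hx hy => ?_, H.col_nc, H.row_nc⟩, key⟩
    rw [key]
    exact H.map x y hx hy
  have hA : A = ∑ i, Pi.single i 1 ⊠ A i := by
    ext i j
    simp [Matrix.sum_apply, vecMulVec_apply, Pi.single_apply]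
  rw [hA]
  induction (Finset.univ : Finset m) using Finset.induction_on with
  | empty =>
    rw [Finset.sum_empty, shift_at_zero φ h0]
    exact ⟨H, fun _ _ => rfl⟩
  | insert i s hi ih =>
    rw [Finset.sum_insert hi, add_comm]
    exact step _ _ _ ih

theorem map_add (H : Reg φ h g) (hφ : AdjPres φ) (h0 : φ 0 = 0) (hDE : OntoHoms D E)
    (A B : Matrix m n D) : φ (A + B) = φ A + φ B := by
  classical
  have step : ∀ A (x : m → D) (y : n → D), φ (A + x ⊠ y) = φ A + φ (x ⊠ y) := by
    intro A x y
    rw [← (H.shift_vecMulVec hφ h0 hDE A).2, shift, add_sub_cancel]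
  have hB : B = ∑ i, Pi.single i 1 ⊠ B i := by
    ext i j
    simp [Matrix.sum_apply, vecMulVec_apply, Pi.single_apply]
  rw [hB]
  induction (Finset.univ : Finset m) using Finset.induction_on with
  | empty => rw [Finset.sum_empty, h0, add_zero, add_zero]
  | insert i s hi ih =>
    rw [Finset.sum_insert hi, add_comm (Pi.single i 1 ⊠ B i), ← add_assoc, step, step, ih,
      add_assoc]

/-- Each block has its own homomorphism; comparing it with that of the fixed product `x₀ ⊠ y₀` shows
that it is conjugate to one `τ`. After normalisation the column and the row of the image depend on
`x` and `y` alone, and additivity extends the formula from products to all matrices. -/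
theorem exists_standard (H : Reg φ h g) (hφ : AdjPres φ) (h0 : φ 0 = 0) (hDE : OntoHoms D E) :
    ∃ (τ : D →+* E) (U : Matrix p m E) (V : Matrix n q E),
      (∀ x, x ≠ 0 → U *ᵥ x ≠ 0) ∧ (∀ y, y ≠ 0 → y ᵥ* V ≠ 0) ∧ ∀ X, φ X = U * X.map τ * V := by
  classical
  obtain ⟨x₀, -, hx₀, -⟩ := H.col_nc
  obtain ⟨y₀, -, hy₀, -⟩ := H.row_nc
  obtain ⟨-, τ, u₀, _, v₀, _, e₀⟩ := H.exists_standard_pair hφ h0 hDE hx₀ hy₀ x₀ y₀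
  replace e₀ := fun d => (e₀ d).1
  have hne : φ (x₀ ⊠ y₀) ≠ 0 := H.map_ne_zero hx₀ hy₀
  have e₁ := e₀ 1
  rw [one_smul, _root_.map_one, one_smul] at e₁
  rw [e₁] at hne
  have hu₀ : u₀ ≠ 0 := by rintro rfl; simp at hne
  have hv₀ : v₀ ≠ 0 := by rintro rfl; simp at hne
  have cr : ∀ {w w' : q → E} {u : p → E}, u ≠ 0 → u ⊠ w = u ⊠ w' → w = w' := by
    intro w w' u hu hw
    obtain ⟨i, hi⟩ := Function.ne_iff.1 hu
    ext j
    have := congrFun (congrFun hw i) j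
    exact mul_left_cancel₀ hi this
  have cl : ∀ {w w' : p → E} {v : q → E}, v ≠ 0 → w ⊠ v = w' ⊠ v → w = w' := by
    intro w w' v hv hw
    obtain ⟨j, hj⟩ := Function.ne_iff.1 hv
    ext i
    have := congrFun (congrFun hw i) j
    exact mul_right_cancel₀ hj this
  have key : ∀ x y, ∃ u v, ∀ d, φ (x ⊠ (d • y₀)) = u ⊠ (τ d • v₀) ∧
      φ (x₀ ⊠ (d • y)) = u₀ ⊠ (τ d • v) ∧ φ (x ⊠ (d • y)) = u ⊠ (τ d • v) := by
    intro x y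
    obtain ⟨-, τ', u₀', u, v₀', v, e⟩ := H.exists_standard_pair hφ h0 hDE hx₀ hy₀ x y
    have e1 := (e 1).1
    rw [_root_.map_one, one_smul, one_smul, e₁] at e1
    obtain ⟨c, hc, ec⟩ := (cPar_and_rPar_of_vecMulVec_eq hu₀ hv₀ e1).1.exists_eq
    subst ec
    rw [smul_op_vecMulVec] at e1
    have ev := cr hu₀ e1
    -- `x₀ ⊠ (d • y₀)` computed in both blocks: `c` conjugates `τ'` into `τ` and is absorbed into
    -- `u` and `v`.
    have eτ : ∀ d, c * τ' d = τ d * c := by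
      intro d
      have := (e d).1
      rw [e₀, smul_op_vecMulVec] at this
      have := cr hu₀ this
      rw [ev, smul_smul, smul_smul] at this
      have hv' : v₀' ≠ 0 := by rintro rfl; exact hv₀ (by rw [ev, smul_zero])
      exact (smul_left_injective E hv' this).symm
    refine ⟨MulOpposite.op c⁻¹ • u, c • v, fun d => ⟨?_, ?_, ?_⟩⟩
    · rw [(e d).2.1, smul_op_vecMulVec, ev, smul_smul, smul_smul, mul_assoc, ← eτ,
        inv_mul_cancel_left₀ hc]
    · rw [(e d).2.2.1, smul_op_vecMulVec, smul_smul, smul_smul, eτ]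
    · rw [(e d).2.2.2, smul_op_vecMulVec, smul_smul, smul_smul, mul_assoc, ← eτ,
        inv_mul_cancel_left₀ hc]
  choose u v e using key
  have eu : ∀ x y, u x y = u x y₀ := by
    intro x y
    have h1 := (e x y 1).1
    rw [(e x y₀ 1).1, _root_.map_one, one_smul] at h1
    exact (cl hv₀ h1).symm
  have evv : ∀ x y, v x y = v x₀ y := by
    intro x y
    have h1 := (e x y 1).2.1
    rw [(e x₀ y 1).2.1, _root_.map_one, one_smul, one_smul] at h1
    exact (cr hu₀ h1).symm
  have hd : ∀ x y d, φ (x ⊠ (d • y)) = u x y₀ ⊠ (τ d • v x₀ y) := fun x y d => by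
    rw [(e x y d).2.2, eu, evv]
  set U : Matrix p m E := of fun k i => u (Pi.single i 1) y₀ k with hU
  set V : Matrix n q E := of fun j l => v x₀ (Pi.single j 1) l with hV
  have hX : ∀ X, φ X = U * X.map τ * V := by
    intro X
    have eX : X = ∑ i, ∑ j, Pi.single i 1 ⊠ (X i j • Pi.single j 1) := by
      ext i j
      simp [Matrix.sum_apply, vecMulVec_apply, Pi.single_apply]
    have hs : φ X = ∑ i, ∑ j, φ (Pi.single i 1 ⊠ (X i j • Pi.single j 1)) := by
      let f : Matrix m n D →+ Matrix p q E :=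
        { toFun := φ, map_zero' := h0, map_add' := H.map_add hφ h0 hDE }
      have := congrArg f eX
      simp only [map_sum] at this
      exact this
    rw [hs]
    ext k l
    simp only [hd, Matrix.sum_apply, vecMulVec_apply, Matrix.mul_apply, Finset.sum_mul,
      Matrix.map_apply, Pi.smul_apply, smul_eq_mul, hU, hV, of_apply]
    rw [Finset.sum_comm]
    simp only [mul_assoc]
  -- Vectors over `E` are lifted entrywise through `τ`; products have nonzero images, so `U` and `V`
  -- kill no nonzero vector.
  have hrank : ∀ x y, x ≠ 0 → y ≠ 0 → (U *ᵥ x) ⊠ (y ᵥ* V) ≠ 0 := by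
    intro x y hx hy
    choose f hf using hDE.surjective τ
    have h1 : τ ∘ (f ∘ x) = x := funext fun i => hf _
    have h2 : τ ∘ (f ∘ y) = y := funext fun i => hf _
    have n1 : f ∘ x ≠ 0 := by
      intro h; rw [h] at h1; exact hx (by rw [← h1]; ext i; simp)
    have n2 : f ∘ y ≠ 0 := by
      intro h; rw [h] at h2; exact hy (by rw [← h2]; ext i; simp)
    have := H.map_ne_zero n1 n2
    rwa [hX, map_vecMulVec, h1, h2, mul_vecMulVec, vecMulVec_mul] at this
  obtain ⟨x, hx⟩ : ∃ x : m → E, x ≠ 0 :=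
    ⟨τ ∘ x₀, fun h => hx₀ (by ext i; exact (map_eq_zero τ).1 (congrFun h i))⟩
  obtain ⟨y, hy⟩ : ∃ y : n → E, y ≠ 0 :=
    ⟨τ ∘ y₀, fun h => hy₀ (by ext i; exact (map_eq_zero τ).1 (congrFun h i))⟩
  refine ⟨τ, U, V, fun z hz h => hrank z y hz hy ?_, fun z hz h => hrank x z hx hz ?_, hX⟩
  · rw [h, zero_vecMulVec]
  · rw [h, vecMulVec_zero_right]

end Reg

/-! ### Rank, degenerate and standard maps -/

theorem IsEAS.ontoHoms (hD : IsEAS D) : OntoHoms D D := ⟨hD, id⟩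

/-- A homomorphism followed by its opposite is an endomorphism of `D`, up to the identification with
the double opposite; it is onto, hence so is the homomorphism. -/
theorem IsEAS.ontoHoms_op (hD : IsEAS D) : OntoHoms D Dᵐᵒᵖ where
  surjective f e := by
    obtain ⟨d, hd⟩ := hD ((RingEquiv.opOp D).symm.toRingHom.comp ((RingHom.op f).comp f)) (unop e)
    exact ⟨unop (f d), unop_injective hd⟩
  binary h e := (h (unop e)).imp (congrArg MulOpposite.op) (congrArg MulOpposite.op)

section Rank

variable {m n p q : ℕ}

theorem rowRank_eq_zero {M : Matrix (Fin m) (Fin n) D} : rowRank M = 0 ↔ M = 0 := by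
  rw [rowRank, Submodule.finrank_eq_zero, Submodule.span_eq_bot]
  constructor
  · intro h
    ext i j
    exact congrFun (h _ ⟨i, rfl⟩) j
  · rintro rfl _ ⟨i, rfl⟩
    rfl

theorem rowRank_eq_one {M : Matrix (Fin m) (Fin n) D} : rowRank M = 1 ↔ IsRankOne M := by
  constructor
  · intro h
    have hM : M ≠ 0 := by
      intro h0
      rw [← rowRank_eq_zero, h] at h0
      exact one_ne_zero h0
    rw [rowRank, finrank_eq_one_iff'] at h
    obtain ⟨⟨v, hv⟩, -, h⟩ := h
    have : ∀ i, ∃ c : D, M i = c • v := fun i => by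
      obtain ⟨c, hc⟩ := h ⟨M i, Submodule.subset_span ⟨i, rfl⟩⟩
      exact ⟨c, (congrArg Subtype.val hc).symm⟩
    choose x hx using this
    have e : M = x ⊠ v := by
      ext i j
      rw [hx i]
      rfl
    rw [e] at hM ⊢
    exact isRankOne_of_ne_zero hM
  · rintro ⟨x, y, hx, hy, rfl⟩
    have : Submodule.span D (Set.range (x ⊠ y).row) = D ∙ y := by
      apply le_antisymm
      · rw [Submodule.span_le]
        rintro _ ⟨i, rfl⟩
        exact Submodule.mem_span_singleton.2 ⟨x i, rfl⟩
      · rw [Submodule.span_singleton_le_iff_mem]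
        obtain ⟨i, hi⟩ := Function.ne_iff.1 hx
        have : y = (x i)⁻¹ • (x ⊠ y).row i := by
          ext j
          simp [vecMulVec_apply, Matrix.row, inv_mul_cancel_left₀ hi]
        have h := Submodule.smul_mem (Submodule.span D (Set.range (x ⊠ y).row)) (x i)⁻¹
          (Submodule.subset_span ⟨i, rfl⟩)
        rwa [← this] at h
    rw [rowRank, this, finrank_span_singleton hy]

theorem PreservesAdjacency.adjPres {φ : Matrix (Fin m) (Fin n) D → Matrix (Fin p) (Fin q) D}
    (hφ : PreservesAdjacency φ) : AdjPres φ := fun A B h =>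
  rowRank_eq_one.1 (hφ A B (rowRank_eq_one.2 h))

theorem DegenerateAtZero.isDegenerateAt {φ : Matrix (Fin m) (Fin n) D → Matrix (Fin p) (Fin q) D}
    {A : Matrix (Fin m) (Fin n) D} (h : DegenerateAtZero (shift φ A)) : IsDegenerateAt φ A := by
  obtain ⟨a, b, ha, hb, h⟩ := h
  refine ⟨a, b, ha, hb, ?_⟩
  rintro _ ⟨B, hB, rfl⟩
  rcases Nat.le_one_iff_eq_zero_or_eq_one.1 hB with h0 | h1
  · rw [rowRank_eq_zero, sub_eq_zero] at h0
    subst h0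
    exact Or.inl ⟨0, ⟨0, zero_vecMulVec b⟩, add_zero _⟩
  · obtain ⟨x, y, hx, hy, e⟩ := rowRank_eq_one.1 h1
    -- `unitBall` uses `A - B` while `shift` uses `A + X`, whence the sign.
    have eB : A + (-x) ⊠ y = B := by
      rw [neg_vecMulVec, ← e]
      abel
    rcases h (-x) y (neg_ne_zero.2 hx) hy with ⟨r, hr⟩ | ⟨r, hr⟩
    · refine Or.inr ⟨_, ⟨r, rfl⟩, ?_⟩
      show φ A + a ⊠ r = φ B
      rw [← hr, shift, eB, add_sub_cancel]
    · refine Or.inl ⟨_, ⟨r, rfl⟩, ?_⟩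
      show φ A + r ⊠ b = φ B
      rw [← hr, shift, eB, add_sub_cancel]

/-! ### Completion to invertible matrices -/

/-- A matrix with independent rows can be completed to an invertible matrix. -/
theorem exists_isUnit_rows {V : Matrix (Fin n) (Fin q) D} (hV : ∀ y, y ≠ 0 → y ᵥ* V ≠ 0) :
    ∃ (h : n ≤ q) (S : Matrix (Fin q) (Fin q) D), IsUnit S ∧ ∀ i, S (Fin.castLE h i) = V i := by
  have hli : LinearIndependent D (fun i => V i) := by
    rw [Fintype.linearIndependent_iff]
    intro y hy i
    by_contra hi
    refine hV y (fun h => hi (congrFun h i)) ?_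
    rw [← hy]
    ext j
    simp [vecMul, dotProduct]
  let b := Module.Basis.sumExtend hli
  have : Finite (Fin n ⊕ Module.Basis.sumExtendIndex hli) := Module.Finite.finite_basis b
  have : Finite (Module.Basis.sumExtendIndex hli) := Finite.sum_right (Fin n)
  obtain ⟨k, ⟨e⟩⟩ := Finite.exists_equiv_fin (Module.Basis.sumExtendIndex hli)
  let b' := b.reindex (((Equiv.refl (Fin n)).sumCongr e).trans finSumFinEquiv)
  have hk : n + k = q := by
    have := Module.finrank_eq_card_basis b'
    simpa [eq_comm] using this
  subst hk
  have hb : ∀ i, b' (Fin.castLE (Nat.le_add_right n k) i) = V i := by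
    intro i
    have h1 : finSumFinEquiv.symm (Fin.castLE (Nat.le_add_right n k) i) = Sum.inl i := by
      rw [Equiv.symm_apply_eq]; rfl
    rw [Module.Basis.reindex_apply, Equiv.symm_trans_apply, h1]
    simp only [b, Module.Basis.sumExtend, Module.Basis.reindex_apply, Module.Basis.coe_extend]
    rfl
  refine ⟨Nat.le_add_right n k, of fun i => b' i, ?_, hb⟩
  set S : Matrix (Fin (n + k)) (Fin (n + k)) D := of fun i => b' i
  -- The inverse of the matrix of basis rows consists of the coordinates of the standard vectors in
  -- that basis.
  set S' : Matrix (Fin (n + k)) (Fin (n + k)) D := of fun j i => b'.repr (Pi.single j 1) i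
  refine ⟨⟨S, S', ?_, ?_⟩, rfl⟩
  · ext i l
    have h1 : b' i = ∑ j, b' i j • Pi.single j (1 : D) := by
      ext j
      simp [Finset.sum_apply, Pi.single_apply]
    have h2 := congrArg (fun v => b'.repr v l) h1
    simp only [map_sum, map_smul, Module.Basis.repr_self] at h2
    rw [Matrix.mul_apply, Matrix.one_apply]
    simpa [Finsupp.single_apply, S, S'] using h2.symm
  · ext j l
    have h1 := congrFun (b'.sum_repr (Pi.single j (1 : D))) l
    rw [Matrix.mul_apply, Matrix.one_apply]
    simpa [Finset.sum_apply, Pi.single_apply, S, S', eq_comm] using h1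

theorem unopT_mul {k : ℕ} (M : Matrix (Fin m) (Fin n) Dᵐᵒᵖ) (N : Matrix (Fin n) (Fin k) Dᵐᵒᵖ) :
    unopT (M * N) = unopT N * unopT M := by
  ext i j
  simp [Matrix.mul_apply, Finset.unop_sum]

theorem isUnit_unopT {M : Matrix (Fin n) (Fin n) Dᵐᵒᵖ} (h : IsUnit M) : IsUnit (unopT M) := by
  obtain ⟨⟨M, N, h1, h2⟩, rfl⟩ := h
  have e : unopT (1 : Matrix (Fin n) (Fin n) Dᵐᵒᵖ) = 1 := by
    ext i j
    rw [unopT_apply, Matrix.one_apply, Matrix.one_apply]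
    by_cases hij : i = j
    · subst hij; simp
    · rw [if_neg hij, if_neg fun h => hij h.symm, unop_zero]
  exact ⟨⟨unopT M, unopT N, by rw [← unopT_mul, h2, e], by rw [← unopT_mul, h1, e]⟩, rfl⟩

/-- A matrix with independent columns can be completed to an invertible matrix. -/
theorem exists_isUnit_cols {U : Matrix (Fin p) (Fin m) D} (hU : ∀ x, x ≠ 0 → U *ᵥ x ≠ 0) :
    ∃ (h : m ≤ p) (T : Matrix (Fin p) (Fin p) D), IsUnit T ∧
      ∀ k i, T k (Fin.castLE h i) = U k i := by
  obtain ⟨h, S, hS, e⟩ := exists_isUnit_rows (V := opT U) (fun y hy h0 =>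
    hU (unop ∘ y) (unop_comp_ne_zero.2 hy) (by
      ext i
      have := congrArg unop (congrFun h0 i)
      simpa [vecMul, mulVec, dotProduct, Finset.unop_sum] using this))
  exact ⟨h, unopT S, isUnit_unopT hS, fun k i => congrArg unop (congrFun (e i) k)⟩

/-- `corner` is multiplication by two inclusion matrices, which select the given columns of `T` and
rows of `S`. -/
theorem mul_corner_mul {U : Matrix (Fin p) (Fin m) D} {V : Matrix (Fin n) (Fin q) D}
    {T : Matrix (Fin p) (Fin p) D} {S : Matrix (Fin q) (Fin q) D} (hm : m ≤ p) (hn : n ≤ q)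
    (hT : ∀ k i, T k (Fin.castLE hm i) = U k i) (hS : ∀ i, S (Fin.castLE hn i) = V i)
    (B : Matrix (Fin m) (Fin n) D) : T * corner p q B * S = U * B * V := by
  set J : Matrix (Fin p) (Fin m) D := of fun a i => if a = Fin.castLE hm i then 1 else 0
  set J' : Matrix (Fin n) (Fin q) D := of fun j b => if b = Fin.castLE hn j then 1 else 0
  have hU : T * J = U := by
    ext k i
    simp [J, Matrix.mul_apply, hT]
  have hV : J' * S = V := by
    ext j l
    simp [J', Matrix.mul_apply, hS]
  have hc : corner p q B = J * B * J' := by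
    ext a b
    by_cases hb : (b : ℕ) < n
    · obtain ⟨j, rfl⟩ : ∃ j, b = Fin.castLE hn j := ⟨⟨b, hb⟩, rfl⟩
      by_cases ha : (a : ℕ) < m
      · obtain ⟨i, rfl⟩ : ∃ i, a = Fin.castLE hm i := ⟨⟨a, ha⟩, rfl⟩
        simp [corner, J, J', Matrix.mul_apply]
      · have : ∀ i, a ≠ Fin.castLE hm i := by rintro i rfl; exact ha i.2
        simp [corner, J, J', Matrix.mul_apply, ha, this]
    · have : ∀ j, b ≠ Fin.castLE hn j := by rintro j rfl; exact hb j.2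
      simp [corner, J', Matrix.mul_apply, hb, this]
  rw [hc, ← hU, ← hV]
  simp only [Matrix.mul_assoc]

variable {φ : Matrix (Fin m) (Fin n) D → Matrix (Fin p) (Fin q) D} {A : Matrix (Fin m) (Fin n) D}

theorem isStandardAut_of_shift {τ : D ≃+* D} {U : Matrix (Fin p) (Fin m) D}
    {V : Matrix (Fin n) (Fin q) D} (hU : ∀ x, x ≠ 0 → U *ᵥ x ≠ 0) (hV : ∀ y, y ≠ 0 → y ᵥ* V ≠ 0)
    (h : ∀ X, shift φ A X = U * X.map τ * V) : IsStandardAut φ := by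
  obtain ⟨hm, T, hT, eT⟩ := exists_isUnit_cols hU
  obtain ⟨hn, S, hS, eS⟩ := exists_isUnit_rows hV
  refine ⟨hm, hn, τ, T, S, φ A - U * A.map τ * V, hT, hS, fun X => ?_⟩
  have h1 := h (X - A)
  rw [shift, add_sub_cancel] at h1
  have h2 : (X - A).map τ = X.map τ - A.map τ := by ext; simp
  rw [mul_corner_mul hm hn eT eS, ← sub_eq_zero]
  rw [h2, Matrix.mul_sub, Matrix.sub_mul, ← sub_eq_zero] at h1
  rw [← h1]
  abel

theorem isStandardAnti_of_shift {σ : D ≃+* Dᵐᵒᵖ} {U : Matrix (Fin p) (Fin n) D}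
    {V : Matrix (Fin m) (Fin q) D} (hU : ∀ x, x ≠ 0 → U *ᵥ x ≠ 0) (hV : ∀ y, y ≠ 0 → y ᵥ* V ≠ 0)
    (h : ∀ X, shift φ A X = U * unopT (X.map σ) * V) : IsStandardAnti φ := by
  obtain ⟨hm, T, hT, eT⟩ := exists_isUnit_cols hU
  obtain ⟨hn, S, hS, eS⟩ := exists_isUnit_rows hV
  refine ⟨hm, hn, σ, T, S, φ A - U * unopT (A.map σ) * V, hT, hS, fun X => ?_⟩
  have h1 := h (X - A)
  rw [shift, add_sub_cancel] at h1
  have h2 : unopT ((X - A).map σ) = unopT (X.map σ) - unopT (A.map σ) := by ext; simp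
  rw [mul_corner_mul hm hn eT eS, ← sub_eq_zero]
  rw [h2, Matrix.mul_sub, Matrix.sub_mul, ← sub_eq_zero] at h1
  rw [← h1]
  have h3 : (X.map fun a => unop (σ a)).transpose = unopT (X.map σ) := rfl
  rw [h3]
  abel

end Rank

end HuaGeometry
end

theorem theorem1p2 {D : Type*} [DivisionRing D] (hD : HuaGeometry.IsEAS D)
    (m n p q : ℕ) (hm : 0 < m) (hn : 0 < n) (hp : 0 < p) (hq : 0 < q)
    (φ : Matrix (Fin m) (Fin n) D → Matrix (Fin p) (Fin q) D)
    (hφ : HuaGeometry.PreservesAdjacency φ) :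
    HuaGeometry.IsDegenerate φ ∨ HuaGeometry.IsStandard φ := by
  open HuaGeometry MulOpposite in
  refine or_iff_not_imp_left.2 fun hdeg => ?_
  simp only [IsDegenerate, not_forall] at hdeg
  obtain ⟨A, hA⟩ := hdeg
  have : Nonempty (Fin p) := ⟨⟨0, hp⟩⟩
  have : Nonempty (Fin q) := ⟨⟨0, hq⟩⟩
  have hs := hφ.adjPres.shift A
  rcases degenerate_or_reg hs (shift_zero φ A) with h | ⟨h, g, H⟩ | ⟨h, g, H⟩
  · exact absurd h.isDegenerateAt hA
  · obtain ⟨τ, U, V, hU, hV, e⟩ := H.exists_standard hs (shift_zero φ A) hD.ontoHoms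
    exact Or.inl (isStandardAut_of_shift (τ := RingEquiv.ofBijective τ ⟨τ.injective, hD τ⟩)
      hU hV e)
  -- Transposed case: the regular map takes values over the opposite ring. Undoing `opT` reverses
  -- products, so `U` and `V` change places and the homomorphism becomes an anti-automorphism of
  -- `D`.
  · have hs' : AdjPres (fun X => opT (shift φ A X)) := fun X Y hXY => (hs X Y hXY).opT
    obtain ⟨τ, U, V, hU, hV, e⟩ := H.exists_standard hs' (by rw [shift_zero, opT_zero])
      hD.ontoHoms_op
    refine Or.inr (isStandardAnti_of_shift (A := A) (U := unopT V) (V := unopT U)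
      (σ := RingEquiv.ofBijective τ ⟨τ.injective, hD.ontoHoms_op.surjective τ⟩) ?_ ?_ ?_)
    · intro x hx h0
      refine hV (op ∘ x) (op_comp_ne_zero.2 hx) ?_
      ext i
      have := congrArg op (congrFun h0 i)
      simpa [Matrix.vecMul, Matrix.mulVec, dotProduct] using this
    · intro y hy h0
      refine hU (op ∘ y) (op_comp_ne_zero.2 hy) ?_
      ext i
      have := congrArg op (congrFun h0 i)
      simpa [Matrix.vecMul, Matrix.mulVec, dotProduct] using this
    · intro X
      have := congrArg unopT (e X)
      rw [unopT_opT, unopT_mul, unopT_mul, ← Matrix.mul_assoc] at this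
      exact this
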